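/- **Setting.** Let $\kappa_1<\dots<\kappa_n$ be real and generic: for each $1<p<n$, the sums of $p$ distinct $\kappa$'s are pairwise distinct. Let $I\subset[n]$ with $|I|=k$. The Young diagram $\lambda(I)$ in a $k\times(n-k)$ rectangle is the one whose south-east border, with steps labelled $1,\dots,n$ from north-east to south-west, has vertical steps exactly $I$. Rows are labelled by $i\in I$, columns by $j\notin I$, and there is a box $(i,j)$ iff $i<j$. A box lying $r$ rows below the top row and $c$ columns left of the rightmost column of the rectangle carries the simple transposition $s_{r+c+1}=(r+c+1,\,r+c+2)$. Fix a reading order of the boxes (a linear order in which no box is followed by a box weakly south-east of it). It gives a reduced word $\mathbf w$ of a permutation $w$. **Go-diagrams and Deodhar components.** A Go-diagram $D$ is a filling of the boxes by blanks, white stones and black stones such that, with $u$ the product of the $s_{b'}$ over the non-blank boxes $b'$ read before $b$: $\ell(us_b)>\ell(u)$ if $b$ is blank or white, and $\ell(us_b)<\ell(u)$ if $b$ is black. Equivalently, the $s_b$ of the boxes with stones form a distinguished subexpression $\mathbf v$ of $\mathbf w$, with white (black) stones at length-increasing (length-decreasing) factors. Let $v$ be the product of $\mathbf v$ and $\pi(D)=vw^{-1}$.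 Number rows and columns of $n\times n$ matrices from the bottom right corner, and let $x_i(m),y_i(p),\dot s_i$ be the images of $\begin{pmatrix}1&m\\0&1\end{pmatrix},\begin{pmatrix}1&0\\p&1\end{pmatrix},\begin{pmatrix}0&-1\\1&0\end{pmatrix}$ in the $2\times2$ block with indices $i+1,i$. The Deodhar component $S_D\subset Gr_{k,n}(\mathbb R)$ is the set of spans of the leftmost $k$ columns of products, in reading order, of factors $y_{b}(p_b)$ ($p_b\neq0$) for blank boxes, $\dot s_b$ for white stones and $x_b(m_b)\dot s_b^{-1}$ ($m_b\in\mathbb R$) for black stones; here $y_b,\dot s_b,x_b$ are $y_i,\dot s_i,x_i$ for the index $i$ with $s_b=s_i$. For a matroid $\mathcal M$, $S_{\mathcal M}$ is the set of $A\in Gr_{k,n}(\mathbb R)$ with $\Delta_J(A)\ne0\iff J$ is a basis of $\mathcal M$. **The graph $G_-(D)$.** Replace stones by crosses and blank boxes by two elbows, one joining the east and north sides of the box and one joining its south and west sides. This gives $n$ pipes from the south-east to the north-west border; label the north-west end of each pipe by the label of its starting step. In each blank box put a white vertex on the north-east elbow and a black vertex on the south-west elbow, joined by an edge. Erase, at the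 south-east border, the straight piece of each pipe before its first elbow. Replace each pipe without elbows by an isolated boundary vertex with its label, coloured $1$ (horizontal pipe) or $-1$ (vertical pipe). Forget vertices of degree $2$. The boundary vertices are the ends of the rows at the west and of the columns at the north. The trip $T_a$ starts at the boundary vertex labelled $a$, turns right at black vertices, left at white vertices, and goes straight through crossings, until it reaches a boundary vertex; at an isolated vertex it starts and ends there. The trip permutation sends $a$ to the label of the endpoint of $T_a$. Each edge is labelled by all $a$ such that $T_a$ runs along it. **Contour plots.** Put $\phi_i(\bar x,\bar y)=\kappa_i\bar x+\kappa_i^2\bar y+\kappa_i^3$. $\mathcal C_{-\infty}(\mathcal M)\subset\mathbb R^2$ is the locus where $\min_{J}\sum_{j\in J}\phi_j$ ($J$ over bases of $\mathcal M$) is not linear (not locally affine). For $A\in Gr_{k,n}(\mathbb R)$, $\mathcal C_t(u_A)\subset\mathbb R^2$ is the locus where $(x,y)\mapsto\max_{\Delta_J(A)\neq0}\sum_{j\in J}(\kappa_jx+\kappa_j^2y+\kappa_j^3t)$ is not linear. A non-horizontal direction $(a,b)$ has slope $-a/b$ (the tangent of the angle measured counterclockwise from the positive vertical axis). **Theorem.**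 Let $D$ be a Go-diagram. 1. $G_-(D)$ is a generalized plabic graph, and its trip permutation is $\pi(D)$. 2. Every edge of $G_-(D)$ has exactly two labels $i<j$ (write $[i,j]$). Every internal vertex is trivalent, and its edges are labelled $[i,\ell],[i,m],[\ell,m]$ for some $i<\ell<m$. 3. Place each such vertex at $v_{i,\ell,m}=(\kappa_i\kappa_\ell+\kappa_i\kappa_m+\kappa_\ell\kappa_m,\,-(\kappa_i+\kappa_\ell+\kappa_m))$. These points are distinct for distinct vertices. For every edge $[i,j]$ between two trivalent vertices, the segment between its endpoints has slope $\kappa_i+\kappa_j$. 4. Draw each edge between two trivalent vertices as a line segment. Draw each edge $[i,j]$ from a trivalent vertex to a boundary vertex as a ray of slope $\kappa_i+\kappa_j$, with $\bar y\to-\infty$ if the boundary vertex is at the west side and $\bar y\to+\infty$ if it is at the north side. Draw each edge $[i,j]$ between two boundary vertices as the line $\phi_i=\phi_j$ (of slope $\kappa_i+\kappa_j$). Then, for every matroid $\mathcal M$ whose stratum $S_{\mathcal M}$ meets (equivalently, is nonempty and contained in) $S_D$, the union of these pieces is exactly $\mathcal C_{-\infty}(\mathcal M)$. 5. In particular, $\mathcal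 C_{-\infty}(\mathcal M)=\mathcal C_{-\infty}(\mathcal M')$ whenever $S_{\mathcal M}$ and $S_{\mathcal M'}$ both meet $S_D$. 6. If $S_{\mathcal M}$ meets $S_D$ and $A\in S_{\mathcal M}$, then for every $t<0$ the rescaled contour plot $|t|^{-1}\,\mathcal C_t(u_A)$ equals $-\mathcal C_{-\infty}(\mathcal M)$, the image of $\mathcal C_{-\infty}(\mathcal M)$ under the $180^\circ$ rotation; in particular this rotated plot is the limit, in the Hausdorff distance, of $|t|^{-1}\,\mathcal C_t(u_A)$ as $t\to-\infty$. -/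

import Mathlib

open Topology Filter

namespace KPSoliton

noncomputable section

/-! ### Young diagrams, reading orders and Go-diagrams

A Young diagram contained in a `k × (n-k)` rectangle is given by the set `I` of the `k` labels of
the vertical steps of its south-east border, whose `n` steps are labelled from north-east to
south-west (here by `Fin n`, that is, from `0` to `n - 1`).  Rows are labelled by the elements of
`I` (labels increase from top to bottom), columns by the elements of the complement (labels
increase from right to left); row `i` and column `j` meet in a box exactly when `i < j`. -/

/-- `b = (i, j)` is the box in row `i` and column `j` of the Young diagram of `I`. -/
def IsBox {n : ℕ} (I : Finset (Fin n)) (b : Fin n × Fin n) : Prop :=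
  b.1 ∈ I ∧ b.2 ∉ I ∧ b.1 < b.2

/-- The boxes of the Young diagram of `I`. -/
abbrev Box {n : ℕ} (I : Finset (Fin n)) : Type := {b : Fin n × Fin n // IsBox I b}

/-- A box lying `r` rows below the top row and `c` columns to the left of the rightmost column of
the `k × (n-k)` rectangle carries the simple generator exchanging the (zero-based) positions `r + c`
and `r + c + 1`; this is `r + c`. -/
def genIndex {n : ℕ} {I : Finset (Fin n)} (b : Box I) : ℕ :=
  (I.filter (fun i => i < b.1.1)).card + (Iᶜ.filter (fun j => j < b.1.2)).card

/-- The simple reflection exchanging the zero-based positions `m` and `m + 1`. -/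
def simpleReflection (n m : ℕ) : Equiv.Perm (Fin n) :=
  if h : m + 1 < n then Equiv.swap ⟨m, Nat.lt_of_succ_lt h⟩ ⟨m + 1, h⟩ else 1

/-- The Coxeter length of a permutation: its number of inversions. -/
def permLength {n : ℕ} (v : Equiv.Perm (Fin n)) : ℕ :=
  (Finset.univ.filter (fun p : Fin n × Fin n => p.1 < p.2 ∧ v p.2 < v p.1)).card

/-- The list `e` is a reading order (linear extension) of the Young diagram: it contains every box,
and a box is never followed by a box weakly south-east of it. -/
def IsReadingOrder {n : ℕ} {I : Finset (Fin n)} (e : List (Box I)) : Prop :=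
  (∀ b, b ∈ e) ∧ e.Pairwise (fun b b' => ¬ (b.1.1 ≤ b'.1.1 ∧ b'.1.2 ≤ b.1.2))

/-- The possible contents of a box. -/
inductive Stone : Type
  | blank
  | white
  | black

/-- The permutation `w` with reduced word `𝐰` given by the reading order `e`. -/
def wordPerm {n : ℕ} {I : Finset (Fin n)} (e : List (Box I)) : Equiv.Perm (Fin n) :=
  (e.map (fun b => simpleReflection n (genIndex b))).prod

open Classical in
/-- The product of the factors of the subexpression `𝐯` in the listed boxes: the simple generator
for a box with a stone, and `1` for a blank box. -/
def subexprPerm {n : ℕ} {I : Finset (Fin n)} (D : Box I → Stone) (e : List (Box I)) :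
    Equiv.Perm (Fin n) :=
  (e.map (fun b => if D b = Stone.blank then 1 else simpleReflection n (genIndex b))).prod

/-- `D` is a Go-diagram: with `u` the partial product of the subexpression `𝐯` before the box `b`,
the subexpression is distinguished (a generator that decreases the length of `u` may not be
omitted), the white stones mark the factors that increase the length and the black stones those
that decrease it.  (As `u` and `u s` are always comparable in the Bruhat order, comparing them
amounts to comparing lengths.) -/
def IsGoDiagram {n : ℕ} {I : Finset (Fin n)} (e : List (Box I)) (D : Box I → Stone) : Prop :=
  ∀ (pre post : List (Box I)) (b : Box I), e = pre ++ b :: post →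
    let u := subexprPerm D pre
    let us := u * simpleReflection n (genIndex b)
    (D b = Stone.blank → permLength u < permLength us) ∧
    (D b = Stone.white → permLength u < permLength us) ∧
    (D b = Stone.black → permLength us < permLength u)

/-- The permutation `π(D) = v w⁻¹`. -/
def goPerm {n : ℕ} {I : Finset (Fin n)} (e : List (Box I)) (D : Box I → Stone) :
    Equiv.Perm (Fin n) :=
  subexprPerm D e * (wordPerm e)⁻¹

/-! ### The Grassmannian, its matroid strata and its Deodhar components

A point of the Grassmannian is represented by a `k × n` matrix of rank `k`. -/

/-- The Plücker coordinate `Δ_J(A)`: the maximal minor of `A` in the columns `J`. -/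
def plucker {k n : ℕ} (A : Matrix (Fin k) (Fin n) ℝ) (J : Finset (Fin n)) (h : J.card = k) : ℝ :=
  (A.submatrix id (J.orderEmbOfFin h)).det

/-- The matroid stratum of `M`: the points whose nonzero Plücker coordinates are those indexed by
the bases of `M`.  (A matroid has a basis, so such a matrix has rank `k`.) -/
def matroidStratum {n : ℕ} (k : ℕ) (M : Matroid (Fin n)) : Set (Matrix (Fin k) (Fin n) ℝ) :=
  {A | ∀ J : Finset (Fin n), M.IsBase (J : Set (Fin n)) ↔ ∃ h : J.card = k, plucker A J h ≠ 0}

/-- The image of the `2 × 2` matrix with rows `(a, b)` and `(c, d)` under the homomorphism `φ` that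
belongs to the generator with zero-based index `m`.  Rows and columns of the `n × n` matrices are
numbered from the bottom right corner, so `a` is the diagonal entry with index `m + 1`
and `d` the one with index `m`. -/
def blockMatrix (n m : ℕ) (a b c d : ℝ) : Matrix (Fin n) (Fin n) ℝ :=
  Matrix.of fun r s =>
    if (r : ℕ) = m + 1 ∧ (s : ℕ) = m + 1 then a
    else if (r : ℕ) = m + 1 ∧ (s : ℕ) = m then b
    else if (r : ℕ) = m ∧ (s : ℕ) = m + 1 then c
    else if (r : ℕ) = m ∧ (s : ℕ) = m then d
    else if r = s then 1 else 0

/-- The factor of an element of `G_{𝐯,𝐰}` in the box `b`: `y(p)` for a blank box, the representative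
`ṡ` for a white stone, and `x(q) ṡ⁻¹` for a black stone. -/
def boxFactor {n : ℕ} {I : Finset (Fin n)} (D : Box I → Stone) (p q : Box I → ℝ) (b : Box I) :
    Matrix (Fin n) (Fin n) ℝ :=
  match D b with
  | Stone.blank => blockMatrix n (genIndex b) 1 0 (p b) 1
  | Stone.white => blockMatrix n (genIndex b) 0 (-1) 1 0
  | Stone.black => blockMatrix n (genIndex b) 1 (q b) 0 1 * blockMatrix n (genIndex b) 0 1 (-1) 0

/-- The set `G_{𝐯,𝐰}` of Marsh and Rietsch for the reduced word `𝐰` given by `e` and the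
distinguished subexpression `𝐯` given by `D`. -/
def marshRietsch {n : ℕ} {I : Finset (Fin n)} (e : List (Box I)) (D : Box I → Stone) :
    Set (Matrix (Fin n) (Fin n) ℝ) :=
  {g | ∃ p q : Box I → ℝ, (∀ b, p b ≠ 0) ∧ g = (e.map (boxFactor D p q)).prod}

/-- The Deodhar component `S_D` of the Grassmannian: the matrices `A` whose row space is spanned by
the leftmost `k` columns of some `g` in `G_{𝐯,𝐰}`, which are the columns with the `k` largest
indices. -/
def deodharComponent {n : ℕ} {I : Finset (Fin n)} (k : ℕ) (e : List (Box I)) (D : Box I → Stone) :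
    Set (Matrix (Fin k) (Fin n) ℝ) :=
  {A | ∃ g ∈ marshRietsch e D,
    Submodule.span ℝ (Set.range A.row) = Submodule.span ℝ (g.col '' {c : Fin n | n - k ≤ (c : ℕ)})}

/-! ### Contour plots -/

/-- The parameters increase strictly and are generic: sums of `p` distinct parameters are all
distinct, for every `1 < p < n`. -/
def GenericParameters {n : ℕ} (κ : Fin n → ℝ) : Prop :=
  StrictMono κ ∧ ∀ p : ℕ, 1 < p → p < n → ∀ S T : Finset (Fin n), S.card = p → T.card = p →
    ∑ i ∈ S, κ i = ∑ i ∈ T, κ i → S = T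

/-- The locus where a function on the plane is not linear: the points near which it does not agree
with a polynomial of degree at most one. -/
def nonlinearLocus (f : ℝ × ℝ → ℝ) : Set (ℝ × ℝ) :=
  {p | ¬ ∃ a b c : ℝ, ∀ᶠ q in 𝓝 p, f q = a * q.1 + b * q.2 + c}

/-- `f_A(x, y, t)`: the maximum over the `J` with `Δ_J(A) ≠ 0` of the sums of
`κ_j x + κ_j² y + κ_j³ t` over `j ∈ J`. -/
def dominantExponent {k n : ℕ} (κ : Fin n → ℝ) (A : Matrix (Fin k) (Fin n) ℝ) (x y t : ℝ) : ℝ :=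
  ⨆ J : {J : Finset (Fin n) // ∃ h : J.card = k, plucker A J h ≠ 0},
    ∑ j ∈ J.1, (κ j * x + κ j ^ 2 * y + κ j ^ 3 * t)

/-- The contour plot `C_t(u_A)` at time `t`. -/
def contourPlot {k n : ℕ} (κ : Fin n → ℝ) (A : Matrix (Fin k) (Fin n) ℝ) (t : ℝ) : Set (ℝ × ℝ) :=
  nonlinearLocus (fun q => dominantExponent κ A q.1 q.2 t)

/-- `φ_i(x̄, ȳ) = κ_i x̄ + κ_i² ȳ + κ_i³`. -/
def phi {n : ℕ} (κ : Fin n → ℝ) (i : Fin n) (p : ℝ × ℝ) : ℝ :=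
  κ i * p.1 + κ i ^ 2 * p.2 + κ i ^ 3

/-- The contour plot `C_{-∞}(M)`: the locus where the minimum over the bases `J` of `M` of the sums
of the `φ_j` over `j ∈ J` is not linear. -/
def contourPlotNegInfinity {n : ℕ} (κ : Fin n → ℝ) (M : Matroid (Fin n)) : Set (ℝ × ℝ) :=
  nonlinearLocus (fun q =>
    ⨅ J : {J : Finset (Fin n) // M.IsBase (J : Set (Fin n))}, ∑ j ∈ J.1, phi κ j q)

/-- The point `v_{i,l,m}`. -/
def vPoint {n : ℕ} (κ : Fin n → ℝ) (i l m : Fin n) : ℝ × ℝ :=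
  (κ i * κ l + κ i * κ m + κ l * κ m, -(κ i + κ l + κ m))

/-- The nonzero direction `w` has slope `s`, slopes being measured by the tangent of the
counterclockwise angle from the positive vertical axis; it is required not to be horizontal. -/
def HasSlope (w : ℝ × ℝ) (s : ℝ) : Prop := w.2 ≠ 0 ∧ w.1 = -s * w.2

/-! ### Generalized plabic graphs -/

/-- The data of a graph drawn in a disk with `n` boundary vertices, edges being allowed to cross
without thereby creating a vertex.  Edges are given by their two half-edges, and the drawing enters
through the cyclic order of the half-edges around each vertex. -/
structure PlabicGraph (n : ℕ) where
  /-- internal vertices -/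
  Vert : Type
  /-- half-edges -/
  Dart : Type
  /-- the internal vertices coloured black; the others are white -/
  isBlack : Vert → Prop
  /-- the internal vertex or boundary vertex at which a half-edge is attached -/
  tail : Dart → Vert ⊕ Fin n
  /-- the other half of the same edge -/
  rev : Dart → Dart
  /-- the next half-edge counterclockwise around the same vertex -/
  rot : Equiv.Perm Dart
  /-- the labels of the boundary vertices -/
  label : Fin n → Fin n
  /-- the colours of the isolated boundary vertices (irrelevant at the others) -/
  isoColor : Fin n → ℤ

namespace PlabicGraph

variable {n : ℕ} (G : PlabicGraph n)

/-- A boundary vertex without edges. -/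
def IsIsolated (x : Fin n) : Prop := ∀ d, G.tail d ≠ Sum.inr x

/-- The data form a finite generalized plabic graph: reversal matches the half-edges in pairs, the
half-edges at a vertex form one cycle, the boundary vertices are labelled bijectively, and each of
them has exactly one edge or is isolated and coloured `1` or `-1`. -/
def IsGeneralizedPlabic : Prop :=
  Finite G.Vert ∧ Finite G.Dart ∧
  (∀ d, G.rev (G.rev d) = d ∧ G.rev d ≠ d) ∧
  (∀ d d', G.tail d = G.tail d' ↔ G.rot.SameCycle d d') ∧
  Function.Bijective G.label ∧
  (∀ d d' x, G.tail d = Sum.inr x → G.tail d' = Sum.inr x → d = d') ∧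
  (∀ x, G.IsIsolated x → G.isoColor x = 1 ∨ G.isoColor x = -1)

/-- The half-edges `d` such that the trip starting at the boundary vertex `x` runs along the edge of
`d` beginning with `d`.  Turning right at a vertex means leaving by the half-edge that is next in
counterclockwise order after the one of arrival, turning left means leaving by the previous one. -/
inductive OnTrip (x : Fin n) : G.Dart → Prop
  | start (d : G.Dart) (h : G.tail d = Sum.inr x) : OnTrip x d
  | turnRight (d : G.Dart) (v : G.Vert) (hd : OnTrip x d) (h : G.tail (G.rev d) = Sum.inl v)
      (hv : G.isBlack v) : OnTrip x (G.rot (G.rev d))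
  | turnLeft (d : G.Dart) (v : G.Vert) (hd : OnTrip x d) (h : G.tail (G.rev d) = Sum.inl v)
      (hv : ¬ G.isBlack v) : OnTrip x (G.rot.symm (G.rev d))

/-- The trip starting at the boundary vertex `x` ends at the boundary vertex `y`. -/
def TripEndsAt (x y : Fin n) : Prop :=
  (G.IsIsolated x ∧ y = x) ∨ ∃ d, G.OnTrip x d ∧ G.tail (G.rev d) = Sum.inr y

/-- For all `a`, the trip `T_a` ends, and only at the boundary vertex with label `π a`. -/
def HasTripPermutation (π : Equiv.Perm (Fin n)) : Prop :=
  ∀ x y, G.TripEndsAt x y ↔ G.label y = π (G.label x)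

/-- The labels of the edge of the half-edge `d`: all `a` such that the trip `T_a` runs along it. -/
def edgeLabels (d : G.Dart) : Set (Fin n) :=
  {a | ∃ x, G.label x = a ∧ (G.OnTrip x d ∨ G.OnTrip x (G.rev d))}

/-- `v` is trivalent, and its edges are labelled `[i, l]`, `[i, m]` and `[l, m]`. -/
def HasVertexType (v : G.Vert) (i l m : Fin n) : Prop :=
  ∃ d₁ d₂ d₃ : G.Dart, d₁ ≠ d₂ ∧ d₁ ≠ d₃ ∧ d₂ ≠ d₃ ∧
    {d | G.tail d = Sum.inl v} = {d₁, d₂, d₃} ∧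
    G.edgeLabels d₁ = {i, l} ∧ G.edgeLabels d₂ = {i, m} ∧ G.edgeLabels d₃ = {l, m}

/-- The ray from `P` with slope `s` along which `ȳ → -∞` (if `down`) or `ȳ → +∞` (otherwise). -/
def ray (P : ℝ × ℝ) (s : ℝ) (down : Prop) : Set (ℝ × ℝ) :=
  {q | ∃ w : ℝ × ℝ, q = P + w ∧ w.1 = -s * w.2 ∧ (down → w.2 ≤ 0) ∧ (¬ down → 0 ≤ w.2)}

/-- The part of the plane that replaces an edge with labels `i` and `j` when the internal vertices
are placed at the points `pos`: a line segment for an edge between two internal vertices, a ray of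
slope `κ_i + κ_j` for an edge from an internal vertex to a boundary vertex (`down` being the set of
boundary vertices towards which `ȳ → -∞`), and the whole line `φ_i = φ_j`, which has this slope,
for an edge between two boundary vertices. -/
def edgePiece (κ : Fin n → ℝ) (pos : G.Vert → ℝ × ℝ) (down : Fin n → Prop) (d : G.Dart)
    (i j : Fin n) : Set (ℝ × ℝ) :=
  match G.tail d, G.tail (G.rev d) with
  | Sum.inl v, Sum.inl v' => segment ℝ (pos v) (pos v')
  | Sum.inl v, Sum.inr x => ray (pos v) (κ i + κ j) (down x)
  | Sum.inr x, Sum.inl v => ray (pos v) (κ i + κ j) (down x)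
  | Sum.inr _, Sum.inr _ => {p | phi κ i p = phi κ j p}

/-- The union of the pieces that replace the edges of the graph. -/
def realization (κ : Fin n → ℝ) (pos : G.Vert → ℝ × ℝ) (down : Fin n → Prop) : Set (ℝ × ℝ) :=
  {p | ∃ (d : G.Dart) (i j : Fin n), i < j ∧ G.edgeLabels d = {i, j} ∧
    p ∈ G.edgePiece κ pos down d i j}

end PlabicGraph

/-! ### The graph `G_-(D)` -/

section GoToPlabic

variable {n : ℕ} {I : Finset (Fin n)} (D : Box I → Stone)

/-- The blank boxes: those that receive a pair of elbows (all other boxes receive a cross).  The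
pipes run from the south-east border to the north-west border; one elbow joins the east side of the
box to its north side, the other one joins the south side to the west side. -/
abbrev Blank : Type := {b : Fin n × Fin n // ∃ h : IsBox I b, D ⟨b, h⟩ = Stone.blank}

variable {D}

namespace Blank

open Classical in
/-- The columns of the blank boxes to the east of `b` in its row. -/
def eastOf (b : Blank D) : Finset (Fin n) :=
  Finset.univ.filter fun j => j < b.1.2 ∧ ∃ h : IsBox I (b.1.1, j), D ⟨_, h⟩ = Stone.blank

open Classical in
/-- The columns of the blank boxes to the west of `b` in its row. -/
def westOf (b : Blank D) : Finset (Fin n) :=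
  Finset.univ.filter fun j => b.1.2 < j ∧ ∃ h : IsBox I (b.1.1, j), D ⟨_, h⟩ = Stone.blank

open Classical in
/-- The rows of the blank boxes to the south of `b` in its column. -/
def southOf (b : Blank D) : Finset (Fin n) :=
  Finset.univ.filter fun i => b.1.1 < i ∧ ∃ h : IsBox I (i, b.1.2), D ⟨_, h⟩ = Stone.blank

open Classical in
/-- The rows of the blank boxes to the north of `b` in its column. -/
def northOf (b : Blank D) : Finset (Fin n) :=
  Finset.univ.filter fun i => i < b.1.1 ∧ ∃ h : IsBox I (i, b.1.2), D ⟨_, h⟩ = Stone.blank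

/-- The nearest blank box to the east. -/
def nextEast (b : Blank D) (h : b.eastOf.Nonempty) : Blank D :=
  ⟨(b.1.1, b.eastOf.max' h), by
    have := b.eastOf.max'_mem h; simp only [eastOf, Finset.mem_filter] at this; exact this.2.2⟩

/-- The nearest blank box to the west. -/
def nextWest (b : Blank D) (h : b.westOf.Nonempty) : Blank D :=
  ⟨(b.1.1, b.westOf.min' h), by
    have := b.westOf.min'_mem h; simp only [westOf, Finset.mem_filter] at this; exact this.2.2⟩

/-- The nearest blank box to the south. -/
def nextSouth (b : Blank D) (h : b.southOf.Nonempty) : Blank D :=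
  ⟨(b.southOf.min' h, b.1.2), by
    have := b.southOf.min'_mem h; simp only [southOf, Finset.mem_filter] at this; exact this.2.2⟩

/-- The nearest blank box to the north. -/
def nextNorth (b : Blank D) (h : b.northOf.Nonempty) : Blank D :=
  ⟨(b.northOf.max' h, b.1.2), by
    have := b.northOf.max'_mem h; simp only [northOf, Finset.mem_filter] at this; exact this.2.2⟩

theorem nextEast_lt (b : Blank D) (h : b.eastOf.Nonempty) : (b.nextEast h).1.2 < b.1.2 := by
  have := b.eastOf.max'_mem h; simp only [eastOf, Finset.mem_filter] at this; exact this.2.1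

theorem nextWest_lt (b : Blank D) (h : b.westOf.Nonempty) : b.1.2 < (b.nextWest h).1.2 := by
  have := b.westOf.min'_mem h; simp only [westOf, Finset.mem_filter] at this; exact this.2.1

theorem nextSouth_lt (b : Blank D) (h : b.southOf.Nonempty) : b.1.1 < (b.nextSouth h).1.1 := by
  have := b.southOf.min'_mem h; simp only [southOf, Finset.mem_filter] at this; exact this.2.1

theorem nextNorth_lt (b : Blank D) (h : b.northOf.Nonempty) : (b.nextNorth h).1.1 < b.1.1 := by
  have := b.northOf.max'_mem h; simp only [northOf, Finset.mem_filter] at this; exact this.2.1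

theorem eastOf_nextWest (b : Blank D) (h : b.westOf.Nonempty) :
    (b.nextWest h).eastOf.Nonempty :=
  ⟨b.1.2, by
    simp only [eastOf, Finset.mem_filter, Finset.mem_univ, true_and]
    exact ⟨b.nextWest_lt h, b.2⟩⟩

theorem southOf_nextNorth (b : Blank D) (h : b.northOf.Nonempty) :
    (b.nextNorth h).southOf.Nonempty :=
  ⟨b.1.1, by
    simp only [southOf, Finset.mem_filter, Finset.mem_univ, true_and]
    exact ⟨b.nextNorth_lt h, b.2⟩⟩

open Classical in
mutual

/-- The label (number of the step of the south-east border where it starts) of the pipe that leaves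
the blank box `b` through its north side; it entered through the east side, coming straight from the
nearest blank box to the east, or from the border. -/
def pipeNorth (b : Blank D) : Fin n :=
  if h : b.eastOf.Nonempty then pipeWest (b.nextEast h) else b.1.1
termination_by (b.1.2 : ℕ) + (n - (b.1.1 : ℕ))
decreasing_by
  have h₁ : ((b.nextEast h).1.2 : ℕ) < b.1.2 := b.nextEast_lt h
  have h₂ : ((b.nextEast h).1.1 : ℕ) = b.1.1 := rfl
  omega

/-- The label of the pipe that leaves the blank box `b` through its west side; it entered through
the south side, coming straight from the nearest blank box to the south, or from the border. -/
def pipeWest (b : Blank D) : Fin n :=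
  if h : b.southOf.Nonempty then pipeNorth (b.nextSouth h) else b.1.2
termination_by (b.1.2 : ℕ) + (n - (b.1.1 : ℕ))
decreasing_by
  have h₁ : (b.1.1 : ℕ) < ((b.nextSouth h).1.1 : ℕ) := b.nextSouth_lt h
  have h₂ : ((b.nextSouth h).1.2 : ℕ) = b.1.2 := rfl
  have _h₃ : ((b.nextSouth h).1.1 : ℕ) < n := (b.nextSouth h).1.1.isLt
  omega

end

end Blank

variable (D)

/-- The white vertices of `G_-(D)`.  Each blank box gets a white vertex on its north-east elbow, with
edges to the north, to the east, and to the black vertex of the same box.  The straight piece of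
pipe to the east is erased if there is no blank box to the east in the same row, and then the vertex
has degree two and is forgotten. -/
abbrev WhiteVert : Type := {b : Blank D // b.eastOf.Nonempty}

/-- The black vertices of `G_-(D)`.  Each blank box gets a black vertex on its south-west elbow, with
edges to the west, to the south, and to the white vertex of the same box.  The straight piece of
pipe to the south is erased if there is no blank box to the south in the same column, and then the
vertex has degree two and is forgotten. -/
abbrev BlackVert : Type := {b : Blank D // b.southOf.Nonempty}

/-- The row (if in `I`) or column labelled `x` contains a blank box. -/
def LineHasBlank (x : Fin n) : Prop := ∃ b : Blank D, b.1.1 = x ∨ b.1.2 = x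

/-- The half-edges of `G_-(D)`: three at each vertex, numbered counterclockwise (at a white vertex:
`0` to the north, `1` to the black vertex of the box, `2` to the east; at a black vertex: `0` to the
west, `1` to the south, `2` to the white vertex of the box), and one at each boundary vertex that is
not isolated.  The boundary vertices are the west ends of the rows and the north ends of the columns,
and are named after the row or column. -/
abbrev GoDart : Type := ((WhiteVert D ⊕ BlackVert D) × Fin 3) ⊕ {x : Fin n // LineHasBlank D x}

variable {D}

/-- A half-edge at a white vertex. -/
abbrev whiteDart (b : Blank D) (h : b.eastOf.Nonempty) (m : Fin 3) : GoDart D :=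
  Sum.inl (Sum.inl ⟨b, h⟩, m)

/-- A half-edge at a black vertex. -/
abbrev blackDart (b : Blank D) (h : b.southOf.Nonempty) (m : Fin 3) : GoDart D :=
  Sum.inl (Sum.inr ⟨b, h⟩, m)

open Classical in
/-- The half-edge reached by leaving the blank box `b` through its west side: the east half-edge of
the nearest blank box to the west, or the one at the west end of the row. -/
def leaveWest (b : Blank D) : GoDart D :=
  if h : b.westOf.Nonempty then whiteDart (b.nextWest h) (b.eastOf_nextWest h) 2
  else Sum.inr ⟨b.1.1, b, Or.inl rfl⟩

open Classical in
/-- The half-edge reached by leaving the blank box `b` through its north side: the south half-edge of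
the nearest blank box to the north, or the one at the north end of the column. -/
def leaveNorth (b : Blank D) : GoDart D :=
  if h : b.northOf.Nonempty then blackDart (b.nextNorth h) (b.southOf_nextNorth h) 1
  else Sum.inr ⟨b.1.2, b, Or.inr rfl⟩

open Classical in
/-- The half-edge reached by entering the blank box `b` through its west side, passing through
forgotten vertices: the one at the black vertex; or, if that vertex is forgotten, the one at the
white vertex; or, if both are forgotten, the edge goes on to the north. -/
def enterWest (b : Blank D) : GoDart D :=
  if h : b.southOf.Nonempty then blackDart b h 0
  else if h : b.eastOf.Nonempty then whiteDart b h 1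
  else leaveNorth b

open Classical in
/-- The half-edge reached by entering the blank box `b` through its north side, passing through
forgotten vertices: the one at the white vertex; or, if that vertex is forgotten, the one at the
black vertex; or, if both are forgotten, the edge goes on to the west. -/
def enterNorth (b : Blank D) : GoDart D :=
  if h : b.eastOf.Nonempty then whiteDart b h 0
  else if h : b.southOf.Nonempty then blackDart b h 2
  else leaveWest b

/-- `b` is the westmost blank box of row `x`. -/
def IsWestmost (x : Fin n) (b : Blank D) : Prop := b.1.1 = x ∧ ¬ b.westOf.Nonempty

/-- `b` is the northmost blank box of column `x`. -/
def IsNorthmost (x : Fin n) (b : Blank D) : Prop := b.1.2 = x ∧ ¬ b.northOf.Nonempty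

open Classical in
/-- The other half of the edge of a half-edge of `G_-(D)`. -/
def goRev : GoDart D → GoDart D
  | Sum.inl (Sum.inl b, m) =>
      if m = 0 then leaveNorth b.1
      else if m = 1 then
        if h : b.1.southOf.Nonempty then blackDart b.1 h 2 else leaveWest b.1
      else enterWest (b.1.nextEast b.2)
  | Sum.inl (Sum.inr b, m) =>
      if m = 0 then leaveWest b.1
      else if m = 1 then enterNorth (b.1.nextSouth b.2)
      else if h : b.1.eastOf.Nonempty then whiteDart b.1 h 1 else leaveNorth b.1
  | Sum.inr x =>
      if h : ∃ b : Blank D, IsWestmost x.1 b then enterWest h.choose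
      else if h : ∃ b : Blank D, IsNorthmost x.1 b then enterNorth h.choose
      else Sum.inr x

variable (D)

open Classical in
/-- The label of the pipe that ends at the west end of row `x` or at the north end of column `x`. -/
def pipeAtEnd (x : Fin n) : Fin n :=
  if h : ∃ b : Blank D, IsWestmost x b then h.choose.pipeWest
  else if h : ∃ b : Blank D, IsNorthmost x b then h.choose.pipeNorth
  else x

open Classical in
/-- The generalized plabic graph `G_-(D)`. -/
def goMinus : PlabicGraph n where
  Vert := WhiteVert D ⊕ BlackVert D
  Dart := GoDart D
  isBlack := fun v => v.isRight = true
  tail := Sum.map Prod.fst Subtype.val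
  rev := goRev
  rot := Equiv.sumCongr (Equiv.prodCongr (Equiv.refl _) (finRotate 3)) (Equiv.refl _)
  label := pipeAtEnd D
  isoColor := fun x => if x ∈ I then 1 else -1

end GoToPlabic

end

end KPSoliton

open KPSoliton

namespace KPSoliton

/-! ### Reading orders and pipes -/

section Pipes

variable {n : ℕ} {I : Finset (Fin n)}

-- Everything is read off the pipes. While the boxes are read, each row and column carries a pipe at
-- the frontier of the boxes read so far; a blank box exchanges the pipes of its row and its column,
-- a stone leaves them alone. With `blankPerm` the product of these exchanges, v = `blankPerm` · w
-- holds at every stage (`subexprPerm_eq`). Hence π(D) sends a line to the label of the pipe at its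
-- north-west end, and the Go condition compares the labels of the two pipes that enter a box
-- (`IsGoDiagram.pipes`). A trip runs backwards along a pipe to its border step a and then straight
-- along the row or column a. So an edge inside a box is labelled by the row and the column of the
-- box, any other edge by a line and the pipe on it (`tripLabel`, `onTrip_iff`).
--
-- For the plot, the greedy principle for bases of minimal weight reduces the question to ranks: if
-- no three weights agree, the minimum at P is attained twice exactly when some i and j of equal
-- weight can be exchanged over the set S of lighter elements (`IsMinBasis.exists_ne`,
-- `exists_isExchange`). On the line φ_i = φ_j with parameter r, φ_x - φ_i is the product of κ_x -
-- κ_i, κ_x - κ_j and κ_x - r. So S consists of the labels below the smallest and of those between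
-- the middle and the largest of i, j, r, and only the ranks of sets [0, a) ∪ [s, t) of columns
-- enter.
--
-- These ranks are the same for all points of S_D (`finrank_map_coordProj`). Indexed by lines
-- instead of positions, the columns of a Marsh-Rietsch product have controlled supports: the vector
-- of row x starts at the coordinate x (`lineVec_lower`), and the vector of a line ends at the label
-- of the pipe on it, the Go condition preventing cancellation (`lineVec_upper`). The rank is
-- therefore a number of rows plus a number of pipes. Comparing such counts for neighbouring
-- intervals turns the exchange condition into the existence of a blank box (`exchange_high_iff`,
-- `exchange_middle_iff`, `exchange_low_iff`), giving three pieces of line per blank box: west of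
-- it, inside it, north of it. The finitely many points where three φ agree do not matter, since the
-- locus is closed and has no isolated points (`contourPlotNegInfinity_eq`).
--
-- In the graph, a forgotten vertex is one at which consecutive pieces lie on the same line, so the
-- edges are the pieces glued at forgotten vertices (`realization_eq`). For t < 0 the contour plot
-- is obtained by the scaling (x, y) = t(x̄, ȳ), which turns the maximum into the minimum.

/-- A list of boxes in reading order that contains, with a box, all boxes weakly south-east of
it. -/
def IsClosedOrder (l : List (Box I)) : Prop :=
  l.Pairwise (fun b b' => ¬ (b.1.1 ≤ b'.1.1 ∧ b'.1.2 ≤ b.1.2)) ∧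
  ∀ b ∈ l, ∀ b' : Box I, b.1.1 ≤ b'.1.1 → b'.1.2 ≤ b.1.2 → b' ∈ l

theorem IsReadingOrder.isClosedOrder {e : List (Box I)} (he : IsReadingOrder e) :
    IsClosedOrder e :=
  ⟨he.2, fun _ _ b' _ _ => he.1 b'⟩

theorem IsClosedOrder.of_append {l l' : List (Box I)} (h : IsClosedOrder (l ++ l')) :
    IsClosedOrder l := by
  obtain ⟨h₁, h₂⟩ := h
  rw [List.pairwise_append] at h₁
  refine ⟨h₁.1, fun b hb b' hr hc => ?_⟩
  rcases List.mem_append.1 (h₂ b (List.mem_append_left _ hb) b' hr hc) with h | h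
  · exact h
  · exact absurd ⟨hr, hc⟩ (h₁.2.2 b hb b' h)

theorem IsClosedOrder.filter {l : List (Box I)} (h : IsClosedOrder l) (p : Box I → Bool)
    (hp : ∀ b b' : Box I, b.1.1 ≤ b'.1.1 → b'.1.2 ≤ b.1.2 → p b = true → p b' = true) :
    IsClosedOrder (l.filter p) := by
  refine ⟨h.1.filter p, fun b hb b' hr hc => ?_⟩
  rw [List.mem_filter] at hb ⊢
  exact ⟨h.2 b hb.1 b' hr hc, hp b b' hr hc hb.2⟩

theorem IsClosedOrder.not_southEast {l : List (Box I)} {c : Box I}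
    (h : IsClosedOrder (l ++ [c])) {b : Box I} (hb : b ∈ l) :
    ¬ (b.1.1 ≤ c.1.1 ∧ c.1.2 ≤ b.1.2) :=
  (List.pairwise_append.1 h.1).2.2 b hb c (by simp)

theorem IsClosedOrder.mem_of_southEast {l : List (Box I)} {c : Box I}
    (h : IsClosedOrder (l ++ [c])) {b : Box I} (hr : c.1.1 ≤ b.1.1) (hc : b.1.2 ≤ c.1.2)
    (hne : b ≠ c) : b ∈ l := by
  have := h.2 c (by simp) b hr hc
  simpa [hne] using this

theorem IsClosedOrder.notMem {l : List (Box I)} {c : Box I}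
    (h : IsClosedOrder (l ++ [c])) : c ∉ l := fun hc => h.not_southEast hc ⟨le_rfl, le_rfl⟩

open Classical in
/-- The product of the transpositions that exchange the row and the column of the blank boxes in the
list: it maps a row or column to the label of the pipe that leaves the listed boxes on it. -/
noncomputable def blankPerm (D : Box I → Stone) (l : List (Box I)) : Equiv.Perm (Fin n) :=
  (l.map fun b => if D b = Stone.blank then Equiv.swap b.1.1 b.1.2 else 1).prod

variable {D : Box I → Stone}

/-- The underlying box of a blank box. -/
def Blank.box (b : Blank D) : Box I := ⟨b.1, b.2.elim fun h _ => h⟩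

theorem Blank.box_blank (b : Blank D) : D b.box = Stone.blank := by
  obtain ⟨h, hh⟩ := b.2; exact hh

theorem Blank.row_mem (b : Blank D) : b.1.1 ∈ I := b.box.2.1

theorem Blank.col_notMem (b : Blank D) : b.1.2 ∉ I := b.box.2.2.1

theorem Blank.row_lt_col (b : Blank D) : b.1.1 < b.1.2 := b.box.2.2.2

/-- A box that is blank, as an element of `Blank D`. -/
def toBlank (b : Box I) (h : D b = Stone.blank) : Blank D := ⟨b.1, b.2, h⟩

@[simp] theorem toBlank_box (b : Box I) (h : D b = Stone.blank) : (toBlank b h).box = b := rfl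

theorem Blank.mem_eastOf {b : Blank D} {j : Fin n} :
    j ∈ b.eastOf ↔ j < b.1.2 ∧ ∃ b' : Blank D, b'.1 = (b.1.1, j) := by
  simp only [eastOf, Finset.mem_filter, Finset.mem_univ, true_and]
  exact and_congr_right fun _ => ⟨fun h => ⟨⟨_, h⟩, rfl⟩, fun ⟨b', h⟩ => h ▸ b'.2⟩

theorem Blank.mem_westOf {b : Blank D} {j : Fin n} :
    j ∈ b.westOf ↔ b.1.2 < j ∧ ∃ b' : Blank D, b'.1 = (b.1.1, j) := by
  simp only [westOf, Finset.mem_filter, Finset.mem_univ, true_and]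
  exact and_congr_right fun _ => ⟨fun h => ⟨⟨_, h⟩, rfl⟩, fun ⟨b', h⟩ => h ▸ b'.2⟩

theorem Blank.mem_southOf {b : Blank D} {i : Fin n} :
    i ∈ b.southOf ↔ b.1.1 < i ∧ ∃ b' : Blank D, b'.1 = (i, b.1.2) := by
  simp only [southOf, Finset.mem_filter, Finset.mem_univ, true_and]
  exact and_congr_right fun _ => ⟨fun h => ⟨⟨_, h⟩, rfl⟩, fun ⟨b', h⟩ => h ▸ b'.2⟩

theorem Blank.mem_northOf {b : Blank D} {i : Fin n} :
    i ∈ b.northOf ↔ i < b.1.1 ∧ ∃ b' : Blank D, b'.1 = (i, b.1.2) := by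
  simp only [northOf, Finset.mem_filter, Finset.mem_univ, true_and]
  exact and_congr_right fun _ => ⟨fun h => ⟨⟨_, h⟩, rfl⟩, fun ⟨b', h⟩ => h ▸ b'.2⟩

theorem Blank.eastOf_nonempty {b b' : Blank D} (hr : b'.1.1 = b.1.1) (hc : b'.1.2 < b.1.2) :
    b.eastOf.Nonempty :=
  ⟨b'.1.2, Blank.mem_eastOf.2 ⟨hc, b', Prod.ext hr rfl⟩⟩

theorem Blank.westOf_nonempty {b b' : Blank D} (hr : b'.1.1 = b.1.1) (hc : b.1.2 < b'.1.2) :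
    b.westOf.Nonempty :=
  ⟨b'.1.2, Blank.mem_westOf.2 ⟨hc, b', Prod.ext hr rfl⟩⟩

theorem Blank.southOf_nonempty {b b' : Blank D} (hc : b'.1.2 = b.1.2) (hr : b.1.1 < b'.1.1) :
    b.southOf.Nonempty :=
  ⟨b'.1.1, Blank.mem_southOf.2 ⟨hr, b', Prod.ext rfl hc⟩⟩

theorem Blank.northOf_nonempty {b b' : Blank D} (hc : b'.1.2 = b.1.2) (hr : b'.1.1 < b.1.1) :
    b.northOf.Nonempty :=
  ⟨b'.1.1, Blank.mem_northOf.2 ⟨hr, b', Prod.ext rfl hc⟩⟩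

theorem Blank.le_nextEast {b b' : Blank D} (h : b.eastOf.Nonempty) (hr : b'.1.1 = b.1.1)
    (hc : b'.1.2 < b.1.2) : b'.1.2 ≤ (b.nextEast h).1.2 :=
  Finset.le_max' _ _ (Blank.mem_eastOf.2 ⟨hc, b', Prod.ext hr rfl⟩)

theorem Blank.nextWest_le {b b' : Blank D} (h : b.westOf.Nonempty) (hr : b'.1.1 = b.1.1)
    (hc : b.1.2 < b'.1.2) : (b.nextWest h).1.2 ≤ b'.1.2 :=
  Finset.min'_le _ _ (Blank.mem_westOf.2 ⟨hc, b', Prod.ext hr rfl⟩)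

theorem Blank.nextSouth_le {b b' : Blank D} (h : b.southOf.Nonempty) (hc : b'.1.2 = b.1.2)
    (hr : b.1.1 < b'.1.1) : (b.nextSouth h).1.1 ≤ b'.1.1 :=
  Finset.min'_le _ _ (Blank.mem_southOf.2 ⟨hr, b', Prod.ext rfl hc⟩)

theorem Blank.le_nextNorth {b b' : Blank D} (h : b.northOf.Nonempty) (hc : b'.1.2 = b.1.2)
    (hr : b'.1.1 < b.1.1) : b'.1.1 ≤ (b.nextNorth h).1.1 :=
  Finset.le_max' _ _ (Blank.mem_northOf.2 ⟨hr, b', Prod.ext rfl hc⟩)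

theorem blankPerm_concat (l : List (Box I)) (c : Box I) :
    blankPerm D (l ++ [c]) =
      blankPerm D l * (open Classical in
        if D c = Stone.blank then Equiv.swap c.1.1 c.1.2 else 1) := by
  simp [blankPerm]

theorem blankPerm_concat_blank (l : List (Box I)) {c : Box I} (h : D c = Stone.blank) :
    blankPerm D (l ++ [c]) = blankPerm D l * Equiv.swap c.1.1 c.1.2 := by
  simp [blankPerm_concat, h]

theorem blankPerm_concat_stone (l : List (Box I)) {c : Box I} (h : D c ≠ Stone.blank) :
    blankPerm D (l ++ [c]) = blankPerm D l := by
  simp [blankPerm_concat, h]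

theorem blankPerm_of_forall (l : List (Box I)) (x : Fin n)
    (h : ∀ b : Blank D, b.box ∈ l → b.1.1 ≠ x ∧ b.1.2 ≠ x) : blankPerm D l x = x := by
  induction l using List.reverseRecOn with
  | nil => simp [blankPerm]
  | append_singleton l c ih =>
    have ih' := ih fun b hb => h b (by simp [hb])
    by_cases hc : D c = Stone.blank
    · have : c.1.1 ≠ x ∧ c.1.2 ≠ x := h (toBlank c hc) (by simp)
      rw [blankPerm_concat_blank l hc, Equiv.Perm.mul_apply,
        Equiv.swap_apply_of_ne_of_ne this.1.symm this.2.symm, ih']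
    · rw [blankPerm_concat_stone l hc, ih']

theorem blankPerm_of_forall_row (l : List (Box I)) {x : Fin n} (hx : x ∈ I)
    (h : ∀ b : Blank D, b.box ∈ l → b.1.1 ≠ x) : blankPerm D l x = x :=
  blankPerm_of_forall l x fun b hb => ⟨h b hb, fun h' => b.col_notMem (h' ▸ hx)⟩

theorem blankPerm_of_forall_col (l : List (Box I)) {x : Fin n} (hx : x ∉ I)
    (h : ∀ b : Blank D, b.box ∈ l → b.1.2 ≠ x) : blankPerm D l x = x :=
  blankPerm_of_forall l x fun b hb => ⟨fun h' => hx (h' ▸ b.row_mem), h b hb⟩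

theorem Blank.box_inj {b b' : Blank D} (h : b.box = b'.box) : b = b' :=
  Subtype.ext (congrArg (fun c : Box I => c.1) h)

theorem Blank.ext' {b b' : Blank D} (h₁ : b.1.1 = b'.1.1) (h₂ : b.1.2 = b'.1.2) : b = b' :=
  Subtype.ext (Prod.ext h₁ h₂)

/-- Only the last blank box read on a line decides its value. The swap in b gives the row what the
column carried: the pipe sent north by the nearest blank box to the south, or the column's own label
if there is none. Pipes alternate between rows and columns, so both halves are proved together. -/
theorem blankPerm_westmost_northmost (l : List (Box I)) (hl : IsClosedOrder l) :
    (∀ b : Blank D, b.box ∈ l → (∀ b' : Blank D, b'.box ∈ l → b'.1.1 = b.1.1 → b'.1.2 ≤ b.1.2) →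
      blankPerm D l b.1.1 = b.pipeWest) ∧
    (∀ b : Blank D, b.box ∈ l → (∀ b' : Blank D, b'.box ∈ l → b'.1.2 = b.1.2 → b.1.1 ≤ b'.1.1) →
      blankPerm D l b.1.2 = b.pipeNorth) := by
  induction l using List.reverseRecOn with
  | nil => simp
  | append_singleton l c ih =>
    obtain ⟨ih₁, ih₂⟩ := ih hl.of_append
    constructor
    · intro b hb hmax
      by_cases hbc : b.box = c
      · subst hbc
        rw [blankPerm_concat_blank l b.box_blank, Equiv.Perm.mul_apply]
        change blankPerm D l (Equiv.swap b.1.1 b.1.2 b.1.1) = _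
        rw [Equiv.swap_apply_left, Blank.pipeWest]
        split_ifs with hs
        · have hlt := b.nextSouth_lt hs
          have hne : (b.nextSouth hs).box ≠ b.box := fun h =>
            hlt.ne (congrArg (fun b : Blank D => b.1.1) (Blank.box_inj h)).symm
          refine ih₂ (b.nextSouth hs) (hl.mem_of_southEast hlt.le le_rfl hne) ?_
          intro b' hb' hcol
          refine Blank.nextSouth_le hs hcol (lt_of_not_ge fun hle => ?_)
          exact hl.not_southEast hb' ⟨hle, hcol.ge⟩
        · refine blankPerm_of_forall_col l b.col_notMem fun b' hb' hcol => hs ?_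
          refine Blank.southOf_nonempty hcol (lt_of_not_ge fun hle => ?_)
          exact hl.not_southEast hb' ⟨hle, hcol.ge⟩
      · have hb' : b.box ∈ l := by simpa [hbc] using hb
        have ih' := ih₁ b hb' fun b' hb'' => hmax b' (by simp [hb''])
        by_cases hcb : D c = Stone.blank
        · have hrow : b.1.1 ≠ c.1.1 := fun h =>
            hl.not_southEast hb' ⟨h.le, hmax (toBlank c hcb) (by simp) h.symm⟩
          rw [blankPerm_concat_blank l hcb, Equiv.Perm.mul_apply,
            Equiv.swap_apply_of_ne_of_ne hrow (fun h : b.1.1 = c.1.2 => c.2.2.1 (h ▸ b.row_mem)), ih']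
        · rw [blankPerm_concat_stone l hcb, ih']
    · intro b hb hmax
      by_cases hbc : b.box = c
      · subst hbc
        rw [blankPerm_concat_blank l b.box_blank, Equiv.Perm.mul_apply]
        change blankPerm D l (Equiv.swap b.1.1 b.1.2 b.1.2) = _
        rw [Equiv.swap_apply_right, Blank.pipeNorth]
        split_ifs with hs
        · have hlt := b.nextEast_lt hs
          have hne : (b.nextEast hs).box ≠ b.box := fun h =>
            hlt.ne (congrArg (fun b : Blank D => b.1.2) (Blank.box_inj h))
          refine ih₁ (b.nextEast hs) (hl.mem_of_southEast le_rfl hlt.le hne) ?_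
          intro b' hb' hrow
          refine Blank.le_nextEast hs hrow (lt_of_not_ge fun hle => ?_)
          exact hl.not_southEast hb' ⟨hrow.le, hle⟩
        · refine blankPerm_of_forall_row l b.row_mem fun b' hb' hrow => hs ?_
          refine Blank.eastOf_nonempty hrow (lt_of_not_ge fun hle => ?_)
          exact hl.not_southEast hb' ⟨hrow.le, hle⟩
      · have hb' : b.box ∈ l := by simpa [hbc] using hb
        have ih' := ih₂ b hb' fun b' hb'' => hmax b' (by simp [hb''])
        by_cases hcb : D c = Stone.blank
        · have hcol : b.1.2 ≠ c.1.2 := fun h =>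
            hl.not_southEast hb' ⟨hmax (toBlank c hcb) (by simp) h.symm, h.ge⟩
          rw [blankPerm_concat_blank l hcb, Equiv.Perm.mul_apply,
            Equiv.swap_apply_of_ne_of_ne (fun h : b.1.2 = c.1.1 => b.col_notMem (h ▸ c.2.1)) hcol, ih']
        · rw [blankPerm_concat_stone l hcb, ih']

/-- A nonempty set of blank boxes in one row has a westmost element. -/
theorem exists_westmost (P : Blank D → Prop) (x : Fin n) (h : ∃ b : Blank D, P b ∧ b.1.1 = x) :
    ∃ b : Blank D, P b ∧ b.1.1 = x ∧ ∀ b' : Blank D, P b' → b'.1.1 = x → b'.1.2 ≤ b.1.2 := by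
  classical
  obtain ⟨b, hb, hmax⟩ := Finset.exists_max_image
    (Finset.univ.filter fun b : Blank D => P b ∧ b.1.1 = x) (fun b => b.1.2)
    (by obtain ⟨b, hb⟩ := h; exact ⟨b, by simpa using hb⟩)
  simp only [Finset.mem_filter, Finset.mem_univ, true_and] at hb hmax
  exact ⟨b, hb.1, hb.2, fun b' h₁ h₂ => hmax b' ⟨h₁, h₂⟩⟩

/-- A nonempty set of blank boxes in one column has a northmost element. -/
theorem exists_northmost (P : Blank D → Prop) (x : Fin n) (h : ∃ b : Blank D, P b ∧ b.1.2 = x) :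
    ∃ b : Blank D, P b ∧ b.1.2 = x ∧ ∀ b' : Blank D, P b' → b'.1.2 = x → b.1.1 ≤ b'.1.1 := by
  classical
  obtain ⟨b, hb, hmax⟩ := Finset.exists_min_image
    (Finset.univ.filter fun b : Blank D => P b ∧ b.1.2 = x) (fun b => b.1.1)
    (by obtain ⟨b, hb⟩ := h; exact ⟨b, by simpa using hb⟩)
  simp only [Finset.mem_filter, Finset.mem_univ, true_and] at hb hmax
  exact ⟨b, hb.1, hb.2, fun b' h₁ h₂ => hmax b' ⟨h₁, h₂⟩⟩

/-- The westmost listed blank box of the row decides the value, so only the listed boxes of that row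
matter. This allows a prefix of the reading order to be traded for a window. -/
theorem blankPerm_congr_row {l l' : List (Box I)} (hl : IsClosedOrder l) (hl' : IsClosedOrder l')
    {x : Fin n} (hx : x ∈ I) (h : ∀ b : Box I, b.1.1 = x → (b ∈ l ↔ b ∈ l')) :
    blankPerm D l x = blankPerm D l' x := by
  by_cases hne : ∃ b : Blank D, b.box ∈ l ∧ b.1.1 = x
  · obtain ⟨b, hb, rfl, hmax⟩ := exists_westmost (fun b => b.box ∈ l) x hne
    rw [(blankPerm_westmost_northmost l hl).1 b hb hmax,
      (blankPerm_westmost_northmost l' hl').1 b ((h b.box rfl).1 hb)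
        fun b' hb' hr => hmax b' ((h b'.box hr).2 hb') hr]
  · rw [blankPerm_of_forall_row l hx fun b hb hr => hne ⟨b, hb, hr⟩,
      blankPerm_of_forall_row l' hx fun b hb hr => hne ⟨b, (h b.box hr).2 hb, hr⟩]

theorem blankPerm_congr_col {l l' : List (Box I)} (hl : IsClosedOrder l) (hl' : IsClosedOrder l')
    {x : Fin n} (hx : x ∉ I) (h : ∀ b : Box I, b.1.2 = x → (b ∈ l ↔ b ∈ l')) :
    blankPerm D l x = blankPerm D l' x := by
  by_cases hne : ∃ b : Blank D, b.box ∈ l ∧ b.1.2 = x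
  · obtain ⟨b, hb, rfl, hmax⟩ := exists_northmost (fun b => b.box ∈ l) x hne
    rw [(blankPerm_westmost_northmost l hl).2 b hb hmax,
      (blankPerm_westmost_northmost l' hl').2 b ((h b.box rfl).1 hb)
        fun b' hb' hr => hmax b' ((h b'.box hr).2 hb') hr]
  · rw [blankPerm_of_forall_col l hx fun b hb hr => hne ⟨b, hb, hr⟩,
      blankPerm_of_forall_col l' hx fun b hb hr => hne ⟨b, (h b.box hr).2 hb, hr⟩]

/-- The swap in b undone: just before b is read, its row carries the pipe that will leave north, its
column the one that will leave west. -/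
theorem blankPerm_pipes {l : List (Box I)} {b : Blank D} (hl : IsClosedOrder (l ++ [b.box])) :
    blankPerm D l b.1.1 = b.pipeNorth ∧ blankPerm D l b.1.2 = b.pipeWest := by
  have h := blankPerm_westmost_northmost (D := D) _ hl
  have h₁ := h.1 b (by simp) fun b' hb' hr => by
    rcases List.mem_append.1 hb' with hb' | hb'
    · exact le_of_lt (lt_of_not_ge fun hle => hl.not_southEast hb' ⟨hr.le, hle⟩)
    · exact (congrArg (fun b : Blank D => b.1.2) (Blank.box_inj (List.mem_singleton.1 hb'))).le
  have h₂ := h.2 b (by simp) fun b' hb' hr => by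
    rcases List.mem_append.1 hb' with hb' | hb'
    · exact le_of_lt (lt_of_not_ge fun hle => hl.not_southEast hb' ⟨hle, hr.ge⟩)
    · exact (congrArg (fun b : Blank D => b.1.1) (Blank.box_inj (List.mem_singleton.1 hb'))).ge
  rw [blankPerm_concat_blank l b.box_blank, Equiv.Perm.mul_apply] at h₁ h₂
  constructor
  · rw [← h₂]; exact (congrArg _ (Equiv.swap_apply_right b.1.1 b.1.2)).symm
  · rw [← h₁]; exact (congrArg _ (Equiv.swap_apply_left b.1.1 b.1.2)).symm

theorem IsWestmost.unique {x : Fin n} {b b' : Blank D} (h : IsWestmost x b)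
    (h' : IsWestmost x b') : b = b' := by
  have hr : b.1.1 = b'.1.1 := h.1.trans h'.1.symm
  rcases lt_trichotomy b.1.2 b'.1.2 with hlt | heq | hlt
  · exact absurd (Blank.westOf_nonempty hr.symm hlt) h.2
  · exact Blank.ext' hr heq
  · exact absurd (Blank.westOf_nonempty hr hlt) h'.2

theorem IsNorthmost.unique {x : Fin n} {b b' : Blank D} (h : IsNorthmost x b)
    (h' : IsNorthmost x b') : b = b' := by
  have hc : b.1.2 = b'.1.2 := h.1.trans h'.1.symm
  rcases lt_trichotomy b.1.1 b'.1.1 with hlt | heq | hlt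
  · exact absurd (Blank.northOf_nonempty hc hlt) h'.2
  · exact Blank.ext' heq hc
  · exact absurd (Blank.northOf_nonempty hc.symm hlt) h.2

theorem IsWestmost.pipeAtEnd {x : Fin n} {b : Blank D} (h : IsWestmost x b) :
    pipeAtEnd D x = b.pipeWest := by
  have hex : ∃ b : Blank D, IsWestmost x b := ⟨b, h⟩
  rw [KPSoliton.pipeAtEnd, dif_pos hex, hex.choose_spec.unique h]

theorem IsNorthmost.not_isWestmost {x : Fin n} {b : Blank D} (h : IsNorthmost x b) :
    ¬ ∃ b : Blank D, IsWestmost x b :=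
  fun ⟨b', h'⟩ => b.col_notMem (h.1 ▸ h'.1 ▸ b'.row_mem)

theorem IsNorthmost.pipeAtEnd {x : Fin n} {b : Blank D} (h : IsNorthmost x b) :
    pipeAtEnd D x = b.pipeNorth := by
  have hex : ∃ b : Blank D, IsNorthmost x b := ⟨b, h⟩
  rw [KPSoliton.pipeAtEnd, dif_neg h.not_isWestmost, dif_pos hex, hex.choose_spec.unique h]

theorem exists_isWestmost (b : Blank D) : ∃ b' : Blank D, IsWestmost b.1.1 b' := by
  obtain ⟨b', -, hr, hmax⟩ := exists_westmost (fun _ : Blank D => True) b.1.1 ⟨b, trivial, rfl⟩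
  refine ⟨b', hr, fun ⟨j, hj⟩ => ?_⟩
  obtain ⟨hlt, b'', h⟩ := Blank.mem_westOf.1 hj
  have := hmax b'' trivial (by rw [h]; exact hr)
  rw [h] at this
  exact absurd hlt (not_lt.2 this)

theorem exists_isNorthmost (b : Blank D) : ∃ b' : Blank D, IsNorthmost b.1.2 b' := by
  obtain ⟨b', -, hr, hmax⟩ := exists_northmost (fun _ : Blank D => True) b.1.2 ⟨b, trivial, rfl⟩
  refine ⟨b', hr, fun ⟨j, hj⟩ => ?_⟩
  obtain ⟨hlt, b'', h⟩ := Blank.mem_northOf.1 hj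
  have := hmax b'' trivial (by rw [h]; exact hr)
  rw [h] at this
  exact absurd hlt (not_lt.2 this)

theorem pipeAtEnd_of_not_lineHasBlank {x : Fin n} (h : ¬ LineHasBlank D x) :
    pipeAtEnd D x = x := by
  rw [pipeAtEnd, dif_neg fun ⟨b, hb⟩ => h ⟨b, Or.inl hb.1⟩,
    dif_neg fun ⟨b, hb⟩ => h ⟨b, Or.inr hb.1⟩]

theorem blankPerm_eq_pipeAtEnd {e : List (Box I)} (he : IsReadingOrder e) (x : Fin n) :
    blankPerm D e x = pipeAtEnd D x := by
  have h := blankPerm_westmost_northmost (D := D) e he.isClosedOrder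
  by_cases hx : LineHasBlank D x
  · obtain ⟨b, rfl | rfl⟩ := hx
    · obtain ⟨b', hr, hw⟩ := exists_isWestmost b
      rw [IsWestmost.pipeAtEnd ⟨hr, hw⟩, ← hr]
      exact h.1 b' (he.1 _) fun b'' _ hr' => le_of_not_gt fun hlt =>
        hw (Blank.westOf_nonempty hr' hlt)
    · obtain ⟨b', hr, hw⟩ := exists_isNorthmost b
      rw [IsNorthmost.pipeAtEnd ⟨hr, hw⟩, ← hr]
      exact h.2 b' (he.1 _) fun b'' _ hr' => le_of_not_gt fun hlt =>
        hw (Blank.northOf_nonempty hr' hlt)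
  · rw [pipeAtEnd_of_not_lineHasBlank hx]
    exact blankPerm_of_forall e x fun b _ => ⟨fun h => hx ⟨b, Or.inl h⟩, fun h => hx ⟨b, Or.inr h⟩⟩

/-- A pipe through the blank box `b` starts on the part of the border south-east of `b`. -/
theorem Blank.pipe_bounds (N : ℕ) : ∀ b : Blank D, (b.1.2 : ℕ) + (n - (b.1.1 : ℕ)) < N →
    (b.1.1 ≤ b.pipeNorth ∧ b.pipeNorth < b.1.2 ∧ (b.pipeNorth = b.1.1 ↔ ¬ b.eastOf.Nonempty)) ∧
    (b.1.1 < b.pipeWest ∧ b.pipeWest ≤ b.1.2 ∧ (b.pipeWest = b.1.2 ↔ ¬ b.southOf.Nonempty)) := by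
  -- `N` bounds the termination measure of the mutual recursion that defines the pipes.
  induction N with
  | zero => simp
  | succ N ih =>
    intro b hb
    constructor
    · rw [Blank.pipeNorth]
      split_ifs with h
      · have hlt := b.nextEast_lt h
        have hr : (b.nextEast h).1.1 = b.1.1 := rfl
        obtain ⟨-, h₁, h₂, -⟩ := ih (b.nextEast h) (by rw [hr]; have : ((b.nextEast h).1.2 : ℕ) < b.1.2 := hlt; omega)
        exact ⟨h₁.le, h₂.trans_lt hlt, iff_of_false h₁.ne' (not_not.2 h)⟩
      · exact ⟨le_rfl, b.row_lt_col, by simp [h]⟩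
    · rw [Blank.pipeWest]
      split_ifs with h
      · have hlt := b.nextSouth_lt h
        have hr : (b.nextSouth h).1.2 = b.1.2 := rfl
        have hn := (b.nextSouth h).1.1.isLt
        obtain ⟨⟨h₁, h₂, -⟩, -⟩ := ih (b.nextSouth h) (by rw [hr]; have : (b.1.1 : ℕ) < ((b.nextSouth h).1.1 : ℕ) := hlt; omega)
        exact ⟨hlt.trans_le h₁, h₂.le, iff_of_false h₂.ne (not_not.2 h)⟩
      · exact ⟨b.row_lt_col, le_rfl, by simp [h]⟩

theorem Blank.row_le_pipeNorth (b : Blank D) : b.1.1 ≤ b.pipeNorth :=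
  (Blank.pipe_bounds _ b (Nat.lt_succ_self _)).1.1

theorem Blank.pipeNorth_lt_col (b : Blank D) : b.pipeNorth < b.1.2 :=
  (Blank.pipe_bounds _ b (Nat.lt_succ_self _)).1.2.1

theorem Blank.pipeNorth_eq_row_iff (b : Blank D) : b.pipeNorth = b.1.1 ↔ ¬ b.eastOf.Nonempty :=
  (Blank.pipe_bounds _ b (Nat.lt_succ_self _)).1.2.2

theorem Blank.row_lt_pipeWest (b : Blank D) : b.1.1 < b.pipeWest :=
  (Blank.pipe_bounds _ b (Nat.lt_succ_self _)).2.1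

theorem Blank.pipeWest_le_col (b : Blank D) : b.pipeWest ≤ b.1.2 :=
  (Blank.pipe_bounds _ b (Nat.lt_succ_self _)).2.2.1

theorem Blank.pipeWest_eq_col_iff (b : Blank D) : b.pipeWest = b.1.2 ↔ ¬ b.southOf.Nonempty :=
  (Blank.pipe_bounds _ b (Nat.lt_succ_self _)).2.2.2

end Pipes


/-! ### Words, lengths and the Go condition -/

section Words

/-- Applying the adjacent transposition to both entries of a pair carries the inversions of u
injectively to inversions of u s, and the new inversion (m, m + 1) is not in the image. -/
theorem permLength_lt_mul_simpleReflection {n m : ℕ} (hm : m + 1 < n) (u : Equiv.Perm (Fin n))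
    (h : u ⟨m, Nat.lt_of_succ_lt hm⟩ < u ⟨m + 1, hm⟩) :
    permLength u < permLength (u * simpleReflection n m) := by
  set a : Fin n := ⟨m, Nat.lt_of_succ_lt hm⟩ with ha
  set b : Fin n := ⟨m + 1, hm⟩ with hb
  have hs : simpleReflection n m = Equiv.swap a b := by simp [simpleReflection, hm, ha, hb]
  have hab : a < b := by simp [ha, hb, Fin.lt_def]
  have key : ∀ p q : Fin n, p < q → ¬ (p = a ∧ q = b) → Equiv.swap a b p < Equiv.swap a b q := by
    intro p q hpq hne
    have hpq' : (p : ℕ) < q := hpq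
    have e1 : ∀ x : Fin n, x = a ↔ (x : ℕ) = m := fun x => by simp [ha, Fin.ext_iff]
    have e2 : ∀ x : Fin n, x = b ↔ (x : ℕ) = m + 1 := fun x => by simp [hb, Fin.ext_iff]
    have va : (a : ℕ) = m := rfl
    have vb : (b : ℕ) = m + 1 := rfl
    rw [e1, e2] at hne
    rw [Equiv.swap_apply_def, Equiv.swap_apply_def, Fin.lt_def]
    split_ifs with h1 h2 h3 h4 h5 h6 h7 <;> simp only [e1, e2, va, vb] at * <;> omega
  rw [hs, permLength, permLength]
  rw [← Finset.card_map (Equiv.prodCongr (Equiv.swap a b) (Equiv.swap a b)).toEmbedding]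
  refine Finset.card_lt_card (Finset.ssubset_iff_of_subset ?_ |>.2 ⟨(a, b), ?_, ?_⟩)
  · intro x hx
    simp only [Finset.mem_map, Finset.mem_filter, Finset.mem_univ, true_and] at hx
    obtain ⟨⟨p, q⟩, ⟨hpq, hu⟩, rfl⟩ := hx
    simp only [Finset.mem_filter, Finset.mem_univ, true_and]
    refine ⟨key p q hpq fun ⟨hp, hq⟩ => ?_, by simpa using hu⟩
    subst hp; subst hq
    exact lt_asymm h hu
  · simp only [Finset.mem_filter, Finset.mem_univ, true_and]
    exact ⟨hab, by simpa using h⟩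
  · simp only [Finset.mem_map, Finset.mem_filter, Finset.mem_univ, true_and]
    rintro ⟨⟨p, q⟩, ⟨hpq, -⟩, hx⟩
    have h₁ : p = b := by simpa [Equiv.swap_apply_eq_iff] using congrArg Prod.fst hx
    have h₂ : q = a := by simpa [Equiv.swap_apply_eq_iff] using congrArg Prod.snd hx
    subst h₁; subst h₂
    exact lt_asymm hab hpq

theorem simpleReflection_mul_self (n m : ℕ) :
    simpleReflection n m * simpleReflection n m = 1 := by
  rw [simpleReflection]; split_ifs <;> simp

/-- Right multiplication by a simple reflection increases the length if and only if it exchanges an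
ascent. -/
theorem permLength_lt_iff {n m : ℕ} (hm : m + 1 < n) (u : Equiv.Perm (Fin n)) :
    (permLength u < permLength (u * simpleReflection n m) ↔
      u ⟨m, Nat.lt_of_succ_lt hm⟩ < u ⟨m + 1, hm⟩) ∧
    (permLength (u * simpleReflection n m) < permLength u ↔
      u ⟨m + 1, hm⟩ < u ⟨m, Nat.lt_of_succ_lt hm⟩) := by
  rcases lt_trichotomy (u ⟨m, Nat.lt_of_succ_lt hm⟩) (u ⟨m + 1, hm⟩) with h | h | h
  · have := permLength_lt_mul_simpleReflection hm u h
    simp [h, this, h.not_gt, this.not_gt]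
  · exact absurd (u.injective h) (by simp)
  · have := permLength_lt_mul_simpleReflection hm (u * simpleReflection n m)
      (by simpa [simpleReflection, hm] using h)
    rw [mul_assoc, simpleReflection_mul_self, mul_one] at this
    simp [h, this, h.not_gt, this.not_gt]

-- Positions of rows and columns on the frontier.

variable {n : ℕ} {I : Finset (Fin n)}

theorem IsClosedOrder.nodup {l : List (Box I)} (hl : IsClosedOrder l) : l.Nodup :=
  hl.1.imp fun {b b'} h => by rintro rfl; exact h ⟨le_rfl, le_rfl⟩

theorem countP_row {l : List (Box I)} {c : Box I} (hl : IsClosedOrder (l ++ [c])) :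
    l.countP (fun b => decide (b.1.1 = c.1.1)) =
      (Iᶜ.filter fun j => c.1.1 < j ∧ j < c.1.2).card := by
  have hnd : ((l.filter fun b => decide (b.1.1 = c.1.1)).map fun b => b.1.2).Nodup := by
    refine List.Nodup.map_on ?_ (hl.of_append.nodup.filter _)
    intro b hb b' hb' h
    simp only [List.mem_filter, decide_eq_true_eq] at hb hb'
    exact Subtype.ext (Prod.ext (hb.2.trans hb'.2.symm) h)
  rw [List.countP_eq_length_filter, ← List.length_map (fun b : Box I => b.1.2),
    ← List.toFinset_card_of_nodup hnd]
  congr 1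
  ext j
  simp only [List.mem_toFinset, List.mem_map, List.mem_filter, decide_eq_true_eq,
    Finset.mem_filter, Finset.mem_compl]
  constructor
  · rintro ⟨b, ⟨hb, hr⟩, rfl⟩
    exact ⟨b.2.2.1, hr ▸ b.2.2.2, lt_of_not_ge fun h => hl.not_southEast hb ⟨hr.le, h⟩⟩
  · rintro ⟨hj, h₁, h₂⟩
    refine ⟨⟨(c.1.1, j), c.2.1, hj, h₁⟩, ⟨hl.mem_of_southEast le_rfl h₂.le fun h => ?_, rfl⟩, rfl⟩
    exact h₂.ne (congrArg (fun b : Box I => b.1.2) h)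

theorem countP_col {l : List (Box I)} {c : Box I} (hl : IsClosedOrder (l ++ [c])) :
    l.countP (fun b => decide (b.1.2 = c.1.2)) =
      (I.filter fun i => c.1.1 < i ∧ i < c.1.2).card := by
  have hnd : ((l.filter fun b => decide (b.1.2 = c.1.2)).map fun b => b.1.1).Nodup := by
    refine List.Nodup.map_on ?_ (hl.of_append.nodup.filter _)
    intro b hb b' hb' h
    simp only [List.mem_filter, decide_eq_true_eq] at hb hb'
    exact Subtype.ext (Prod.ext h (hb.2.trans hb'.2.symm))
  rw [List.countP_eq_length_filter, ← List.length_map (fun b : Box I => b.1.1),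
    ← List.toFinset_card_of_nodup hnd]
  congr 1
  ext i
  simp only [List.mem_toFinset, List.mem_map, List.mem_filter, decide_eq_true_eq,
    Finset.mem_filter]
  constructor
  · rintro ⟨b, ⟨hb, hr⟩, rfl⟩
    exact ⟨b.2.1, lt_of_not_ge fun h => hl.not_southEast hb ⟨h, hr.ge⟩, hr ▸ b.2.2.2⟩
  · rintro ⟨hi, h₁, h₂⟩
    refine ⟨⟨(i, c.1.2), hi, c.2.2.1, h₂⟩, ⟨hl.mem_of_southEast h₁.le le_rfl fun h => ?_, rfl⟩, rfl⟩
    exact h₁.ne' (congrArg (fun b : Box I => b.1.1) h)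

theorem card_filter_lt_add (I : Finset (Fin n)) (x : Fin n) :
    (I.filter fun i => i < x).card + (Iᶜ.filter fun i => i < x).card = x := by
  rw [← Finset.card_union_of_disjoint
    (Finset.disjoint_filter_filter disjoint_compl_right), ← Finset.filter_union,
    Finset.union_compl, show Finset.univ.filter (fun i => i < x) = Finset.Iio x by ext; simp,
    Fin.card_Iio]

/-- A row starts at the position given by its label and moves up by one with each of its boxes; a
column moves down likewise. This computes where the row of c stands when c is about to be read. -/
theorem genIndex_eq_row {l : List (Box I)} {c : Box I} (hl : IsClosedOrder (l ++ [c])) :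
    (c.1.1 : ℕ) + l.countP (fun b => decide (b.1.1 = c.1.1)) = genIndex c := by
  rw [countP_row hl, genIndex, ← card_filter_lt_add I c.1.1, add_assoc,
    ← Finset.card_union_of_disjoint]
  · congr 2
    ext j
    simp only [Finset.mem_union, Finset.mem_filter, Finset.mem_compl]
    have := c.2.2.2
    have hc := c.2.1
    constructor
    · rintro (⟨h, h'⟩ | ⟨h, h', h''⟩)
      · exact ⟨h, h'.trans this⟩
      · exact ⟨h, h''⟩
    · rintro ⟨h, h'⟩
      rcases lt_trichotomy j c.1.1 with h1 | rfl | h1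
      · exact Or.inl ⟨h, h1⟩
      · exact absurd hc h
      · exact Or.inr ⟨h, h1, h'⟩
  · rw [Finset.disjoint_left]
    intro j h h'
    simp only [Finset.mem_filter] at h h'
    exact lt_asymm h.2 h'.2.1

theorem genIndex_eq_col {l : List (Box I)} {c : Box I} (hl : IsClosedOrder (l ++ [c])) :
    genIndex c + 1 + l.countP (fun b => decide (b.1.2 = c.1.2)) = c.1.2 := by
  rw [countP_col hl, genIndex, ← card_filter_lt_add I c.1.2]
  have : (I.filter fun i => i < c.1.2) =
      (insert c.1.1 (I.filter fun i => i < c.1.1)) ∪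
        (I.filter fun i => c.1.1 < i ∧ i < c.1.2) := by
    ext j
    simp only [Finset.mem_union, Finset.mem_filter, Finset.mem_insert]
    have := c.2.2.2
    have hc := c.2.1
    constructor
    · rintro ⟨h, h'⟩
      rcases lt_trichotomy j c.1.1 with h1 | rfl | h1
      · exact Or.inl (Or.inr ⟨h, h1⟩)
      · exact Or.inl (Or.inl rfl)
      · exact Or.inr ⟨h, h1, h'⟩
    · rintro ((rfl | ⟨h, h'⟩) | ⟨h, h', h''⟩)
      · exact ⟨hc, this⟩
      · exact ⟨h, h'.trans this⟩
      · exact ⟨h, h''⟩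
  rw [this, Finset.card_union_of_disjoint, Finset.card_insert_of_notMem (by simp)]
  · ring
  · rw [Finset.disjoint_left]
    intro j h h'
    simp only [Finset.mem_filter, Finset.mem_insert] at h h'
    rcases h with rfl | h
    · exact lt_irrefl _ h'.2.1
    · exact lt_asymm h.2 h'.2.1

theorem wordPerm_concat (l : List (Box I)) (c : Box I) :
    wordPerm (l ++ [c]) = wordPerm l * simpleReflection n (genIndex c) := by
  simp [wordPerm]

/-- The position on the frontier of the listed boxes of the row or column labelled `x`. -/
theorem wordPerm_inv_apply (l : List (Box I)) (hl : IsClosedOrder l) (x : Fin n) :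
    ((((wordPerm l)⁻¹ x : Fin n) : ℕ) + l.countP (fun b => decide (b.1.2 = x)) =
      x + l.countP (fun b => decide (b.1.1 = x))) := by
  induction l using List.reverseRecOn generalizing x with
  | nil => simp [wordPerm]
  | append_singleton l c ih =>
    have ih' := ih hl.of_append
    have hi := ih' c.1.1
    have hj := ih' c.1.2
    have hi0 : l.countP (fun b => decide (b.1.2 = c.1.1)) = 0 := by
      rw [List.countP_eq_zero]
      intro b _ h
      exact b.2.2.1 ((of_decide_eq_true h) ▸ c.2.1)
    have hj0 : l.countP (fun b => decide (b.1.1 = c.1.2)) = 0 := by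
      rw [List.countP_eq_zero]
      intro b _ h
      exact c.2.2.1 ((of_decide_eq_true h) ▸ b.2.1)
    have gi := genIndex_eq_row hl
    have gj := genIndex_eq_col hl
    -- The column of c stands at position `genIndex c + 1`, which is therefore less than n; so the
    -- reflection is a true transposition and not the default 1.
    have hm : genIndex c + 1 < n := by
      have := ((wordPerm l)⁻¹ c.1.2).isLt
      omega
    have ei : (wordPerm l)⁻¹ c.1.1 = ⟨genIndex c, Nat.lt_of_succ_lt hm⟩ := Fin.ext (by dsimp only; omega)
    have ej : (wordPerm l)⁻¹ c.1.2 = ⟨genIndex c + 1, hm⟩ := Fin.ext (by dsimp only; omega)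
    have hs : (simpleReflection n (genIndex c))⁻¹ =
        Equiv.swap ((wordPerm l)⁻¹ c.1.1) ((wordPerm l)⁻¹ c.1.2) := by
      rw [ei, ej]; simp [simpleReflection, hm]
    have hne : c.1.1 ≠ c.1.2 := c.2.2.2.ne
    rw [wordPerm_concat, mul_inv_rev, Equiv.Perm.mul_apply, hs, List.countP_append,
      List.countP_append, List.countP_singleton, List.countP_singleton]
    by_cases h1 : x = c.1.1
    · subst h1
      rw [Equiv.swap_apply_left, ej]
      simp only [hne.symm, decide_false, decide_true, if_true]
      simp; omega
    by_cases h2 : x = c.1.2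
    · subst h2
      rw [Equiv.swap_apply_right, ei]
      simp only [hne, decide_false, decide_true, if_true]
      simp; omega
    rw [Equiv.swap_apply_of_ne_of_ne (fun h => h1 ((wordPerm l)⁻¹.injective h))
      (fun h => h2 ((wordPerm l)⁻¹.injective h))]
    simpa [Ne.symm h1, Ne.symm h2] using ih' x

/-- The generator of c exchanges precisely the two positions at which the row and the column of c
stand. -/
theorem wordPerm_genIndex {l : List (Box I)} {c : Box I} (hl : IsClosedOrder (l ++ [c])) :
    ∃ hm : genIndex c + 1 < n, wordPerm l ⟨genIndex c, Nat.lt_of_succ_lt hm⟩ = c.1.1 ∧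
      wordPerm l ⟨genIndex c + 1, hm⟩ = c.1.2 := by
  have hi := wordPerm_inv_apply l hl.of_append c.1.1
  have hj := wordPerm_inv_apply l hl.of_append c.1.2
  have hi0 : l.countP (fun b => decide (b.1.2 = c.1.1)) = 0 := by
    rw [List.countP_eq_zero]
    intro b _ h
    exact b.2.2.1 ((of_decide_eq_true h) ▸ c.2.1)
  have hj0 : l.countP (fun b => decide (b.1.1 = c.1.2)) = 0 := by
    rw [List.countP_eq_zero]
    intro b _ h
    exact c.2.2.1 ((of_decide_eq_true h) ▸ b.2.1)
  have gi := genIndex_eq_row hl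
  have gj := genIndex_eq_col hl
  have hm : genIndex c + 1 < n := by
    have := ((wordPerm l)⁻¹ c.1.2).isLt
    omega
  refine ⟨hm, ?_, ?_⟩
  · rw [← Equiv.Perm.eq_inv_iff_eq]; exact Fin.ext (by dsimp only; omega)
  · rw [← Equiv.Perm.eq_inv_iff_eq]; exact Fin.ext (by dsimp only; omega)

-- The subexpression and the Go condition in terms of pipes.

variable {D : Box I → Stone}

theorem subexprPerm_concat_blank (l : List (Box I)) {c : Box I} (h : D c = Stone.blank) :
    subexprPerm D (l ++ [c]) = subexprPerm D l := by
  simp [subexprPerm, h]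

theorem subexprPerm_concat_stone (l : List (Box I)) {c : Box I} (h : D c ≠ Stone.blank) :
    subexprPerm D (l ++ [c]) = subexprPerm D l * simpleReflection n (genIndex c) := by
  simp [subexprPerm, h]

/-- The labels of the pipes at the positions of the frontier are given by the subexpression. -/
theorem subexprPerm_eq (l : List (Box I)) (hl : IsClosedOrder l) :
    subexprPerm D l = blankPerm D l * wordPerm l := by
  induction l using List.reverseRecOn with
  | nil => simp [subexprPerm, wordPerm, blankPerm]
  | append_singleton l c ih =>
    by_cases hc : D c = Stone.blank
    · obtain ⟨hm, h₁, h₂⟩ := wordPerm_genIndex hl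
      -- Pulled through the word, the swap of the two lines becomes the swap of their positions and
      -- cancels the new reflection, as v does not change at a blank box.
      rw [subexprPerm_concat_blank l hc, blankPerm_concat_blank l hc, wordPerm_concat,
        ih hl.of_append, mul_assoc, ← h₁, ← h₂, simpleReflection, dif_pos hm,
        ← mul_assoc (Equiv.swap _ _), Equiv.swap_mul_eq_mul_swap]
      simp
    · rw [subexprPerm_concat_stone l hc, blankPerm_concat_stone l hc, wordPerm_concat,
        ih hl.of_append, mul_assoc]

theorem goPerm_apply {e : List (Box I)} (he : IsReadingOrder e) (x : Fin n) :
    goPerm e D x = pipeAtEnd D x := by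
  rw [goPerm, subexprPerm_eq e he.isClosedOrder, mul_inv_cancel_right, blankPerm_eq_pipeAtEnd he]

/-- The Go condition in terms of pipes: the pipe that enters a box from the east has the smaller
label of the two if the box is blank or has a white stone, and the larger one if it has a black
stone. -/
theorem IsGoDiagram.pipes {e : List (Box I)} (he : IsReadingOrder e) (hD : IsGoDiagram e D)
    {l : List (Box I)} {c : Box I} (hl : IsClosedOrder (l ++ [c])) :
    (D c ≠ Stone.black → blankPerm D l c.1.1 < blankPerm D l c.1.2) ∧
    (D c = Stone.black → blankPerm D l c.1.2 < blankPerm D l c.1.1) := by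
  obtain ⟨pre, post, h⟩ := List.append_of_mem (he.1 c)
  have hpre : IsClosedOrder (pre ++ [c]) := by
    have := he.isClosedOrder
    rw [h, ← List.singleton_append, ← List.append_assoc] at this
    exact this.of_append
  -- Of the row and column of c, every closed list ending in c contains the same boxes, so the given
  -- list may be replaced by the prefix of `e` to which the Go condition applies.
  have key : ∀ {l : List (Box I)}, IsClosedOrder (l ++ [c]) → ∀ b : Box I,
      b.1.1 = c.1.1 ∨ b.1.2 = c.1.2 →
      (b ∈ l ↔ c.1.1 ≤ b.1.1 ∧ b.1.2 ≤ c.1.2 ∧ b ≠ c) := by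
    intro l hl b hb
    constructor
    · intro hbl
      have h1 := hl.not_southEast hbl
      refine ⟨?_, ?_, fun h => hl.notMem (h ▸ hbl)⟩
      · rcases hb with h | h
        · exact h.ge
        · exact le_of_not_ge fun h' => h1 ⟨h', h.ge⟩
      · rcases hb with h | h
        · exact le_of_not_ge fun h' => h1 ⟨h.le, h'⟩
        · exact h.le
    · rintro ⟨h1, h2, h3⟩
      exact hl.mem_of_southEast h1 h2 h3
  rw [blankPerm_congr_row hl.of_append hpre.of_append c.2.1 fun b hb =>
      (key hl b (Or.inl hb)).trans (key hpre b (Or.inl hb)).symm,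
    blankPerm_congr_col hl.of_append hpre.of_append c.2.2.1 fun b hb =>
      (key hl b (Or.inr hb)).trans (key hpre b (Or.inr hb)).symm]
  obtain ⟨hm, h₁, h₂⟩ := wordPerm_genIndex hpre
  have hgo := hD pre post c h
  simp only [(permLength_lt_iff hm _).1, (permLength_lt_iff hm _).2,
    subexprPerm_eq pre hpre.of_append, Equiv.Perm.mul_apply, h₁, h₂] at hgo
  refine ⟨fun hne => ?_, hgo.2.2⟩
  rcases hs : D c with _ | _ | _
  · exact hgo.1 hs
  · exact hgo.2.1 hs
  · exact absurd hs hne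

/-- A blank box sits at an ascent. In the plane this orders the two vertices of the box and keeps
the edge between them from degenerating. -/
theorem Blank.pipeNorth_lt_pipeWest {e : List (Box I)} (he : IsReadingOrder e)
    (hD : IsGoDiagram e D) (b : Blank D) : b.pipeNorth < b.pipeWest := by
  obtain ⟨pre, post, h⟩ := List.append_of_mem (he.1 b.box)
  have hpre : IsClosedOrder (pre ++ [b.box]) := by
    have := he.isClosedOrder
    rw [h, ← List.singleton_append, ← List.append_assoc] at this
    exact this.of_append
  rw [← (blankPerm_pipes hpre).1, ← (blankPerm_pipes hpre).2]
  exact (hD.pipes he hpre).1 (by rw [b.box_blank]; simp)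

end Words


/-! ### The graph: trips and edge labels -/

section Graph

variable {n : ℕ} {I : Finset (Fin n)} {D : Box I → Stone}

theorem Blank.nextEast_nextWest (b : Blank D) (h : b.westOf.Nonempty) :
    (b.nextWest h).nextEast (b.eastOf_nextWest h) = b := by
  refine Blank.ext' rfl (le_antisymm ?_ ?_)
  · by_contra hlt
    exact not_lt.2 (Blank.nextWest_le (b' := (b.nextWest h).nextEast (b.eastOf_nextWest h))
      h rfl (lt_of_not_ge hlt)) (Blank.nextEast_lt _ (b.eastOf_nextWest h))
  · exact Blank.le_nextEast (b.eastOf_nextWest h) rfl (b.nextWest_lt h)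

theorem Blank.westOf_nextEast (b : Blank D) (h : b.eastOf.Nonempty) :
    (b.nextEast h).westOf.Nonempty :=
  Blank.westOf_nonempty (b' := b) rfl (b.nextEast_lt h)

theorem Blank.nextWest_nextEast (b : Blank D) (h : b.eastOf.Nonempty) :
    (b.nextEast h).nextWest (b.westOf_nextEast h) = b := by
  refine Blank.ext' rfl (le_antisymm ?_ ?_)
  · exact Blank.nextWest_le (b.westOf_nextEast h) rfl (b.nextEast_lt h)
  · by_contra hlt
    exact not_lt.2 (Blank.le_nextEast (b' := (b.nextEast h).nextWest (b.westOf_nextEast h))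
      h rfl (lt_of_not_ge hlt)) (Blank.nextWest_lt _ (b.westOf_nextEast h))

theorem Blank.nextSouth_nextNorth (b : Blank D) (h : b.northOf.Nonempty) :
    (b.nextNorth h).nextSouth (b.southOf_nextNorth h) = b := by
  refine Blank.ext' (le_antisymm ?_ ?_) rfl
  · exact Blank.nextSouth_le (b.southOf_nextNorth h) rfl (b.nextNorth_lt h)
  · by_contra hlt
    exact not_lt.2 (Blank.le_nextNorth (b' := (b.nextNorth h).nextSouth (b.southOf_nextNorth h))
      h rfl (lt_of_not_ge hlt)) (Blank.nextSouth_lt _ (b.southOf_nextNorth h))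

theorem Blank.northOf_nextSouth (b : Blank D) (h : b.southOf.Nonempty) :
    (b.nextSouth h).northOf.Nonempty :=
  Blank.northOf_nonempty (b' := b) rfl (b.nextSouth_lt h)

theorem Blank.nextNorth_nextSouth (b : Blank D) (h : b.southOf.Nonempty) :
    (b.nextSouth h).nextNorth (b.northOf_nextSouth h) = b := by
  refine Blank.ext' (le_antisymm ?_ ?_) rfl
  · by_contra hlt
    exact not_lt.2 (Blank.nextSouth_le (b' := (b.nextSouth h).nextNorth (b.northOf_nextSouth h))
      h rfl (lt_of_not_ge hlt)) (Blank.nextNorth_lt _ (b.northOf_nextSouth h))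
  · exact Blank.le_nextNorth (b.northOf_nextSouth h) rfl (b.nextSouth_lt h)

theorem Blank.pipeWest_nextEast (b : Blank D) (h : b.eastOf.Nonempty) :
    (b.nextEast h).pipeWest = b.pipeNorth := by
  conv_rhs => rw [Blank.pipeNorth, dif_pos h]

theorem Blank.pipeNorth_nextSouth (b : Blank D) (h : b.southOf.Nonempty) :
    (b.nextSouth h).pipeNorth = b.pipeWest := by
  conv_rhs => rw [Blank.pipeWest, dif_pos h]

theorem Blank.pipeNorth_nextWest (b : Blank D) (h : b.westOf.Nonempty) :
    (b.nextWest h).pipeNorth = b.pipeWest := by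
  rw [← Blank.pipeWest_nextEast _ (b.eastOf_nextWest h), Blank.nextEast_nextWest]

theorem Blank.pipeWest_nextNorth (b : Blank D) (h : b.northOf.Nonempty) :
    (b.nextNorth h).pipeWest = b.pipeNorth := by
  rw [← Blank.pipeNorth_nextSouth _ (b.southOf_nextNorth h), Blank.nextSouth_nextNorth]

theorem goRev_white_zero (b : Blank D) (h) : goRev (whiteDart b h 0) = leaveNorth b := rfl

theorem goRev_white_one (b : Blank D) (h) : goRev (whiteDart b h 1) =
    open Classical in if h : b.southOf.Nonempty then blackDart b h 2 else leaveWest b := rfl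

theorem goRev_white_two (b : Blank D) (h) :
    goRev (whiteDart b h 2) = enterWest (b.nextEast h) := rfl

theorem goRev_black_zero (b : Blank D) (h) : goRev (blackDart b h 0) = leaveWest b := rfl

theorem goRev_black_one (b : Blank D) (h) :
    goRev (blackDart b h 1) = enterNorth (b.nextSouth h) := rfl

theorem goRev_black_two (b : Blank D) (h) : goRev (blackDart b h 2) =
    open Classical in if h : b.eastOf.Nonempty then whiteDart b h 1 else leaveNorth b := rfl

theorem IsWestmost.goRev {x : Fin n} {b : Blank D} (h : IsWestmost x b) (hx) :
    goRev (Sum.inr ⟨x, hx⟩ : GoDart D) = enterWest b := by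
  have hex : ∃ b : Blank D, IsWestmost x b := ⟨b, h⟩
  rw [KPSoliton.goRev, dif_pos hex, hex.choose_spec.unique h]

theorem IsNorthmost.goRev {x : Fin n} {b : Blank D} (h : IsNorthmost x b) (hx) :
    goRev (Sum.inr ⟨x, hx⟩ : GoDart D) = enterNorth b := by
  have hex : ∃ b : Blank D, IsNorthmost x b := ⟨b, h⟩
  rw [KPSoliton.goRev, dif_neg h.not_isWestmost, dif_pos hex, hex.choose_spec.unique h]

theorem goRev_leaveWest (b : Blank D) : goRev (leaveWest b) = enterWest b := by
  rw [leaveWest]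
  split_ifs with h
  · rw [goRev_white_two, Blank.nextEast_nextWest]
  · exact IsWestmost.goRev ⟨rfl, h⟩ _

theorem goRev_leaveNorth (b : Blank D) : goRev (leaveNorth b) = enterNorth b := by
  rw [leaveNorth]
  split_ifs with h
  · rw [goRev_black_one, Blank.nextSouth_nextNorth]
  · exact IsNorthmost.goRev ⟨rfl, h⟩ _

/-- If both vertices of the box are forgotten, the edge passes on to the north, and reversing it
comes back through `enterNorth` to the west. -/
theorem goRev_enterWest (b : Blank D) : goRev (enterWest b) = leaveWest b := by
  rw [enterWest]
  split_ifs with h h'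
  · rfl
  · rw [goRev_white_one, dif_neg h]
  · rw [goRev_leaveNorth, enterNorth, dif_neg h', dif_neg h]

theorem goRev_enterNorth (b : Blank D) : goRev (enterNorth b) = leaveNorth b := by
  rw [enterNorth]
  split_ifs with h h'
  · rfl
  · rw [goRev_black_two, dif_neg h]
  · rw [goRev_leaveWest, enterWest, dif_neg h', dif_neg h]

/-- Every boundary half-edge is the end of a row or of a column. -/
theorem exists_isWestmost_or_isNorthmost {x : Fin n} (hx : LineHasBlank D x) :
    (∃ b : Blank D, IsWestmost x b) ∨ ∃ b : Blank D, IsNorthmost x b := by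
  obtain ⟨b, rfl | rfl⟩ := hx
  · exact Or.inl (exists_isWestmost b)
  · exact Or.inr (exists_isNorthmost b)

theorem leaveWest_of_isWestmost {x : Fin n} {b : Blank D} (h : IsWestmost x b) (hx) :
    leaveWest b = Sum.inr ⟨x, hx⟩ := by
  obtain ⟨rfl, h⟩ := h
  rw [leaveWest, dif_neg h]

theorem leaveNorth_of_isNorthmost {x : Fin n} {b : Blank D} (h : IsNorthmost x b) (hx) :
    leaveNorth b = Sum.inr ⟨x, hx⟩ := by
  obtain ⟨rfl, h⟩ := h
  rw [leaveNorth, dif_neg h]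

theorem goRev_goRev (d : GoDart D) : goRev (goRev d) = d := by
  rcases d with ⟨⟨b, h⟩ | ⟨b, h⟩, m⟩ | ⟨x, hx⟩
  · obtain rfl | rfl | rfl : m = 0 ∨ m = 1 ∨ m = 2 := by omega
    · rw [goRev_white_zero, goRev_leaveNorth, enterNorth, dif_pos h]
    · rw [goRev_white_one]
      split_ifs with h'
      · rw [goRev_black_two, dif_pos h]
      · rw [goRev_leaveWest, enterWest, dif_neg h', dif_pos h]
    · rw [goRev_white_two, goRev_enterWest, leaveWest, dif_pos (b.westOf_nextEast h)]
      congr 3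
      exact Blank.nextWest_nextEast b h
  · obtain rfl | rfl | rfl : m = 0 ∨ m = 1 ∨ m = 2 := by omega
    · rw [goRev_black_zero, goRev_leaveWest, enterWest, dif_pos h]
    · rw [goRev_black_one, goRev_enterNorth, leaveNorth, dif_pos (b.northOf_nextSouth h)]
      congr 3
      exact Blank.nextNorth_nextSouth b h
    · rw [goRev_black_two]
      split_ifs with h'
      · rw [goRev_white_one, dif_pos h]
      · rw [goRev_leaveNorth, enterNorth, dif_neg h', dif_pos h]
  · rcases exists_isWestmost_or_isNorthmost hx with ⟨b, h⟩ | ⟨b, h⟩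
    · rw [h.goRev, goRev_enterWest, leaveWest_of_isWestmost h]
    · rw [h.goRev, goRev_enterNorth, leaveNorth_of_isNorthmost h]

/-- The label of the trip that runs along a half-edge away from its vertex. -/
noncomputable def tripLabel : GoDart D → Fin n
  | Sum.inl (Sum.inl b, m) => if m = 0 then b.1.1.2 else if m = 1 then b.1.1.1 else b.1.pipeNorth
  | Sum.inl (Sum.inr b, m) => if m = 0 then b.1.1.1 else if m = 1 then b.1.pipeWest else b.1.1.2
  | Sum.inr x => pipeAtEnd D x

theorem tripLabel_leaveWest (b : Blank D) : tripLabel (leaveWest b) = b.pipeWest := by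
  rw [leaveWest]
  split_ifs with h
  · exact b.pipeNorth_nextWest h
  · exact IsWestmost.pipeAtEnd ⟨rfl, h⟩

theorem tripLabel_leaveNorth (b : Blank D) : tripLabel (leaveNorth b) = b.pipeNorth := by
  rw [leaveNorth]
  split_ifs with h
  · exact b.pipeWest_nextNorth h
  · exact IsNorthmost.pipeAtEnd ⟨rfl, h⟩

/-- When both vertices are forgotten there is no blank box to the east, so the pipe that turns north
is the row's own and the label is still that of the row. -/
theorem tripLabel_enterWest (b : Blank D) : tripLabel (enterWest b) = b.1.1 := by
  rw [enterWest]
  split_ifs with h h'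
  · rfl
  · rfl
  · rw [tripLabel_leaveNorth, b.pipeNorth_eq_row_iff.2 h']

theorem tripLabel_enterNorth (b : Blank D) : tripLabel (enterNorth b) = b.1.2 := by
  rw [enterNorth]
  split_ifs with h h'
  · rfl
  · rfl
  · rw [tripLabel_leaveWest, b.pipeWest_eq_col_iff.2 h']

theorem tripLabel_goRev_inr (x : Fin n) (hx) :
    tripLabel (goRev (Sum.inr ⟨x, hx⟩ : GoDart D)) = x := by
  rcases exists_isWestmost_or_isNorthmost hx with ⟨b, h⟩ | ⟨b, h⟩
  · rw [h.goRev, tripLabel_enterWest, h.1]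
  · rw [h.goRev, tripLabel_enterNorth, h.1]

theorem tripLabel_goRev_white (b : Blank D) (h) (m : Fin 3) :
    tripLabel (goRev (whiteDart b h m)) =
      if m = 0 then b.pipeNorth else if m = 1 then b.1.2 else b.1.1 := by
  obtain rfl | rfl | rfl : m = 0 ∨ m = 1 ∨ m = 2 := by omega
  · exact tripLabel_leaveNorth b
  · change tripLabel (goRev (whiteDart b h 1)) = b.1.2
    rw [goRev_white_one]
    split_ifs with h'
    · rfl
    · rw [tripLabel_leaveWest, b.pipeWest_eq_col_iff.2 h']
  · rw [goRev_white_two, tripLabel_enterWest]; rfl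

theorem tripLabel_goRev_black (b : Blank D) (h) (m : Fin 3) :
    tripLabel (goRev (blackDart b h m)) =
      if m = 0 then b.pipeWest else if m = 1 then b.1.2 else b.1.1 := by
  obtain rfl | rfl | rfl : m = 0 ∨ m = 1 ∨ m = 2 := by omega
  · exact tripLabel_leaveWest b
  · rw [goRev_black_one, tripLabel_enterNorth]; rfl
  · change tripLabel (goRev (blackDart b h 2)) = b.1.1
    rw [goRev_black_two]
    split_ifs with h'
    · rfl
    · rw [tripLabel_leaveNorth, b.pipeNorth_eq_row_iff.2 h']

theorem tripLabel_white (b : Blank D) (h) (m : Fin 3) :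
    tripLabel (whiteDart b h m) =
      if m = 0 then b.1.2 else if m = 1 then b.1.1 else b.pipeNorth := rfl

theorem tripLabel_black (b : Blank D) (h) (m : Fin 3) :
    tripLabel (blackDart b h m) =
      if m = 0 then b.1.1 else if m = 1 then b.pipeWest else b.1.2 := rfl

/-- A white vertex is kept only if there is a blank box to the east, and then the pipe on its elbow
is not the row's own; similarly for black vertices and columns. This separates the labels in the
otherwise ambiguous case. -/
theorem tripLabel_ne_goRev (d : GoDart D) : tripLabel d ≠ tripLabel (goRev d) := by
  rcases d with ⟨⟨b, h⟩ | ⟨b, h⟩, m⟩ | ⟨x, hx⟩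
  · have h1 : b.pipeNorth ≠ b.1.1 := fun h' => b.pipeNorth_eq_row_iff.1 h' h
    have h2 := b.pipeNorth_lt_col.ne'
    have h3 := b.row_lt_col.ne
    obtain rfl | rfl | rfl : m = 0 ∨ m = 1 ∨ m = 2 := by omega
    all_goals rw [tripLabel_goRev_white, tripLabel_white]; simpa
  · have h1 : b.pipeWest ≠ b.1.2 := fun h' => b.pipeWest_eq_col_iff.1 h' h
    have h2 := b.row_lt_pipeWest.ne
    have h3 := b.row_lt_col.ne'
    obtain rfl | rfl | rfl : m = 0 ∨ m = 1 ∨ m = 2 := by omega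
    all_goals rw [tripLabel_goRev_black, tripLabel_black]; simpa
  · rw [tripLabel_goRev_inr]
    change pipeAtEnd D x ≠ x
    rcases exists_isWestmost_or_isNorthmost hx with ⟨b, h⟩ | ⟨b, h⟩
    · rw [h.pipeAtEnd, ← h.1]; exact b.row_lt_pipeWest.ne'
    · rw [h.pipeAtEnd, ← h.1]; exact b.pipeNorth_lt_col.ne

/-- The rules of the road preserve the label: right turns at black vertices and left turns at white
ones match the cyclic numbering of the half-edges. -/
theorem OnTrip.tripLabel_eq {x : Fin n} {d : (goMinus D).Dart} (h : (goMinus D).OnTrip x d) :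
    tripLabel (D := D) d = pipeAtEnd D x := by
  induction h with
  | start d h =>
    rcases d with ⟨v, m⟩ | y
    · simp [goMinus] at h
    · have : (y : Fin n) = x := by simpa [goMinus] using h
      rw [← this]; rfl
  | turnRight d v hd h hv ih =>
    rw [← ih]
    change tripLabel ((goMinus D).rot (goRev d)) = _
    change (Sum.map Prod.fst Subtype.val (goRev d)) = Sum.inl v at h
    have hd' : d = goRev (goRev d) := (goRev_goRev d).symm
    conv_rhs => rw [hd']
    generalize goRev d = d' at h ⊢
    rcases d' with ⟨⟨b, hb⟩ | ⟨b, hb⟩, m⟩ | y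
    · have : v = Sum.inl ⟨b, hb⟩ := Sum.inl_injective h.symm
      subst this
      simp [goMinus] at hv
    · rw [tripLabel_goRev_black]
      change tripLabel (blackDart b hb (finRotate 3 m)) = _
      obtain rfl | rfl | rfl : m = 0 ∨ m = 1 ∨ m = 2 := by omega
      all_goals rfl
    · simp at h
  | turnLeft d v hd h hv ih =>
    rw [← ih]
    change tripLabel ((goMinus D).rot.symm (goRev d)) = _
    change (Sum.map Prod.fst Subtype.val (goRev d)) = Sum.inl v at h
    have hd' : d = goRev (goRev d) := (goRev_goRev d).symm
    conv_rhs => rw [hd']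
    generalize goRev d = d' at h ⊢
    rcases d' with ⟨⟨b, hb⟩ | ⟨b, hb⟩, m⟩ | y
    · rw [tripLabel_goRev_white]
      change tripLabel (whiteDart b hb ((finRotate 3).symm m)) = _
      obtain rfl | rfl | rfl : m = 0 ∨ m = 1 ∨ m = 2 := by omega
      all_goals rfl
    · have : v = Sum.inr ⟨b, hb⟩ := Sum.inl_injective h.symm
      subst this
      simp [goMinus] at hv
    · simp at h

-- The course of a trip.

/-- The trip starting at `x` runs along some half-edge towards `d`. -/
def TripReaches (x : Fin n) (d : GoDart D) : Prop :=
  ∃ d', (goMinus D).OnTrip x d' ∧ goRev d' = d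

theorem OnTrip.tripReaches {x : Fin n} {d : GoDart D} (h : (goMinus D).OnTrip x d) :
    TripReaches x (goRev d) := ⟨d, h, rfl⟩

theorem TripReaches.white {x : Fin n} {b : Blank D} {h} {m : Fin 3}
    (hr : TripReaches x (whiteDart b h m)) :
    (goMinus D).OnTrip x (whiteDart b h ((finRotate 3).symm m)) := by
  obtain ⟨d', hd, hr⟩ := hr
  have := PlabicGraph.OnTrip.turnLeft (G := goMinus D) (x := x) d' (Sum.inl ⟨b, h⟩) hd
    (by change Sum.map Prod.fst Subtype.val (goRev d') = _; rw [hr]; rfl) (by simp [goMinus])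
  change (goMinus D).OnTrip x ((goMinus D).rot.symm (goRev d')) at this
  rw [hr] at this
  exact this

theorem TripReaches.black {x : Fin n} {b : Blank D} {h} {m : Fin 3}
    (hr : TripReaches x (blackDart b h m)) :
    (goMinus D).OnTrip x (blackDart b h (finRotate 3 m)) := by
  obtain ⟨d', hd, hr⟩ := hr
  have := PlabicGraph.OnTrip.turnRight (G := goMinus D) (x := x) d' (Sum.inr ⟨b, h⟩) hd
    (by change Sum.map Prod.fst Subtype.val (goRev d') = _; rw [hr]; rfl) (by simp [goMinus])
  change (goMinus D).OnTrip x ((goMinus D).rot (goRev d')) at this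
  rw [hr] at this
  exact this

/-- First phase of a trip: it runs backwards along the pipe that ends at its boundary vertex. The
induction is on the distance from the north-west border; injectivity of `pipeAtEnd` identifies the
end of the pipe with x. -/
theorem tripReaches_enter (hinj : Function.Injective (pipeAtEnd D)) (x : Fin n) (N : ℕ) :
    ∀ b : Blank D, (b.1.1 : ℕ) + (n - (b.1.2 : ℕ)) < N →
    (pipeAtEnd D x = b.pipeNorth → TripReaches x (enterNorth b)) ∧
    (pipeAtEnd D x = b.pipeWest → TripReaches x (enterWest b)) := by
  induction N with
  | zero => simp
  | succ N ih =>
    intro b hb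
    constructor
    · intro hx
      by_cases h : b.northOf.Nonempty
      · have hlt : ((b.nextNorth h).1.1 : ℕ) < b.1.1 := b.nextNorth_lt h
        have hr : (b.nextNorth h).1.2 = b.1.2 := rfl
        have := (ih (b.nextNorth h) (by rw [hr]; omega)).2 (by rw [b.pipeWest_nextNorth, hx])
        rw [enterWest, dif_pos (b.southOf_nextNorth h)] at this
        have := OnTrip.tripReaches this.black
        rwa [show finRotate 3 0 = 1 from rfl, goRev_black_one, b.nextSouth_nextNorth] at this
      · have hn : IsNorthmost b.1.2 b := ⟨rfl, h⟩
        rw [← hn.pipeAtEnd] at hx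
        obtain rfl := hinj hx
        rw [← hn.goRev ⟨b, Or.inr rfl⟩]
        exact OnTrip.tripReaches (PlabicGraph.OnTrip.start _ rfl)
    · intro hx
      by_cases h : b.westOf.Nonempty
      · have hlt : (b.1.2 : ℕ) < ((b.nextWest h).1.2 : ℕ) := b.nextWest_lt h
        have hlt' := (b.nextWest h).1.2.isLt
        have hr : (b.nextWest h).1.1 = b.1.1 := rfl
        have := (ih (b.nextWest h) (by rw [hr]; omega)).1 (by rw [b.pipeNorth_nextWest, hx])
        rw [enterNorth, dif_pos (b.eastOf_nextWest h)] at this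
        have := OnTrip.tripReaches this.white
        rwa [show (finRotate 3).symm 0 = 2 from rfl, goRev_white_two, b.nextEast_nextWest] at this
      · have hn : IsWestmost b.1.1 b := ⟨rfl, h⟩
        rw [← hn.pipeAtEnd] at hx
        obtain rfl := hinj hx
        rw [← hn.goRev ⟨b, Or.inl rfl⟩]
        exact OnTrip.tripReaches (PlabicGraph.OnTrip.start _ rfl)

theorem tripReaches_enterNorth (hinj : Function.Injective (pipeAtEnd D)) {x : Fin n} {b : Blank D}
    (h : pipeAtEnd D x = b.pipeNorth) : TripReaches x (enterNorth b) :=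
  (tripReaches_enter hinj x _ b (Nat.lt_succ_self _)).1 h

theorem tripReaches_enterWest (hinj : Function.Injective (pipeAtEnd D)) {x : Fin n} {b : Blank D}
    (h : pipeAtEnd D x = b.pipeWest) : TripReaches x (enterWest b) :=
  (tripReaches_enter hinj x _ b (Nat.lt_succ_self _)).2 h

/-- Second phase: having reached the beginning of its pipe, at a vertical border step, the trip
follows the whole row of that label, from east to west. At a box without blank boxes to the east,
the row is still its own pipe and the first phase hands over. -/
theorem tripReaches_row (hinj : Function.Injective (pipeAtEnd D)) (x : Fin n) (N : ℕ) :
    ∀ b : Blank D, (b.1.2 : ℕ) < N → pipeAtEnd D x = b.1.1 →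
      (∀ h, (goMinus D).OnTrip x (whiteDart b h 1)) ∧
      (∀ h, (goMinus D).OnTrip x (blackDart b h 0)) ∧ TripReaches x (leaveWest b) := by
  induction N with
  | zero => simp
  | succ N ih =>
    intro b hb hx
    have hw : ∀ h, (goMinus D).OnTrip x (whiteDart b h 1) := by
      intro h
      have hlt : ((b.nextEast h).1.2 : ℕ) < b.1.2 := b.nextEast_lt h
      have := (ih (b.nextEast h) (by omega) hx).2.2
      rw [leaveWest, dif_pos (b.westOf_nextEast h)] at this
      have heq : whiteDart ((b.nextEast h).nextWest (b.westOf_nextEast h))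
          ((b.nextEast h).eastOf_nextWest (b.westOf_nextEast h)) 2 = whiteDart b h 2 := by
        congr 3
        exact Blank.nextWest_nextEast b h
      rw [heq] at this
      exact this.white
    have hb' : ∀ h, (goMinus D).OnTrip x (blackDart b h 0) := by
      intro h
      by_cases h' : b.eastOf.Nonempty
      · have := OnTrip.tripReaches (hw h')
        rw [goRev_white_one, dif_pos h] at this
        exact this.black
      · have := tripReaches_enterNorth hinj (hx.trans (b.pipeNorth_eq_row_iff.2 h').symm)
        rw [enterNorth, dif_neg h', dif_pos h] at this
        exact this.black
    refine ⟨hw, hb', ?_⟩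
    by_cases h : b.southOf.Nonempty
    · exact OnTrip.tripReaches (hb' h)
    · by_cases h' : b.eastOf.Nonempty
      · have := OnTrip.tripReaches (hw h')
        rwa [goRev_white_one, dif_neg h] at this
      · have := tripReaches_enterNorth hinj (hx.trans (b.pipeNorth_eq_row_iff.2 h').symm)
        rwa [enterNorth, dif_neg h', dif_neg h] at this

theorem tripReaches_col (hinj : Function.Injective (pipeAtEnd D)) (x : Fin n) (N : ℕ) :
    ∀ b : Blank D, n - (b.1.1 : ℕ) < N → pipeAtEnd D x = b.1.2 →
      (∀ h, (goMinus D).OnTrip x (blackDart b h 2)) ∧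
      (∀ h, (goMinus D).OnTrip x (whiteDart b h 0)) ∧ TripReaches x (leaveNorth b) := by
  induction N with
  | zero => simp
  | succ N ih =>
    intro b hb hx
    have hw : ∀ h, (goMinus D).OnTrip x (blackDart b h 2) := by
      intro h
      have hlt : (b.1.1 : ℕ) < ((b.nextSouth h).1.1 : ℕ) := b.nextSouth_lt h
      have := (b.nextSouth h).1.1.isLt
      have := (ih (b.nextSouth h) (by omega) hx).2.2
      rw [leaveNorth, dif_pos (b.northOf_nextSouth h)] at this
      have heq : blackDart ((b.nextSouth h).nextNorth (b.northOf_nextSouth h))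
          ((b.nextSouth h).southOf_nextNorth (b.northOf_nextSouth h)) 1 = blackDart b h 1 := by
        congr 3
        exact Blank.nextNorth_nextSouth b h
      rw [heq] at this
      exact this.black
    have hb' : ∀ h, (goMinus D).OnTrip x (whiteDart b h 0) := by
      intro h
      by_cases h' : b.southOf.Nonempty
      · have := OnTrip.tripReaches (hw h')
        rw [goRev_black_two, dif_pos h] at this
        exact this.white
      · have := tripReaches_enterWest hinj (hx.trans (b.pipeWest_eq_col_iff.2 h').symm)
        rw [enterWest, dif_neg h', dif_pos h] at this
        exact this.white
    refine ⟨hw, hb', ?_⟩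
    by_cases h : b.eastOf.Nonempty
    · exact OnTrip.tripReaches (hb' h)
    · by_cases h' : b.southOf.Nonempty
      · have := OnTrip.tripReaches (hw h')
        rwa [goRev_black_two, dif_neg h] at this
      · have := tripReaches_enterWest hinj (hx.trans (b.pipeWest_eq_col_iff.2 h').symm)
        rwa [enterWest, dif_neg h', dif_neg h] at this

/-- Half-edges labelled by a pipe are reached in the first phase, those labelled by their own row or
column in the second. -/
theorem onTrip_iff (hinj : Function.Injective (pipeAtEnd D)) {x : Fin n} {d : GoDart D} :
    (goMinus D).OnTrip x d ↔ tripLabel d = pipeAtEnd D x := by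
  refine ⟨OnTrip.tripLabel_eq, fun hd => ?_⟩
  rcases d with ⟨⟨b, h⟩ | ⟨b, h⟩, m⟩ | ⟨y, hy⟩
  · obtain rfl | rfl | rfl : m = 0 ∨ m = 1 ∨ m = 2 := by omega
    · exact (tripReaches_col hinj x _ b (Nat.lt_succ_self _) hd.symm).2.1 h
    · exact (tripReaches_row hinj x _ b (Nat.lt_succ_self _) hd.symm).1 h
    · have := tripReaches_enterNorth hinj (b := b) hd.symm
      rw [enterNorth, dif_pos h] at this
      exact this.white
  · obtain rfl | rfl | rfl : m = 0 ∨ m = 1 ∨ m = 2 := by omega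
    · exact (tripReaches_row hinj x _ b (Nat.lt_succ_self _) hd.symm).2.1 h
    · have := tripReaches_enterWest hinj (b := b) hd.symm
      rw [enterWest, dif_pos h] at this
      exact this.black
    · exact (tripReaches_col hinj x _ b (Nat.lt_succ_self _) hd.symm).1 h
  · have : y = x := hinj hd
    subst this
    exact PlabicGraph.OnTrip.start _ rfl

theorem edgeLabels_eq (hbij : Function.Bijective (pipeAtEnd D)) (d : GoDart D) :
    (goMinus D).edgeLabels d = {tripLabel d, tripLabel (goRev d)} := by
  ext a
  constructor
  · rintro ⟨x, rfl, h | h⟩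
    · exact Or.inl ((onTrip_iff hbij.1).1 h).symm
    · exact Or.inr ((onTrip_iff hbij.1).1 h).symm
  · obtain ⟨x, rfl⟩ := hbij.2 a
    rintro (h | h)
    · exact ⟨x, rfl, Or.inl ((onTrip_iff hbij.1).2 h.symm)⟩
    · exact ⟨x, rfl, Or.inr ((onTrip_iff hbij.1).2 h.symm)⟩

theorem pipeAtEnd_bijective {e : List (Box I)} (he : IsReadingOrder e) :
    Function.Bijective (pipeAtEnd D) := by
  have : pipeAtEnd D = goPerm e D := funext fun x => (goPerm_apply he x).symm
  rw [this]; exact (goPerm e D).bijective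

theorem goMinus_isIsolated_iff (x : Fin n) : (goMinus D).IsIsolated x ↔ ¬ LineHasBlank D x := by
  constructor
  · exact fun h hx => h (Sum.inr ⟨x, hx⟩) rfl
  · rintro h (⟨v, m⟩ | ⟨y, hy⟩) hd
    · simp [goMinus] at hd
    · have : y = x := by simpa [goMinus] using hd
      exact h (this ▸ hy)

/-- A trip arriving at the end of the line y has label y. So the trip from x ends at the line
`pipeAtEnd D x`, whose boundary vertex is labelled by applying `pipeAtEnd D` once more. -/
theorem goMinus_hasTripPermutation {e : List (Box I)} (he : IsReadingOrder e) :
    (goMinus D).HasTripPermutation (goPerm e D) := by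
  intro x y
  have hbij := pipeAtEnd_bijective (D := D) he
  rw [goPerm_apply he]
  change _ ↔ pipeAtEnd D y = pipeAtEnd D (pipeAtEnd D x)
  rw [hbij.1.eq_iff]
  constructor
  · rintro (⟨h, rfl⟩ | ⟨d, hd, h⟩)
    · rw [pipeAtEnd_of_not_lineHasBlank ((goMinus_isIsolated_iff _).1 h)]
    · replace hd := (onTrip_iff hbij.1).1 hd
      rw [← hd]
      change Sum.map Prod.fst Subtype.val (goRev d) = _ at h
      rcases hr : goRev d with ⟨v, m⟩ | ⟨z, hz⟩
      · simp [hr] at h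
      · rw [hr] at h
        obtain rfl : z = y := Sum.inr_injective h
        rw [← tripLabel_goRev_inr z hz, ← hr]
        exact congrArg tripLabel (goRev_goRev (D := D) d)
  · intro h
    by_cases hy : LineHasBlank D y
    · refine Or.inr ⟨goRev (Sum.inr ⟨y, hy⟩), ?_, ?_⟩
      · rw [onTrip_iff hbij.1, tripLabel_goRev_inr, h]
      · change Sum.map Prod.fst Subtype.val (goRev (goRev _)) = _
        rw [goRev_goRev]; rfl
    · have hxy : x = y := hbij.1 ((pipeAtEnd_of_not_lineHasBlank hy).trans h).symm
      exact Or.inl ⟨(goMinus_isIsolated_iff _).2 (hxy ▸ hy), hxy.symm⟩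

theorem goMinus_isGeneralizedPlabic {e : List (Box I)} (he : IsReadingOrder e) :
    (goMinus D).IsGeneralizedPlabic := by
  classical
  refine ⟨?_, ?_, ?_, ?_, pipeAtEnd_bijective he, ?_, ?_⟩
  · change Finite (WhiteVert D ⊕ BlackVert D); infer_instance
  · change Finite (GoDart D); infer_instance
  · exact fun d => ⟨goRev_goRev d, fun h => tripLabel_ne_goRev d (congrArg tripLabel h).symm⟩
  · have hrot : ∀ (d d' : GoDart D), (goMinus D).rot d = d' →
        (goMinus D).tail d' = (goMinus D).tail d := by
      rintro (⟨v, m⟩ | y) d' rfl <;> rfl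
    intro d d'
    constructor
    · intro h
      rcases d with ⟨v, m⟩ | ⟨y, hy⟩ <;> rcases d' with ⟨v', m'⟩ | ⟨y', hy'⟩
      · obtain rfl : v = v' := by simpa [goMinus] using h
        have h1 : ∀ m : Fin 3, (goMinus D).rot (Sum.inl (v, m)) = Sum.inl (v, finRotate 3 m) :=
          fun m => rfl
        -- Adding 3, the order of the rotation, keeps the subtraction from truncating.
        refine ⟨((m' : ℕ) + 3 - m : ℕ), ?_⟩
        rw [zpow_natCast]
        obtain rfl | rfl | rfl : m = 0 ∨ m = 1 ∨ m = 2 := by omega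
        all_goals obtain rfl | rfl | rfl : m' = 0 ∨ m' = 1 ∨ m' = 2 := by omega
        all_goals rfl
      · simp [goMinus] at h
      · simp [goMinus] at h
      · obtain rfl : y = y' := by simpa [goMinus] using h
        exact Equiv.Perm.SameCycle.refl _ _
    · rintro ⟨z, rfl⟩
      have key : ∀ N : ℕ, ∀ d, (goMinus D).tail (((goMinus D).rot ^ N) d) = (goMinus D).tail d := by
        intro N
        induction N with
        | zero => intro d; rfl
        | succ N ih => intro d; rw [pow_succ, Equiv.Perm.mul_apply, ih]; exact hrot _ _ rfl
      rcases z with N | N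
      · exact (key N d).symm
      · have := key (N + 1) (((goMinus D).rot ^ (Int.negSucc N)) d)
        rw [← this, zpow_negSucc, ← Equiv.Perm.mul_apply, mul_inv_cancel, Equiv.Perm.one_apply]
  · rintro (⟨v, m⟩ | ⟨y, hy⟩) (⟨v', m'⟩ | ⟨y', hy'⟩) x h h'
    · simp [goMinus] at h
    · simp [goMinus] at h
    · simp [goMinus] at h'
    · obtain rfl : y = x := by simpa [goMinus] using h
      obtain rfl : y' = y := by simpa [goMinus] using h'
      rfl
  · intro x _
    change (if x ∈ I then (1 : ℤ) else -1) = 1 ∨ (if x ∈ I then (1 : ℤ) else -1) = -1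
    split_ifs <;> simp

theorem exists_edgeLabels_eq (hbij : Function.Bijective (pipeAtEnd D)) (d : GoDart D) :
    ∃ i j, i < j ∧ (goMinus D).edgeLabels d = {i, j} := by
  rw [edgeLabels_eq hbij]
  rcases lt_or_gt_of_ne (tripLabel_ne_goRev d) with h | h
  · exact ⟨_, _, h, rfl⟩
  · exact ⟨_, _, h, Set.pair_comm _ _⟩

end Graph


/-! ### The columns of the elements of `G_{𝐯,𝐰}` -/

section Vectors

variable {n : ℕ} {I : Finset (Fin n)}

theorem mul_blockMatrix {n m : ℕ} (hm : m + 1 < n) (G : Matrix (Fin n) (Fin n) ℝ) (a b c d : ℝ)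
    (r s : Fin n) :
    (G * blockMatrix n m a b c d) r s =
      if s = ⟨m + 1, hm⟩ then G r ⟨m + 1, hm⟩ * a + G r ⟨m, Nat.lt_of_succ_lt hm⟩ * c
      else if s = ⟨m, Nat.lt_of_succ_lt hm⟩ then
        G r ⟨m + 1, hm⟩ * b + G r ⟨m, Nat.lt_of_succ_lt hm⟩ * d
      else G r s := by
  set u : Fin n := ⟨m, Nat.lt_of_succ_lt hm⟩ with hu
  set w : Fin n := ⟨m + 1, hm⟩ with hw
  have huw : w ≠ u := by simp [hu, hw, Fin.ext_iff]
  have e1 : ∀ x : Fin n, (x : ℕ) = m ↔ x = u := fun x => by simp [hu, Fin.ext_iff]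
  have e2 : ∀ x : Fin n, (x : ℕ) = m + 1 ↔ x = w := fun x => by simp [hw, Fin.ext_iff]
  simp only [Matrix.mul_apply, blockMatrix, Matrix.of_apply, e1, e2]
  split_ifs with h1 h2
  · subst h1
    rw [Finset.sum_eq_add w u huw] <;> simp +contextual [huw.symm]
  · subst h2
    rw [Finset.sum_eq_add w u huw] <;> simp +contextual [huw.symm]
  · simp [h1, h2]

/-- The coefficients of the linear map by which the factor of a box acts on the two columns that
belong to the row and to the column of the box. -/
noncomputable def stepCoeff (D : Box I → Stone) (p q : Box I → ℝ) (b : Box I) : Fin 4 → ℝ :=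
  -- After the box, the row stands at position `genIndex b + 1` and the column at `genIndex b`. So
  -- the first two coefficients come from the block's column of larger index, the last two from the
  -- other.
  match D b with
  | Stone.blank => ![p b, 1, 1, 0]
  | Stone.white => ![1, 0, 0, -1]
  | Stone.black => ![-1, -q b, 0, 1]

/-- The action of the factor of a box on the columns, indexed by the rows and columns of the
diagram. -/
noncomputable def stepVec (D : Box I → Stone) (p q : Box I → ℝ) (s : Fin n → Fin n → ℝ)
    (b : Box I) : Fin n → Fin n → ℝ := fun x =>
  if x = b.1.1 then stepCoeff D p q b 0 • s b.1.1 + stepCoeff D p q b 1 • s b.1.2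
  else if x = b.1.2 then stepCoeff D p q b 2 • s b.1.1 + stepCoeff D p q b 3 • s b.1.2
  else s x

/-- The columns of the product of the factors of the listed boxes, indexed by the rows and columns
of the diagram instead of their positions on the frontier. -/
noncomputable def lineVec (D : Box I → Stone) (p q : Box I → ℝ) (l : List (Box I)) :
    Fin n → Fin n → ℝ :=
  l.foldl (stepVec D p q) fun x => Pi.single x 1

variable {D : Box I → Stone} {p q : Box I → ℝ}

theorem stepVec_row (s : Fin n → Fin n → ℝ) (b : Box I) : stepVec D p q s b b.1.1 =
    stepCoeff D p q b 0 • s b.1.1 + stepCoeff D p q b 1 • s b.1.2 := by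
  simp [stepVec]

theorem stepVec_col (s : Fin n → Fin n → ℝ) (b : Box I) : stepVec D p q s b b.1.2 =
    stepCoeff D p q b 2 • s b.1.1 + stepCoeff D p q b 3 • s b.1.2 := by
  simp [stepVec, b.2.2.2.ne']

theorem stepVec_of_ne (s : Fin n → Fin n → ℝ) (b : Box I) {x : Fin n} (h₁ : x ≠ b.1.1)
    (h₂ : x ≠ b.1.2) : stepVec D p q s b x = s x := by
  simp [stepVec, h₁, h₂]

theorem stepCoeff_zero_ne (hp : ∀ b, p b ≠ 0) (b : Box I) : stepCoeff D p q b 0 ≠ 0 := by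
  rw [stepCoeff]; rcases D b <;> simp [hp]

theorem Box.row_ne_col (b c : Box I) : b.1.1 ≠ c.1.2 := fun h => c.2.2.1 (h ▸ b.2.1)

theorem lineVec_concat (l : List (Box I)) (c : Box I) :
    lineVec D p q (l ++ [c]) = stepVec D p q (lineVec D p q l) c := by
  simp [lineVec]

/-- A factor only affects the columns at the two positions where the row and the column of its box
stand. Following the lines instead of the positions absorbs w. -/
theorem prod_boxFactor (l : List (Box I)) (hl : IsClosedOrder l) (r c : Fin n) :
    (l.map (boxFactor D p q)).prod r c = lineVec D p q l (wordPerm l c) r := by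
  induction l using List.reverseRecOn generalizing r c with
  | nil => simp [lineVec, wordPerm, Matrix.one_apply, Pi.single_apply]
  | append_singleton l b ih =>
    obtain ⟨hm, h₁, h₂⟩ := wordPerm_genIndex hl
    have ih' := ih hl.of_append
    set u : Fin n := ⟨genIndex b, Nat.lt_of_succ_lt hm⟩ with hu
    set w : Fin n := ⟨genIndex b + 1, hm⟩ with hw
    have huw : u ≠ w := by simp [hu, hw, Fin.ext_iff]
    have hs : simpleReflection n (genIndex b) = Equiv.swap u w := by
      rw [simpleReflection, dif_pos hm]
    rw [List.map_append, List.prod_append, List.map_singleton, List.prod_singleton,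
      wordPerm_concat, hs, Equiv.Perm.mul_apply, lineVec_concat]
    have hc : c = w ∨ c = u ∨ (c ≠ w ∧ c ≠ u) := by tauto
    rcases hc with rfl | rfl | ⟨hcw, hcu⟩
    · rw [Equiv.swap_apply_right, h₁, stepVec_row, stepCoeff]
      rcases hD : D b <;>
        simp [boxFactor, hD, mul_blockMatrix hm, ← mul_assoc, ih', ← hu, ← hw, h₁, h₂, huw] <;> ring
    · rw [Equiv.swap_apply_left, h₂, stepVec_col, stepCoeff]
      rcases hD : D b <;>
        simp [boxFactor, hD, mul_blockMatrix hm, ← mul_assoc, ih', ← hu, ← hw, h₁, h₂, huw]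
    · rw [Equiv.swap_apply_of_ne_of_ne hcu hcw, stepVec_of_ne]
      · rcases hD : D b <;>
          simp [boxFactor, hD, mul_blockMatrix hm, ← mul_assoc, ih', ← hu, ← hw, hcu, hcw]
      · rw [← h₁]; exact fun h => hcu ((wordPerm l).injective h)
      · rw [← h₂]; exact fun h => hcw ((wordPerm l).injective h)

theorem countP_row_eq {e : List (Box I)} (he : IsReadingOrder e) {x : Fin n} (hx : x ∈ I) :
    e.countP (fun b => decide (b.1.1 = x)) = (Iᶜ.filter fun j => x < j).card := by
  have hnd : ((e.filter fun b => decide (b.1.1 = x)).map fun b => b.1.2).Nodup := by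
    refine List.Nodup.map_on ?_ (he.isClosedOrder.nodup.filter _)
    intro b hb b' hb' h
    simp only [List.mem_filter, decide_eq_true_eq] at hb hb'
    exact Subtype.ext (Prod.ext (hb.2.trans hb'.2.symm) h)
  rw [List.countP_eq_length_filter, ← List.length_map (fun b : Box I => b.1.2),
    ← List.toFinset_card_of_nodup hnd]
  congr 1
  ext j
  simp only [List.mem_toFinset, List.mem_map, List.mem_filter, decide_eq_true_eq,
    Finset.mem_filter, Finset.mem_compl]
  exact ⟨fun ⟨b, ⟨_, hr⟩, hc⟩ => ⟨hc ▸ b.2.2.1, hc ▸ hr ▸ b.2.2.2⟩,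
    fun ⟨hj, h⟩ => ⟨⟨(x, j), hx, hj, h⟩, ⟨he.1 _, rfl⟩, rfl⟩⟩

theorem countP_col_eq {e : List (Box I)} (he : IsReadingOrder e) {x : Fin n} (hx : x ∉ I) :
    e.countP (fun b => decide (b.1.2 = x)) = (I.filter fun i => i < x).card := by
  have hnd : ((e.filter fun b => decide (b.1.2 = x)).map fun b => b.1.1).Nodup := by
    refine List.Nodup.map_on ?_ (he.isClosedOrder.nodup.filter _)
    intro b hb b' hb' h
    simp only [List.mem_filter, decide_eq_true_eq] at hb hb'
    exact Subtype.ext (Prod.ext h (hb.2.trans hb'.2.symm))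
  rw [List.countP_eq_length_filter, ← List.length_map (fun b : Box I => b.1.1),
    ← List.toFinset_card_of_nodup hnd]
  congr 1
  ext j
  simp only [List.mem_toFinset, List.mem_map, List.mem_filter, decide_eq_true_eq,
    Finset.mem_filter]
  exact ⟨fun ⟨b, ⟨_, hr⟩, hc⟩ => ⟨hc ▸ b.2.1, hc ▸ hr ▸ b.2.2.2⟩,
    fun ⟨hj, h⟩ => ⟨⟨(j, x), hj, hx, h⟩, ⟨he.1 _, rfl⟩, rfl⟩⟩

/-- The positions of the rows at the north-west border are the last ones. -/
theorem wordPerm_mem_iff {e : List (Box I)} (he : IsReadingOrder e) (c : Fin n) :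
    wordPerm e c ∈ I ↔ n - I.card ≤ (c : ℕ) := by
  obtain ⟨x, rfl⟩ := (wordPerm e)⁻¹.surjective c
  rw [← Equiv.Perm.mul_apply, mul_inv_cancel, Equiv.Perm.one_apply]
  have hpos := wordPerm_inv_apply e he.isClosedOrder x
  have hcard : Iᶜ.card = n - I.card := by rw [Finset.card_compl, Fintype.card_fin]
  have hlt := card_filter_lt_add I x
  by_cases hx : x ∈ I
  · have h0 : e.countP (fun b => decide (b.1.2 = x)) = 0 := by
      rw [List.countP_eq_zero]
      intro b _ h
      exact b.2.2.1 ((of_decide_eq_true h) ▸ hx)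
    rw [h0, countP_row_eq he hx] at hpos
    have : Iᶜ = (Iᶜ.filter fun i => i < x) ∪ Iᶜ.filter fun i => x < i := by
      rw [← Finset.filter_or]
      refine (Finset.filter_true_of_mem fun i hi => lt_or_gt_of_ne ?_).symm
      rintro rfl
      exact Finset.mem_compl.1 hi hx
    have h2 := congrArg Finset.card this
    have h3 := Finset.card_union_le (Iᶜ.filter fun i => i < x) (Iᶜ.filter fun i => x < i)
    refine iff_of_true hx ?_
    omega
  · have h0 : e.countP (fun b => decide (b.1.1 = x)) = 0 := by
      rw [List.countP_eq_zero]
      intro b _ h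
      exact hx ((of_decide_eq_true h) ▸ b.2.1)
    rw [h0, countP_col_eq he hx] at hpos
    have : (Iᶜ.filter fun i => i < x).card < Iᶜ.card :=
      Finset.card_lt_card (Finset.filter_ssubset.2 ⟨x, by simpa using hx, lt_irrefl _⟩)
    refine iff_of_false hx ?_
    omega

/-- The rows of a point of the Deodhar component span the same space as the vectors of the rows of
the diagram. -/
theorem exists_lineVec_of_mem_deodharComponent {k : ℕ} (hI : I.card = k) {e : List (Box I)}
    (he : IsReadingOrder e) {A : Matrix (Fin k) (Fin n) ℝ} (hA : A ∈ deodharComponent k e D) :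
    ∃ p q : Box I → ℝ, (∀ b, p b ≠ 0) ∧
      Submodule.span ℝ (Set.range A.row) = Submodule.span ℝ (lineVec D p q e '' I) := by
  obtain ⟨g, ⟨p, q, hp, rfl⟩, hA⟩ := hA
  refine ⟨p, q, hp, hA.trans (congrArg _ ?_)⟩
  have hcol : ∀ c, ((e.map (boxFactor D p q)).prod).col c = lineVec D p q e (wordPerm e c) :=
    fun c => funext fun r => prod_boxFactor e he.isClosedOrder r c
  ext v
  constructor
  · rintro ⟨c, hc, rfl⟩
    rw [hcol]
    exact ⟨_, (wordPerm_mem_iff he c).2 (hI ▸ hc), rfl⟩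
  · rintro ⟨x, hx, rfl⟩
    obtain ⟨c, rfl⟩ := (wordPerm e).surjective x
    exact ⟨c, hI ▸ (wordPerm_mem_iff he c).1 hx, hcol c⟩

/-! ### Supports of the columns -/

/-- When a box is read, all boxes read so far in its column lie further south, so the column vector
vanishes up to the row label. The row keeps a nonzero multiple of itself and gains nothing at or
below its first coordinate; this in turn controls the column vectors. -/
theorem lineVec_lower (hp : ∀ b, p b ≠ 0) (l : List (Box I)) (hl : IsClosedOrder l) :
    (∀ x ∈ I, lineVec D p q l x x ≠ 0 ∧ ∀ y < x, lineVec D p q l x y = 0) ∧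
    (∀ j ∉ I, ∀ i < j, (∀ b ∈ l, b.1.2 = j → i < b.1.1) → ∀ y ≤ i, lineVec D p q l j y = 0) := by
  induction l using List.reverseRecOn with
  | nil =>
    simp only [lineVec, List.foldl_nil]
    exact ⟨fun x _ => ⟨by simp, fun y hy => by simp [hy.ne]⟩,
      fun j _ i hi _ y hy => by simp [(hy.trans_lt hi).ne]⟩
  | append_singleton l c ih =>
    obtain ⟨ih₁, ih₂⟩ := ih hl.of_append
    have hcol : ∀ y ≤ c.1.1, lineVec D p q l c.1.2 y = 0 :=
      ih₂ c.1.2 c.2.2.1 c.1.1 c.2.2.2 fun b hb hbc =>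
        lt_of_not_ge fun h => hl.not_southEast hb ⟨h, hbc.ge⟩
    rw [lineVec_concat]
    constructor
    · intro x hx
      by_cases h : x = c.1.1
      · subst h
        rw [stepVec_row]
        refine ⟨?_, fun y hy => ?_⟩
        · simpa [hcol _ le_rfl] using ⟨stepCoeff_zero_ne hp c, (ih₁ _ hx).1⟩
        · simp [hcol _ hy.le, (ih₁ _ hx).2 y hy]
      · rw [stepVec_of_ne _ _ h fun h' => c.2.2.1 (h' ▸ hx)]
        exact ih₁ x hx
    · intro j hj i hi hb y hy
      have hb' : ∀ b ∈ l, b.1.2 = j → i < b.1.1 := fun b hbl => hb b (by simp [hbl])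
      by_cases h : j = c.1.2
      · subst h
        have hic := hb c (by simp) rfl
        rw [stepVec_col]
        simp [(ih₁ c.1.1 c.2.1).2 y (hy.trans_lt hic), hcol y (hy.trans hic.le)]
      · rw [stepVec_of_ne _ _ (fun h' : j = c.1.1 => hj (h' ▸ c.2.1)) h]
        exact ih₂ j hj i hi hb' y hy

/-- The Go condition prevents cancellation of last coordinates. At a blank box the column has the
larger label, so its last term survives in the row and the labels are exchanged; at a black stone
the column has the smaller label, so adding a multiple of it to the row does not move the row's last
term; a white stone only changes signs. -/
theorem lineVec_upper {e : List (Box I)} (he : IsReadingOrder e)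
    (hD : IsGoDiagram e D) (l : List (Box I)) (hl : IsClosedOrder l) (x : Fin n) :
    lineVec D p q l x (blankPerm D l x) ≠ 0 ∧
      ∀ y, blankPerm D l x < y → lineVec D p q l x y = 0 := by
  induction l using List.reverseRecOn generalizing x with
  | nil =>
    simp only [lineVec, List.foldl_nil, blankPerm, List.map_nil, List.prod_nil,
      Equiv.Perm.one_apply]
    exact ⟨by simp, fun y hy => by simp [hy.ne']⟩
  | append_singleton l c ih =>
    have ih' := ih hl.of_append
    have hgo := hD.pipes he hl
    obtain ⟨i₁, i₂⟩ := ih' c.1.1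
    obtain ⟨j₁, j₂⟩ := ih' c.1.2
    rw [lineVec_concat]
    rcases hc : D c with _ | _ | _
    · have hlt := hgo.1 (by simp [hc])
      rw [blankPerm_concat_blank l hc, Equiv.Perm.mul_apply]
      by_cases h1 : x = c.1.1
      · subst h1
        rw [stepVec_row, Equiv.swap_apply_left]
        simp only [stepCoeff, hc]
        refine ⟨by simpa [i₂ _ hlt] using j₁, fun y hy => ?_⟩
        simp [i₂ _ (hlt.trans hy), j₂ _ hy]
      by_cases h2 : x = c.1.2
      · subst h2
        rw [stepVec_col, Equiv.swap_apply_right]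
        simp only [stepCoeff, hc]
        exact ⟨by simpa using i₁, fun y hy => by simp [i₂ _ hy]⟩
      rw [stepVec_of_ne _ _ h1 h2, Equiv.swap_apply_of_ne_of_ne h1 h2]
      exact ih' x
    · rw [blankPerm_concat_stone l (by simp [hc])]
      by_cases h1 : x = c.1.1
      · subst h1
        rw [stepVec_row]
        simp only [stepCoeff, hc]
        exact ⟨by simpa using i₁, fun y hy => by simp [i₂ _ hy]⟩
      by_cases h2 : x = c.1.2
      · subst h2
        rw [stepVec_col]
        simp only [stepCoeff, hc]
        exact ⟨by simpa using j₁, fun y hy => by simp [j₂ _ hy]⟩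
      rw [stepVec_of_ne _ _ h1 h2]
      exact ih' x
    · have hlt := hgo.2 hc
      rw [blankPerm_concat_stone l (by simp [hc])]
      by_cases h1 : x = c.1.1
      · subst h1
        rw [stepVec_row]
        simp only [stepCoeff, hc]
        refine ⟨by simpa [j₂ _ hlt] using i₁, fun y hy => ?_⟩
        simp [j₂ _ (hlt.trans hy), i₂ _ hy]
      by_cases h2 : x = c.1.2
      · subst h2
        rw [stepVec_col]
        simp only [stepCoeff, hc]
        exact ⟨by simpa using j₁, fun y hy => by simp [j₂ _ hy]⟩
      rw [stepVec_of_ne _ _ h1 h2]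
      exact ih' x

/-! ### Changing the reading order -/

theorem stepVec_comm (s : Fin n → Fin n → ℝ) {b c : Box I} (hr : b.1.1 ≠ c.1.1)
    (hc : b.1.2 ≠ c.1.2) :
    stepVec D p q (stepVec D p q s b) c = stepVec D p q (stepVec D p q s c) b := by
  have h1 := b.row_ne_col c
  have h2 := c.row_ne_col b
  have h3 := b.row_ne_col b
  have h4 := c.row_ne_col c
  funext x
  by_cases e1 : x = b.1.1
  · subst e1
    simp [stepVec, hr, hc, h1, h2.symm]
  by_cases e2 : x = b.1.2
  · subst e2
    simp [stepVec, hr, hc, h1, h3.symm, h2.symm]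
  by_cases e3 : x = c.1.1
  · subst e3
    simp [stepVec, h2, hr.symm, hc.symm, h1.symm]
  by_cases e4 : x = c.1.2
  · subst e4
    simp [stepVec, h2, h4.symm, hr.symm, hc.symm, h1.symm]
  simp [stepVec, e1, e2, e3, e4]

theorem stepVec_foldl_comm (l : List (Box I)) (c : Box I) (s : Fin n → Fin n → ℝ)
    (h : ∀ b ∈ l, b.1.1 ≠ c.1.1 ∧ b.1.2 ≠ c.1.2) :
    stepVec D p q (l.foldl (stepVec D p q) s) c = l.foldl (stepVec D p q) (stepVec D p q s c) := by
  induction l generalizing s with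
  | nil => rfl
  | cons b l ih =>
    rw [List.foldl_cons, List.foldl_cons, ih _ fun b' hb' => h b' (by simp [hb']),
      stepVec_comm _ (h b (by simp)).1 (h b (by simp)).2]

/-- The boxes of a south-east closed set may be read first. -/
theorem lineVec_eq_foldl_filter (l : List (Box I)) (hl : IsClosedOrder l) (P : Box I → Bool)
    (hP : ∀ b b' : Box I, b.1.1 ≤ b'.1.1 → b'.1.2 ≤ b.1.2 → P b = true → P b' = true) :
    lineVec D p q l =
      (l.filter fun b => !P b).foldl (stepVec D p q) (lineVec D p q (l.filter P)) := by
  induction l using List.reverseRecOn with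
  | nil => rfl
  | append_singleton l c ih =>
    rw [lineVec_concat, ih hl.of_append, List.filter_append, List.filter_append]
    by_cases hc : P c = true
    · rw [stepVec_foldl_comm]
      · simp [hc, lineVec_concat]
      -- Neither of b and c is south-east of the other: one way by the reading order, the other
      -- because `P` is closed. Hence they share no line and commute.
      · intro b hb
        rw [List.mem_filter] at hb
        have hbc := hl.not_southEast hb.1
        have hcb : ¬ (c.1.1 ≤ b.1.1 ∧ b.1.2 ≤ c.1.2) := fun h => by
          have := hP c b h.1 h.2 hc
          simp [this] at hb
        constructor
        · intro h
          rcases le_total b.1.2 c.1.2 with h' | h'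
          · exact hcb ⟨h.ge, h'⟩
          · exact hbc ⟨h.le, h'⟩
        · intro h
          rcases le_total b.1.1 c.1.1 with h' | h'
          · exact hbc ⟨h', h.ge⟩
          · exact hcb ⟨h', h.le⟩
    · simp [hc]

end Vectors


/-! ### The ranks of unions of two intervals -/

/-- Evaluate a vanishing combination at the pivot of x: every other term is zero there or has
smaller height, hence a coefficient already known to vanish. -/
theorem linearIndepOn_of_triangular {ι σ : Type*} (v : ι → σ → ℝ) (K : Set ι) (piv : ι → σ)
    (h : ι → ℕ) (hpiv : ∀ x ∈ K, v x (piv x) ≠ 0)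
    (htri : ∀ x ∈ K, ∀ x' ∈ K, v x (piv x') ≠ 0 → x = x' ∨ h x < h x') :
    LinearIndepOn ℝ v K := by
  rw [linearIndepOn_iff']
  intro t c ht hsum
  have key : ∀ N : ℕ, ∀ x ∈ t, h x < N → c x = 0 := by
    intro N
    induction N with
    | zero => simp
    | succ N ih =>
      intro x hx hN
      have h0 := congrFun hsum (piv x)
      rw [Finset.sum_apply, Finset.sum_eq_single x] at h0
      · simpa [hpiv x (ht hx)] using h0
      · intro y hy hyx
        by_cases hv : v y (piv x) = 0
        · simp [hv]
        · rcases htri y (ht hy) x (ht hx) hv with rfl | hlt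
          · exact absurd rfl hyx
          · simp [ih y hy (by omega)]
      · exact fun h => absurd hx h
  exact fun x hx => key _ x hx (Nat.lt_succ_self _)

/-- The linear map that forgets the coordinates outside `S`. -/
noncomputable def coordProj {n : ℕ} (S : Set (Fin n)) : (Fin n → ℝ) →ₗ[ℝ] Fin n → ℝ :=
  open Classical in
  { toFun := fun v x => if x ∈ S then v x else 0
    map_add' := fun v w => by ext x; by_cases h : x ∈ S <;> simp [h]
    map_smul' := fun r v => by ext x; by_cases h : x ∈ S <;> simp [h] }

theorem coordProj_apply_mem {n : ℕ} {S : Set (Fin n)} {x : Fin n} (h : x ∈ S) (v : Fin n → ℝ) :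
    coordProj S v x = v x := by simp [coordProj, h]

theorem coordProj_apply_notMem {n : ℕ} {S : Set (Fin n)} {x : Fin n} (h : x ∉ S) (v : Fin n → ℝ) :
    coordProj S v x = 0 := by simp [coordProj, h]

section Rank

variable {n : ℕ} {I : Finset (Fin n)} {D : Box I → Stone} {p q : Box I → ℝ}

/-- The listed boxes in rows with labels at least `a` and columns with labels less than `t`. -/
def window (e : List (Box I)) (a t : ℕ) : List (Box I) :=
  e.filter fun b => decide (a ≤ (b.1.1 : ℕ) ∧ (b.1.2 : ℕ) < t)

theorem window_closed {e : List (Box I)} (he : IsClosedOrder e) (a t : ℕ) :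
    IsClosedOrder (window e a t) :=
  he.filter _ fun b b' h h' hb => by
    simp only [decide_eq_true_eq] at hb ⊢
    have h1 : (b.1.1 : ℕ) ≤ b'.1.1 := h
    have h2 : (b'.1.2 : ℕ) ≤ b.1.2 := h'
    omega

theorem mem_window {e : List (Box I)} {a t : ℕ} {b : Box I} :
    b ∈ window e a t ↔ b ∈ e ∧ a ≤ (b.1.1 : ℕ) ∧ (b.1.2 : ℕ) < t := by
  simp [window]

theorem foldl_stepVec_of_forall (l : List (Box I)) (s : Fin n → Fin n → ℝ) (x : Fin n)
    (h : ∀ b ∈ l, b.1.1 ≠ x ∧ b.1.2 ≠ x) : l.foldl (stepVec D p q) s x = s x := by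
  induction l using List.reverseRecOn with
  | nil => rfl
  | append_singleton l c ih =>
    have := h c (by simp)
    rw [List.foldl_append, List.foldl_cons, List.foldl_nil,
      stepVec_of_ne _ _ this.1.symm this.2.symm, ih fun b hb => h b (by simp [hb])]

theorem lineVec_of_forall (l : List (Box I)) (x : Fin n)
    (h : ∀ b ∈ l, b.1.1 ≠ x ∧ b.1.2 ≠ x) : lineVec D p q l x = Pi.single x 1 :=
  foldl_stepVec_of_forall l _ x h

/-- If f kills the column vectors at the outset, then after f a column only contains rows already
read in it, all strictly south of the next box. Each step thus multiplies a row by a nonzero scalar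
and adds rows further south, which is a triangular change of generators. -/
theorem span_rows_foldl (hp : ∀ b, p b ≠ 0) (f : (Fin n → ℝ) →ₗ[ℝ] Fin n → ℝ)
    (s : Fin n → Fin n → ℝ) (l : List (Box I))
    (hl : l.Pairwise fun b b' => ¬ (b.1.1 ≤ b'.1.1 ∧ b'.1.2 ≤ b.1.2))
    (hs : ∀ b ∈ l, f (s b.1.2) = 0) :
    (∀ a : ℕ, Submodule.span ℝ ((fun x => f (l.foldl (stepVec D p q) s x)) ''
        {x | x ∈ I ∧ a ≤ (x : ℕ)}) =
      Submodule.span ℝ ((fun x => f (s x)) '' {x | x ∈ I ∧ a ≤ (x : ℕ)})) ∧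
    (∀ j ∉ I, f (s j) = 0 → ∀ a : ℕ, (∀ b ∈ l, b.1.2 = j → a ≤ (b.1.1 : ℕ)) →
      f (l.foldl (stepVec D p q) s j) ∈
        Submodule.span ℝ ((fun x => f (s x)) '' {x | x ∈ I ∧ a ≤ (x : ℕ)})) := by
  induction l using List.reverseRecOn with
  | nil => exact ⟨fun a => rfl, fun j _ hj a _ => by simp [hj]⟩
  | append_singleton l c ih =>
    have hpw := List.pairwise_append.1 hl
    obtain ⟨ih₁, ih₂⟩ := ih hpw.1 fun b hb => hs b (by simp [hb])
    set C := l.foldl (stepVec D p q) s with hC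
    have hC' : (l ++ [c]).foldl (stepVec D p q) s = stepVec D p q C c := by simp [hC]
    rw [hC']
    set C' := stepVec D p q C c with hC'
    have hα := stepCoeff_zero_ne (D := D) (q := q) hp c
    have hcol : f (C c.1.2) ∈ Submodule.span ℝ ((fun x => f (s x)) ''
        {x | x ∈ I ∧ (c.1.1 : ℕ) + 1 ≤ (x : ℕ)}) :=
      ih₂ _ c.2.2.1 (hs c (by simp)) _ fun b hb hbc => lt_of_not_ge fun h =>
        hpw.2.2 b hb c (by simp) ⟨h, hbc.ge⟩
    have hmono : ∀ {a a' : ℕ}, a ≤ a' → Submodule.span ℝ ((fun x => f (s x)) ''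
        {x | x ∈ I ∧ a' ≤ (x : ℕ)}) ≤ Submodule.span ℝ ((fun x => f (s x)) ''
        {x | x ∈ I ∧ a ≤ (x : ℕ)}) := fun h =>
      Submodule.span_mono (Set.image_mono fun x hx => ⟨hx.1, h.trans hx.2⟩)
    have hrow : ∀ {a : ℕ} {x : Fin n}, x ∈ I → a ≤ (x : ℕ) → f (C x) ∈
        Submodule.span ℝ ((fun x => f (s x)) '' {x | x ∈ I ∧ a ≤ (x : ℕ)}) := by
      intro a x hx hax
      rw [← ih₁]
      exact Submodule.subset_span ⟨x, ⟨hx, hax⟩, rfl⟩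
    have hother : ∀ x ∈ I, x ≠ c.1.1 → C' x = C x := fun x hx hne =>
      stepVec_of_ne _ _ hne fun h => c.2.2.1 (h ▸ hx)
    have hC'row : C' c.1.1 = _ := stepVec_row C c
    have hC'col : C' c.1.2 = _ := stepVec_col C c
    have hbelow : Submodule.span ℝ ((fun x => f (C' x)) ''
        {x | x ∈ I ∧ (c.1.1 : ℕ) + 1 ≤ (x : ℕ)}) = Submodule.span ℝ ((fun x => f (s x)) ''
        {x | x ∈ I ∧ (c.1.1 : ℕ) + 1 ≤ (x : ℕ)}) := by
      rw [← ih₁]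
      congr 1
      refine Set.image_congr fun x hx => ?_
      rw [hother x hx.1 fun h => by have := hx.2; rw [h] at this; omega]
    have hspan : ∀ a : ℕ, Submodule.span ℝ ((fun x => f (C' x)) '' {x | x ∈ I ∧ a ≤ (x : ℕ)}) =
      Submodule.span ℝ ((fun x => f (s x)) '' {x | x ∈ I ∧ a ≤ (x : ℕ)}) := by
      intro a
      refine le_antisymm (Submodule.span_le.2 ?_) ?_
      · rintro _ ⟨x, ⟨hx, hax⟩, rfl⟩
        change f (C' x) ∈ Submodule.span _ _
        by_cases h : x = c.1.1
        · rw [h, hC'row, map_add, map_smul, map_smul]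
          exact add_mem (Submodule.smul_mem _ _ (hrow c.2.1 (h ▸ hax)))
            (Submodule.smul_mem _ _ (hmono (by rw [← h]; omega) hcol))
        · rw [hother x hx h]; exact hrow hx hax
      · rw [← ih₁, Submodule.span_le]
        rintro _ ⟨x, ⟨hx, hax⟩, rfl⟩
        change f (C x) ∈ Submodule.span _ _
        by_cases h : x = c.1.1
        · have h1 : f (C x) = (stepCoeff D p q c 0)⁻¹ •
              (f (C' x) - stepCoeff D p q c 1 • f (C c.1.2)) := by
            rw [h, hC'row, map_add, map_smul, map_smul, add_sub_cancel_right, smul_smul,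
              inv_mul_cancel₀ hα, one_smul]
          rw [h1]
          refine Submodule.smul_mem _ _ (sub_mem (Submodule.subset_span ⟨x, ⟨hx, hax⟩, rfl⟩)
            (Submodule.smul_mem _ _ ?_))
          rw [← hbelow] at hcol
          have hsub : {x : Fin n | x ∈ I ∧ (c.1.1 : ℕ) + 1 ≤ (x : ℕ)} ⊆
              {x : Fin n | x ∈ I ∧ a ≤ (x : ℕ)} := fun y hy =>
            ⟨hy.1, by have := hy.2; rw [← h] at this; omega⟩
          exact Submodule.span_mono (Set.image_mono hsub) hcol
        · rw [← hother x hx h]; exact Submodule.subset_span ⟨x, ⟨hx, hax⟩, rfl⟩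
    refine ⟨hspan, fun j hj hsj a ha => ?_⟩
    have ha' : ∀ b ∈ l, b.1.2 = j → a ≤ (b.1.1 : ℕ) := fun b hb => ha b (by simp [hb])
    by_cases h : j = c.1.2
    · have hca := ha c (by simp) h.symm
      rw [h, hC'col, map_add, map_smul, map_smul]
      exact add_mem (Submodule.smul_mem _ _ (hrow c.2.1 hca))
        (Submodule.smul_mem _ _ (h ▸ ih₂ j hj hsj a ha'))
    · rw [hC', stepVec_of_ne C c (fun h' : j = c.1.1 => hj (h' ▸ c.2.1)) h]
      exact ih₂ j hj hsj a ha'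

theorem blankPerm_lt_iff (l : List (Box I)) {t : ℕ}
    (h : ∀ b ∈ l, (b.1.2 : ℕ) < t) (x : Fin n) :
    (blankPerm D l x : ℕ) < t ↔ (x : ℕ) < t := by
  induction l using List.reverseRecOn generalizing x with
  | nil => simp [blankPerm]
  | append_singleton l c ih =>
    have ih' := ih fun b hb => h b (by simp [hb])
    by_cases hc : D c = Stone.blank
    · have h2 := h c (by simp)
      have h1 : (c.1.1 : ℕ) < t := lt_trans c.2.2.2 h2
      rw [blankPerm_concat_blank l hc, Equiv.Perm.mul_apply, ih', Equiv.swap_apply_def]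
      split_ifs with e1 e2
      · rw [e1]; exact iff_of_true h2 h1
      · rw [e2]; exact iff_of_true h1 h2
      · rfl
    · rw [blankPerm_concat_stone l hc, ih']

theorem le_blankPerm_iff (l : List (Box I)) {a : ℕ}
    (h : ∀ b ∈ l, a ≤ (b.1.1 : ℕ)) (x : Fin n) :
    a ≤ (blankPerm D l x : ℕ) ↔ a ≤ (x : ℕ) := by
  induction l using List.reverseRecOn generalizing x with
  | nil => simp [blankPerm]
  | append_singleton l c ih =>
    have ih' := ih fun b hb => h b (by simp [hb])
    by_cases hc : D c = Stone.blank
    · have h1 := h c (by simp)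
      have h2 : a ≤ (c.1.2 : ℕ) := h1.trans (le_of_lt c.2.2.2)
      rw [blankPerm_concat_blank l hc, Equiv.Perm.mul_apply, ih', Equiv.swap_apply_def]
      split_ifs with e1 e2
      · rw [e1]; exact iff_of_true h2 h1
      · rw [e2]; exact iff_of_true h1 h2
      · rfl
    · rw [blankPerm_concat_stone l hc, ih']

/-- The number of rows with labels in `[a, t)` on which a pipe with label at least `s` leaves the
boxes in rows with labels at least `a` and columns with labels less than `t`. -/
noncomputable def pipeCount (D : Box I → Stone) (e : List (Box I)) (a s t : ℕ) : ℕ :=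
  (I.filter fun x : Fin n => a ≤ (x : ℕ) ∧ (x : ℕ) < t ∧ s ≤ (blankPerm D (window e a t) x : ℕ)).card

/-- The rank of the coordinates with indices in `[0, a) ∪ [s, t)` on the span of the rows. -/
theorem finrank_map_coordProj (hp : ∀ b, p b ≠ 0) {e : List (Box I)} (he : IsReadingOrder e)
    (hD : IsGoDiagram e D) {a s t : ℕ} (hst : a ≤ s) {S : Set (Fin n)}
    (hS : ∀ y, y ∈ S ↔ (y : ℕ) < a ∨ s ≤ (y : ℕ) ∧ (y : ℕ) < t) :
    Module.finrank ℝ (Submodule.map (coordProj S)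
        (Submodule.span ℝ (lineVec D p q e '' (I : Set (Fin n))))) =
      (I.filter fun x : Fin n => (x : ℕ) < a).card + pipeCount D e a s t := by
  classical
  have hec := he.isClosedOrder
  set L := blankPerm D (window e a t) with hL
  have hwc := window_closed hec a t
  have hlow := lineVec_lower (D := D) (q := q) hp e hec
  have hlow' := lineVec_lower (D := D) (q := q) hp _ hwc
  have hup := lineVec_upper (p := p) (q := q) he hD _ hwc
  have hLt : ∀ x, (L x : ℕ) < t ↔ (x : ℕ) < t := blankPerm_lt_iff _ fun b hb => (mem_window.1 hb).2.2
  have hLa : ∀ x, a ≤ (L x : ℕ) ↔ a ≤ (x : ℕ) := le_blankPerm_iff _ fun b hb => (mem_window.1 hb).2.1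
  set K₁ := I.filter fun x : Fin n => (x : ℕ) < a with hK₁
  set K₂ := I.filter fun x : Fin n => a ≤ (x : ℕ) ∧ (x : ℕ) < t ∧ s ≤ (L x : ℕ) with hK₂
  -- the rows with labels at least `a`
  have hrows : Submodule.span ℝ ((fun x => coordProj S (lineVec D p q e x)) ''
      {x | x ∈ I ∧ a ≤ (x : ℕ)}) =
      Submodule.span ℝ ((fun x => coordProj S (lineVec D p q (window e a t) x)) '' K₂) := by
    -- Boxes in rows with labels below `a` do not meet the rows considered, so the others are read
    -- first, and among them the window. The boxes left over lie in columns with labels at least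
    -- `t`, whose vectors are still unit vectors outside `S`.
    set P : Box I → Bool := fun b => decide (a ≤ (b.1.1 : ℕ)) with hP
    set Q : Box I → Bool := fun b => decide ((b.1.2 : ℕ) < t) with hQ
    have hPc : ∀ b b' : Box I, b.1.1 ≤ b'.1.1 → b'.1.2 ≤ b.1.2 → P b = true → P b' = true :=
      fun b b' h _ hb => decide_eq_true ((of_decide_eq_true hb).trans h)
    have hQc : ∀ b b' : Box I, b.1.1 ≤ b'.1.1 → b'.1.2 ≤ b.1.2 → Q b = true → Q b' = true :=
      fun b b' _ h hb => decide_eq_true (lt_of_le_of_lt h (of_decide_eq_true hb))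
    have hw : (e.filter P).filter Q = window e a t := by
      rw [List.filter_filter, window]
      congr 1
      funext b
      simp [hP, hQ, Bool.and_comm]
    have h1 : ∀ x ∈ I, a ≤ (x : ℕ) → lineVec D p q e x = lineVec D p q (e.filter P) x := by
      intro x hx hax
      rw [lineVec_eq_foldl_filter e hec P hPc]
      refine foldl_stepVec_of_forall _ _ x fun b hb => ⟨?_, fun h => b.2.2.1 (h ▸ hx)⟩
      rintro rfl
      simp [hP, hax] at hb
    have h2 := lineVec_eq_foldl_filter (D := D) (p := p) (q := q) (e.filter P) (hec.filter P hPc) Q hQc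
    rw [hw] at h2
    have h3 := (span_rows_foldl hp (coordProj S) (lineVec D p q (window e a t))
      ((e.filter P).filter fun b => !Q b) ((he.2.filter _).filter _) (D := D) (q := q) ?_).1 a
    · rw [← h2] at h3
      rw [show (fun x => coordProj S (lineVec D p q e x)) '' {x | x ∈ I ∧ a ≤ (x : ℕ)} =
        (fun x => coordProj S (lineVec D p q (e.filter P) x)) '' {x | x ∈ I ∧ a ≤ (x : ℕ)} from
        Set.image_congr fun x hx => by rw [h1 x hx.1 hx.2], h3]
      refine le_antisymm (Submodule.span_le.2 ?_) (Submodule.span_mono (Set.image_mono ?_))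
      · rintro _ ⟨x, ⟨hx, hax⟩, rfl⟩
        by_cases hxK : x ∈ K₂
        · exact Submodule.subset_span ⟨x, hxK, rfl⟩
        -- The vector is supported between x and `L x`. If x is at least `t`, or `L x` is less than
        -- `s`, this range misses `S`.
        · have : coordProj S (lineVec D p q (window e a t) x) = 0 := by
            ext y
            by_cases hy : y ∈ S
            · rw [coordProj_apply_mem hy, Pi.zero_apply]
              by_cases hyx : y < x
              · exact (hlow'.1 x hx).2 y hyx
              · have hxy : (x : ℕ) ≤ y := le_of_not_gt hyx
                rcases (hS y).1 hy with h | ⟨h, h'⟩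
                · omega
                · refine (hup x).2 y ?_
                  have : ¬ s ≤ (L x : ℕ) := fun h'' => hxK (by
                    rw [hK₂, Finset.mem_filter]; exact ⟨hx, hax, by omega, h''⟩)
                  change (L x : ℕ) < y
                  omega
            · rw [coordProj_apply_notMem hy, Pi.zero_apply]
          simp [this]
      · intro x hx
        have := Finset.mem_filter.1 hx
        exact ⟨this.1, this.2.1⟩
    · intro b hb
      simp only [List.mem_filter, hQ, Bool.not_eq_true', decide_eq_false_iff_not] at hb
      rw [lineVec_of_forall]
      · ext y
        by_cases hy : y ∈ S
        · rw [coordProj_apply_mem hy, Pi.zero_apply, Pi.single_apply, if_neg]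
          rintro rfl
          have h5 := of_decide_eq_true hb.1.2
          have h6 : (b.1.1 : ℕ) < b.1.2 := b.2.2.2
          rcases (hS _).1 hy with h | h <;> omega
        · rw [coordProj_apply_notMem hy, Pi.zero_apply]
      · intro b' hb'
        refine ⟨b'.row_ne_col b, fun h => ?_⟩
        have := (mem_window.1 hb').2.2
        rw [h] at this
        exact hb.2 this
  -- a triangular basis
  let v : Fin n → Fin n → ℝ := fun x =>
    if (x : ℕ) < a then coordProj S (lineVec D p q e x)
    else coordProj S (lineVec D p q (window e a t) x)
  have hv₁ : ∀ x : Fin n, (x : ℕ) < a → v x = coordProj S (lineVec D p q e x) :=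
    fun x hx => if_pos hx
  have hv₂ : ∀ x : Fin n, a ≤ (x : ℕ) → v x = coordProj S (lineVec D p q (window e a t) x) :=
    fun x hx => if_neg (not_lt.2 hx)
  have hdisj : Disjoint K₁ K₂ := by
    rw [Finset.disjoint_left]
    intro x h h'
    have h1 := (Finset.mem_filter.1 h).2
    have h2 := (Finset.mem_filter.1 h').2.1
    omega
  have hspan : Submodule.map (coordProj S) (Submodule.span ℝ (lineVec D p q e '' (I : Set (Fin n)))) =
      Submodule.span ℝ (v '' ((K₁ ∪ K₂ : Finset (Fin n)) : Set (Fin n))) := by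
    have hI : (I : Set (Fin n)) = {x | x ∈ K₁} ∪ {x | x ∈ I ∧ a ≤ (x : ℕ)} := by
      ext x
      simp only [hK₁, Finset.mem_coe, Finset.mem_filter, Set.mem_union, Set.mem_ofPred_eq,
        ← and_or_left]
      exact (and_iff_left (lt_or_ge _ _)).symm
    rw [Submodule.map_span, Set.image_image, hI, Set.image_union, Submodule.span_union, hrows,
      Finset.coe_union, Set.image_union, Submodule.span_union]
    congr 2
    · exact Set.image_congr fun x hx => (hv₁ x (Finset.mem_filter.1 hx).2).symm
    · exact Set.image_congr fun x hx => (hv₂ x (Finset.mem_filter.1 hx).2.1).symm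
  have hind : LinearIndepOn ℝ v ((K₁ ∪ K₂ : Finset (Fin n)) : Set (Fin n)) := by
    have hcases : ∀ x ∈ ((K₁ ∪ K₂ : Finset (Fin n)) : Set (Fin n)), (x ∈ I ∧ (x : ℕ) < a) ∨
        (x ∈ I ∧ a ≤ (x : ℕ) ∧ (x : ℕ) < t ∧ s ≤ (L x : ℕ)) := by
      intro x hx
      simpa only [hK₁, hK₂, Finset.coe_union, Set.mem_union, Finset.mem_coe, Finset.mem_filter]
        using hx
    -- Rows below `a` have their first coordinate as pivot, rows of the window their last one, the
    -- pipe label. The height puts the former first, by increasing label, and then the latter by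
    -- decreasing pipe label; the summand `n` separates the two groups.
    refine linearIndepOn_of_triangular v _ (fun x => if (x : ℕ) < a then x else L x)
      (fun x => if (x : ℕ) < a then (x : ℕ) else n + (n - L x)) ?_ ?_
    · intro x hx
      rcases hcases x hx with ⟨hxI, h⟩ | ⟨hxI, h, ht, hs⟩
      · simp only [h, if_true, hv₁ x h]
        rw [coordProj_apply_mem ((hS x).2 (Or.inl h))]
        exact (hlow.1 x hxI).1
      · simp only [not_lt.2 h, if_false, hv₂ x h]
        rw [coordProj_apply_mem ((hS _).2 (Or.inr ⟨hs, (hLt x).2 ht⟩))]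
        exact (hup x).1
    · intro x hx x' hx' hne
      rcases hcases x hx with ⟨hxI, h⟩ | ⟨hxI, h, ht, hs⟩ <;>
        rcases hcases x' hx' with ⟨hxI', h'⟩ | ⟨hxI', h', ht', hs'⟩
      · simp only [h, h', if_true, hv₁ x h] at hne ⊢
        rw [coordProj_apply_mem ((hS x').2 (Or.inl h'))] at hne
        have : ¬ x' < x := fun hlt => hne ((hlow.1 x hxI).2 x' hlt)
        rcases lt_or_eq_of_le (not_lt.1 this) with h5 | h5
        · exact Or.inr h5
        · exact Or.inl h5
      · simp only [h, not_lt.2 h', if_true, if_false]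
        have := x.isLt
        right; omega
      · simp only [h', not_lt.2 h, if_true, if_false, hv₂ x h] at hne ⊢
        rw [coordProj_apply_mem ((hS x').2 (Or.inl h'))] at hne
        exact absurd ((hlow'.1 x hxI).2 x' (Fin.lt_def.2 (by omega))) hne
      · simp only [not_lt.2 h, not_lt.2 h', if_false, hv₂ x h] at hne ⊢
        rw [coordProj_apply_mem ((hS _).2 (Or.inr ⟨hs', (hLt x').2 ht'⟩))] at hne
        have h5 : ¬ L x < L x' := fun hlt => hne ((hup x).2 _ hlt)
        rcases lt_or_eq_of_le (not_lt.1 h5) with h6 | h6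
        · have h7 : (L x' : ℕ) < L x := h6
          have := (L x).isLt
          right; omega
        · exact Or.inl (L.injective h6).symm
  rw [hspan, Set.image_eq_range]
  have := finrank_span_eq_card (R := ℝ) hind
  rw [pipeCount, ← hL, ← Finset.card_union_of_disjoint hdisj]
  simpa using this

end Rank


/-! ### Counting pipes -/

section Counting

variable {n : ℕ} {I : Finset (Fin n)} {D : Box I → Stone} {e : List (Box I)}

theorem blankPerm_window_row (he : IsReadingOrder e) {a a' t t' : ℕ} {x : Fin n} (hx : x ∈ I)
    (h : a ≤ (x : ℕ)) (h' : a' ≤ (x : ℕ))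
    (ht : ∀ j ∉ I, x < j → ((j : ℕ) < t ↔ (j : ℕ) < t')) :
    blankPerm D (window e a t) x = blankPerm D (window e a' t') x := by
  refine blankPerm_congr_row (window_closed he.isClosedOrder a t)
    (window_closed he.isClosedOrder a' t') hx fun b hb => ?_
  rw [mem_window, mem_window, hb, ht b.1.2 b.2.2.1 (hb ▸ b.2.2.2)]
  simp [h, h']

theorem blankPerm_window_col (he : IsReadingOrder e) {a a' t t' : ℕ} {x : Fin n} (hx : x ∉ I)
    (h : (x : ℕ) < t) (h' : (x : ℕ) < t')
    (ha : ∀ i ∈ I, i < x → (a ≤ (i : ℕ) ↔ a' ≤ (i : ℕ))) :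
    blankPerm D (window e a t) x = blankPerm D (window e a' t') x := by
  refine blankPerm_congr_col (window_closed he.isClosedOrder a t)
    (window_closed he.isClosedOrder a' t') hx fun b hb => ?_
  rw [mem_window, mem_window, hb, ha b.1.1 b.2.1 (hb ▸ b.2.2.2)]
  simp [h, h']

theorem card_filter_lt_succ (I : Finset (Fin n)) (i : Fin n) :
    (I.filter fun x : Fin n => (x : ℕ) < (i : ℕ) + 1).card =
      (I.filter fun x : Fin n => (x : ℕ) < (i : ℕ)).card + if i ∈ I then 1 else 0 := by
  split_ifs with h
  · rw [← Finset.card_insert_of_notMem (a := i) (by simp)]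
    congr 1
    ext x
    simp only [Finset.mem_filter, Finset.mem_insert, Fin.ext_iff]
    constructor
    · rintro ⟨h1, h2⟩
      rcases Nat.lt_or_ge x i with h3 | h3
      · exact Or.inr ⟨h1, h3⟩
      · exact Or.inl (by omega)
    · rintro (h1 | ⟨h1, h2⟩)
      · exact ⟨by rwa [Fin.ext h1], by omega⟩
      · exact ⟨h1, by omega⟩
  · congr 1
    ext x
    simp only [Finset.mem_filter]
    refine and_congr_right fun hx => ⟨fun h1 => ?_, fun h1 => by omega⟩
    have : (x : ℕ) ≠ i := fun h2 => h (Fin.ext h2 ▸ hx)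
    omega

/-- The pipe on a row does not depend on the rows further north, so enlarging the window by the row
i only adds the contribution of that row. -/
theorem pipeCount_row (he : IsReadingOrder e) {i : Fin n} (hi : i ∈ I) {s t : ℕ}
    (ht : (i : ℕ) < t) :
    pipeCount D e i s t = pipeCount D e (i + 1) s t +
      if s ≤ (blankPerm D (window e i t) i : ℕ) then 1 else 0 := by
  have key : ∀ x ∈ I, (i : ℕ) + 1 ≤ (x : ℕ) →
      blankPerm D (window e i t) x = blankPerm D (window e (i + 1) t) x := fun x hx h =>
    blankPerm_window_row he hx (by omega) h fun _ _ _ => Iff.rfl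
  rw [pipeCount, pipeCount]
  split_ifs with h
  · rw [← Finset.card_insert_of_notMem (a := i) (by simp)]
    congr 1
    ext x
    simp only [Finset.mem_filter, Finset.mem_insert]
    constructor
    · rintro ⟨h1, h2, h3, h4⟩
      by_cases hx : x = i
      · exact Or.inl hx
      · have : (x : ℕ) ≠ i := fun h => hx (Fin.ext h)
        exact Or.inr ⟨h1, by omega, h3, by rwa [← key x h1 (by omega)]⟩
    · rintro (rfl | ⟨h1, h2, h3, h4⟩)
      · exact ⟨hi, le_rfl, ht, h⟩
      · exact ⟨h1, by omega, h3, by rwa [key x h1 h2]⟩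
  · congr 1
    ext x
    simp only [Finset.mem_filter]
    constructor
    · rintro ⟨h1, h2, h3, h4⟩
      have : (x : ℕ) ≠ i := fun h' => h (Fin.ext h' ▸ h4)
      exact ⟨h1, by omega, h3, by rwa [← key x h1 (by omega)]⟩
    · rintro ⟨h1, h2, h3, h4⟩
      exact ⟨h1, by omega, h3, by rwa [key x h1 h2]⟩

theorem pipeCount_of_notMem (he : IsReadingOrder e) {i : Fin n} (hi : i ∉ I) {s t : ℕ} :
    pipeCount D e i s t = pipeCount D e (i + 1) s t := by
  rw [pipeCount, pipeCount]
  congr 1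
  ext x
  simp only [Finset.mem_filter]
  refine and_congr_right fun hx => ?_
  have hne : (x : ℕ) ≠ i := fun h' => hi (Fin.ext h' ▸ hx)
  by_cases h : (i : ℕ) + 1 ≤ (x : ℕ)
  · rw [blankPerm_window_row he hx (by omega : (i : ℕ) ≤ x) h fun _ _ _ => Iff.rfl]
    simp [h, (by omega : (i : ℕ) ≤ x)]
  · exact iff_of_false (fun h' => by omega) fun h' => h h'.1

/-- The new row j has no box in the window and carries its own label, which is at least s; no column
is added, so the other rows are unaffected. -/
theorem pipeCount_of_mem (he : IsReadingOrder e) {j : Fin n} (hj : j ∈ I) {a s : ℕ}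
    (ha : a ≤ (j : ℕ)) (hs : s ≤ (j : ℕ)) :
    pipeCount D e a s (j + 1) = pipeCount D e a s j + 1 := by
  have key : ∀ x ∈ I, a ≤ (x : ℕ) →
      blankPerm D (window e a (j + 1)) x = blankPerm D (window e a j) x := fun x hx h =>
    blankPerm_window_row he hx h h fun y hy _ => by
      have : (y : ℕ) ≠ j := fun h' => hy (Fin.ext h' ▸ hj)
      omega
  have hfix : blankPerm D (window e a (j + 1)) j = j := by
    refine blankPerm_of_forall_row _ hj fun b hb hbj => ?_
    have h1 := (mem_window.1 hb).2.2
    have h2 : (b.1.1 : ℕ) < b.1.2 := b.row_lt_col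
    change (b.1.2 : ℕ) < _ at h1
    rw [hbj] at h2
    omega
  rw [pipeCount, pipeCount, ← Finset.card_insert_of_notMem (a := j) (by simp)]
  congr 1
  ext x
  simp only [Finset.mem_filter, Finset.mem_insert]
  constructor
  · rintro ⟨h1, h2, h3, h4⟩
    by_cases hx : x = j
    · exact Or.inl hx
    · have : (x : ℕ) ≠ j := fun h => hx (Fin.ext h)
      exact Or.inr ⟨h1, h2, by omega, by rwa [← key x h1 h2]⟩
  · rintro (rfl | ⟨h1, h2, h3, h4⟩)
    · exact ⟨hj, ha, by omega, by rwa [hfix]⟩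
    · exact ⟨h1, h2, by omega, by rwa [key x h1 h2]⟩

/-- The pipes that leave the boxes of a window on rows are those that do not leave on columns. -/
theorem pipeCount_add_card {a s t : ℕ} (has : a ≤ s) (htn : t ≤ n) :
    pipeCount D e a s t + (Iᶜ.filter fun x : Fin n =>
      (x : ℕ) < t ∧ s ≤ (blankPerm D (window e a t) x : ℕ)).card = t - s := by
  have hLt : ∀ x, (blankPerm D (window e a t) x : ℕ) < t ↔ (x : ℕ) < t :=
    blankPerm_lt_iff _ fun b hb => (mem_window.1 hb).2.2
  have hLa : ∀ x, a ≤ (blankPerm D (window e a t) x : ℕ) ↔ a ≤ (x : ℕ) :=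
    le_blankPerm_iff _ fun b hb => (mem_window.1 hb).2.1
  have h1 : (I.filter fun x : Fin n => a ≤ (x : ℕ) ∧ (x : ℕ) < t ∧
      s ≤ (blankPerm D (window e a t) x : ℕ)) = I.filter fun x : Fin n => (x : ℕ) < t ∧
      s ≤ (blankPerm D (window e a t) x : ℕ) := by
    refine Finset.filter_congr fun x _ => ⟨fun h => h.2, fun h => ⟨?_, h⟩⟩
    exact (hLa x).1 (has.trans h.2)
  rw [pipeCount, h1, ← Finset.card_union_of_disjoint
    (Finset.disjoint_filter_filter disjoint_compl_right), ← Finset.filter_union,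
    Finset.union_compl, ← Finset.card_map (blankPerm D (window e a t)).toEmbedding]
  have h2 : (Finset.univ.filter fun x : Fin n => (x : ℕ) < t ∧
      s ≤ (blankPerm D (window e a t) x : ℕ)).map (blankPerm D (window e a t)).toEmbedding =
      Finset.univ.filter fun y : Fin n => s ≤ (y : ℕ) ∧ (y : ℕ) < t := by
    ext y
    simp only [Finset.mem_map, Finset.mem_filter, Finset.mem_univ, true_and]
    constructor
    · rintro ⟨x, ⟨h3, h4⟩, rfl⟩
      exact ⟨h4, (hLt x).2 h3⟩
    · rintro ⟨h3, h4⟩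
      obtain ⟨x, rfl⟩ := (blankPerm D (window e a t)).surjective y
      exact ⟨x, ⟨(hLt x).1 h4, h3⟩, rfl⟩
  rw [h2, ← Nat.card_Ico, ← Finset.card_map Fin.valEmbedding]
  congr 1
  ext y
  simp only [Finset.mem_map, Finset.mem_filter, Finset.mem_univ, true_and, Finset.mem_Ico]
  constructor
  · rintro ⟨x, h, rfl⟩; exact h
  · intro h; exact ⟨⟨y, by omega⟩, h, rfl⟩

/-- A new column can change the pipes on many rows, but not those on the earlier columns. So the
count is made on the columns, using that rows and columns together carry all labels in [s, t). -/
theorem pipeCount_col (he : IsReadingOrder e) {j : Fin n} (hj : j ∉ I) {a s : ℕ}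
    (has : a ≤ s) (hs : s ≤ (j : ℕ)) :
    pipeCount D e a s (j + 1) + (if s ≤ (blankPerm D (window e a (j + 1)) j : ℕ) then 1 else 0) =
      pipeCount D e a s j + 1 := by
  have h1 := pipeCount_add_card (D := D) (e := e) has (show (j : ℕ) + 1 ≤ n from j.isLt)
  have h2 := pipeCount_add_card (D := D) (e := e) has (show (j : ℕ) ≤ n from j.isLt.le)
  have key : ∀ x ∉ I, (x : ℕ) < j →
      blankPerm D (window e a (j + 1)) x = blankPerm D (window e a j) x := fun x hx h =>
    blankPerm_window_col he hx (by omega) h fun _ _ _ => Iff.rfl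
  suffices h : (Iᶜ.filter fun x : Fin n => (x : ℕ) < (j : ℕ) + 1 ∧
      s ≤ (blankPerm D (window e a (j + 1)) x : ℕ)).card = (Iᶜ.filter fun x : Fin n =>
      (x : ℕ) < j ∧ s ≤ (blankPerm D (window e a j) x : ℕ)).card +
      (if s ≤ (blankPerm D (window e a (j + 1)) j : ℕ) then 1 else 0) by omega
  split_ifs with h
  · rw [← Finset.card_insert_of_notMem (a := j) (by simp)]
    congr 1
    ext x
    simp only [Finset.mem_filter, Finset.mem_insert, Finset.mem_compl]
    constructor
    · rintro ⟨h1, h3, h4⟩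
      by_cases hx : x = j
      · exact Or.inl hx
      · have : (x : ℕ) ≠ j := fun h => hx (Fin.ext h)
        exact Or.inr ⟨h1, by omega, by rwa [← key x h1 (by omega)]⟩
    · rintro (rfl | ⟨h1, h3, h4⟩)
      · exact ⟨hj, by omega, h⟩
      · exact ⟨h1, by omega, by rwa [key x h1 h3]⟩
  · congr 1
    ext x
    simp only [Finset.mem_filter, Finset.mem_compl]
    constructor
    · rintro ⟨h1, h3, h4⟩
      have : (x : ℕ) ≠ j := fun h' => h (Fin.ext h' ▸ h4)
      exact ⟨h1, by omega, by rwa [← key x h1 (by omega)]⟩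
    · rintro ⟨h1, h3, h4⟩
      exact ⟨h1, by omega, by rwa [key x h1 h3]⟩

theorem pipeCount_succ_le (a s t : ℕ) : pipeCount D e a (s + 1) t ≤ pipeCount D e a s t :=
  Finset.card_le_card fun x hx => by
    simp only [Finset.mem_filter] at hx ⊢
    exact ⟨hx.1, hx.2.1, hx.2.2.1, by omega⟩

theorem pipeCount_le_succ (a s t : ℕ) : pipeCount D e a s t ≤ pipeCount D e a (s + 1) t + 1 := by
  by_cases h : ∃ x, (blankPerm D (window e a t) x : ℕ) = s
  · obtain ⟨x, hx⟩ := h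
    refine (Finset.card_le_card (t := insert x (I.filter fun x : Fin n => a ≤ (x : ℕ) ∧
      (x : ℕ) < t ∧ s + 1 ≤ (blankPerm D (window e a t) x : ℕ))) fun y hy => ?_).trans
      (Finset.card_insert_le _ _)
    simp only [Finset.mem_filter, Finset.mem_insert] at hy ⊢
    by_cases hyx : y = x
    · exact Or.inl hyx
    · refine Or.inr ⟨hy.1, hy.2.1, hy.2.2.1, ?_⟩
      have : (blankPerm D (window e a t) y : ℕ) ≠ s := fun h' =>
        hyx ((blankPerm D (window e a t)).injective (Fin.ext (h'.trans hx.symm)))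
      omega
  · refine (Finset.card_le_card fun y hy => ?_).trans (Nat.le_succ _)
    simp only [Finset.mem_filter] at hy ⊢
    refine ⟨hy.1, hy.2.1, hy.2.2.1, ?_⟩
    have : (blankPerm D (window e a t) y : ℕ) ≠ s := fun h' => h ⟨y, h'⟩
    omega

/-- The rank of a union of two intervals `[0, a) ∪ [s, t)`. -/
noncomputable def intervalRank (D : Box I → Stone) (e : List (Box I)) (a s t : ℕ) : ℕ :=
  (I.filter fun x : Fin n => (x : ℕ) < a).card + pipeCount D e a s t

/-- A pipe with a label other than i can only be on row i if the window has a blank box there; the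
westmost one then sends it west, and the next blank box to the west lies outside the window. -/
theorem exists_westmost_iff (he : IsReadingOrder e) {i j : Fin n} (hij : i ≠ j) {a : ℕ} :
    (i ∈ I ∧ blankPerm D (window e i a) i = j) ↔ ∃ b : Blank D, b.1.1 = i ∧ b.pipeWest = j ∧
      (b.1.2 : ℕ) < a ∧ ∀ h, a ≤ ((b.nextWest h).1.2 : ℕ) := by
  have hc := window_closed he.isClosedOrder i a
  constructor
  · rintro ⟨hi, h⟩
    have hex : ∃ b : Blank D, b.box ∈ window e i a ∧ b.1.1 = i := by
      by_contra hno
      exact hij ((blankPerm_of_forall_row (D := D) (window e i a) hi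
        fun b hb hbi => hno ⟨b, hb, hbi⟩).symm.trans h)
    obtain ⟨b, hb, hbi, hmax⟩ := exists_westmost (fun b => b.box ∈ window e i a) i hex
    have := (blankPerm_westmost_northmost _ hc).1 b hb fun b' hb' hr => hmax b' hb' (hr.trans hbi)
    refine ⟨b, hbi, ?_, (mem_window.1 hb).2.2, fun hw => ?_⟩
    · rw [← this, hbi, h]
    · by_contra hlt
      have := hmax (b.nextWest hw) (mem_window.2 ⟨he.1 _, ?_, not_le.1 hlt⟩) hbi
      · exact absurd (b.nextWest_lt hw) (not_lt.2 this)
      · rw [show (b.nextWest hw).box.1.1 = i from hbi]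
  · rintro ⟨b, rfl, rfl, hba, hmax⟩
    refine ⟨b.row_mem, (blankPerm_westmost_northmost _ hc).1 b
      (mem_window.2 ⟨he.1 _, le_rfl, hba⟩) fun b' hb' hr => le_of_not_gt fun hlt => ?_⟩
    have hw := Blank.westOf_nonempty hr hlt
    have h1 : ((b.nextWest hw).1.2 : ℕ) ≤ b'.1.2 := Blank.nextWest_le hw hr hlt
    have h2 : (b'.1.2 : ℕ) < a := (mem_window.1 hb').2.2
    have := hmax hw
    omega

theorem exists_northmost_iff (he : IsReadingOrder e) {i j : Fin n} (hij : i ≠ j) {a : ℕ} :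
    (j ∉ I ∧ blankPerm D (window e a (j + 1)) j = i) ↔ ∃ b : Blank D, b.1.2 = j ∧
      b.pipeNorth = i ∧ a ≤ (b.1.1 : ℕ) ∧ ∀ h, ((b.nextNorth h).1.1 : ℕ) < a := by
  have hc := window_closed he.isClosedOrder a (j + 1)
  constructor
  · rintro ⟨hj, h⟩
    have hex : ∃ b : Blank D, b.box ∈ window e a (j + 1) ∧ b.1.2 = j := by
      by_contra hno
      exact hij.symm ((blankPerm_of_forall_col (D := D) (window e a (j + 1)) hj
        fun b hb hbi => hno ⟨b, hb, hbi⟩).symm.trans h)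
    obtain ⟨b, hb, hbj, hmax⟩ := exists_northmost (fun b => b.box ∈ window e a (j + 1)) j hex
    have := (blankPerm_westmost_northmost _ hc).2 b hb fun b' hb' hr => hmax b' hb' (hr.trans hbj)
    refine ⟨b, hbj, ?_, (mem_window.1 hb).2.1, fun hw => ?_⟩
    · rw [← this, hbj, h]
    · by_contra hlt
      have := hmax (b.nextNorth hw) (mem_window.2 ⟨he.1 _, not_lt.1 hlt, ?_⟩) hbj
      · exact absurd (b.nextNorth_lt hw) (not_lt.2 this)
      · rw [show (b.nextNorth hw).box.1.2 = j from hbj]; omega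
  · rintro ⟨b, rfl, rfl, hba, hmax⟩
    refine ⟨b.col_notMem, (blankPerm_westmost_northmost _ hc).2 b
      (mem_window.2 ⟨he.1 _, hba, Nat.lt_succ_self _⟩) fun b' hb' hr => le_of_not_gt fun hlt => ?_⟩
    have hw := Blank.northOf_nonempty hr hlt
    have h1 : (b'.1.1 : ℕ) ≤ ((b.nextNorth hw).1.1 : ℕ) := Blank.le_nextNorth hw hr hlt
    have h2 : a ≤ (b'.1.1 : ℕ) := (mem_window.1 hb').2.1
    have := hmax hw
    omega

/-- The three windows that meet at c show the pipes just before c is read (on its row and on its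
column) and just after (on its row). -/
theorem exists_prefix (he : IsReadingOrder e) (c : Box I) :
    ∃ l : List (Box I), IsClosedOrder (l ++ [c]) ∧
      blankPerm D (window e c.1.1 c.1.2) c.1.1 = blankPerm D l c.1.1 ∧
      blankPerm D (window e (c.1.1 + 1) (c.1.2 + 1)) c.1.2 = blankPerm D l c.1.2 ∧
      blankPerm D (window e c.1.1 (c.1.2 + 1)) c.1.1 = blankPerm D (l ++ [c]) c.1.1 := by
  obtain ⟨l, post, h⟩ := List.append_of_mem (he.1 c)
  have hl : IsClosedOrder (l ++ [c]) := by
    have := he.isClosedOrder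
    rw [h, ← List.singleton_append, ← List.append_assoc] at this
    exact this.of_append
  have hw := fun a t => window_closed he.isClosedOrder a t
  refine ⟨l, hl, blankPerm_congr_row (hw _ _) hl.of_append c.2.1 fun b hb => ?_,
    blankPerm_congr_col (hw _ _) hl.of_append c.2.2.1 fun b hb => ?_,
    blankPerm_congr_row (hw _ _) hl c.2.1 fun b hb => ?_⟩
  · rw [mem_window]
    constructor
    · rintro ⟨-, -, h2⟩
      exact hl.mem_of_southEast hb.ge (le_of_lt h2) fun h' => by rw [h'] at h2; omega
    · exact fun hbl => ⟨he.1 b, by rw [hb], lt_of_not_ge fun h' => hl.not_southEast hbl ⟨hb.le, h'⟩⟩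
  · rw [mem_window]
    constructor
    · rintro ⟨-, h2, -⟩
      have h3 : c.1.1 ≤ b.1.1 := Fin.le_def.2 (by omega)
      exact hl.mem_of_southEast h3 hb.le fun h' => by rw [h'] at h2; omega
    · refine fun hbl => ⟨he.1 b, ?_, by rw [hb]; omega⟩
      exact lt_of_not_ge fun h' => hl.not_southEast hbl ⟨h', hb.ge⟩
  · rw [mem_window]
    constructor
    · rintro ⟨-, -, h2⟩
      exact hl.2 c (by simp) b hb.ge (Fin.le_def.2 (by omega))
    · intro hbl
      refine ⟨he.1 b, by rw [hb], ?_⟩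
      rcases List.mem_append.1 hbl with hbl | hbl
      · exact Nat.lt_succ_of_lt (lt_of_not_ge fun h' => hl.not_southEast hbl ⟨hb.le, h'⟩)
      · rw [List.mem_singleton.1 hbl]; omega

/-- The exchange condition on the ranks for the columns `i < j` and the set `[0, i) ∪ (j, a)`. -/
theorem exchange_high_iff (he : IsReadingOrder e) {i j : Fin n} (hij : i < j) {a : ℕ}
    (ha : (j : ℕ) < a) :
    (intervalRank D e (i + 1) (j + 1) a = intervalRank D e i (j + 1) a + 1 ∧
      intervalRank D e i j a = intervalRank D e i (j + 1) a + 1 ∧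
      intervalRank D e (i + 1) j a = intervalRank D e i (j + 1) a + 1) ↔
    ∃ b : Blank D, b.1.1 = i ∧ b.pipeWest = j ∧
      (b.1.2 : ℕ) < a ∧ ∀ h, a ≤ ((b.nextWest h).1.2 : ℕ) := by
  rw [← exists_westmost_iff he hij.ne]
  have hij' : (i : ℕ) < j := hij
  simp only [intervalRank, card_filter_lt_succ]
  by_cases hi : i ∈ I
  · have h1 := pipeCount_row (D := D) he hi (s := j + 1) (show (i : ℕ) < a by omega)
    have h2 := pipeCount_row (D := D) he hi (s := j) (show (i : ℕ) < a by omega)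
    have h3 := pipeCount_le_succ (D := D) (e := e) i j a
    have h4 := pipeCount_succ_le (D := D) (e := e) (i + 1) j a
    -- Adding i to [0, i) ∪ [s, a) raises the rank exactly when the pipe on row i has a label less
    -- than s. The cases s = j + 1 and s = j together force this label to be j.
    simp only [hi, if_true, true_and, Fin.ext_iff]
    split_ifs at h1 h2 <;> omega
  · have h1 := pipeCount_of_notMem (D := D) he hi (s := j + 1) (t := a)
    simp only [hi, if_false, false_and, iff_false]
    omega

/-- The exchange condition on the ranks for the columns `i < j` and the set `[0, a) ∪ (i, j)`. -/
theorem exchange_low_iff (he : IsReadingOrder e) {i j : Fin n} (hij : i < j) {a : ℕ}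
    (ha : a ≤ (i : ℕ)) :
    (intervalRank D e a i j = intervalRank D e a (i + 1) j + 1 ∧
      intervalRank D e a (i + 1) (j + 1) = intervalRank D e a (i + 1) j + 1 ∧
      intervalRank D e a i (j + 1) = intervalRank D e a (i + 1) j + 1) ↔
    ∃ b : Blank D, b.1.2 = j ∧ b.pipeNorth = i ∧ a ≤ (b.1.1 : ℕ) ∧
      ∀ h, ((b.nextNorth h).1.1 : ℕ) < a := by
  rw [← exists_northmost_iff he hij.ne]
  have hij' : (i : ℕ) < j := hij
  simp only [intervalRank]
  by_cases hj : j ∈ I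
  · have h1 := pipeCount_of_mem (D := D) he hj (a := a) (s := i) (by omega) (by omega)
    simp only [hj, not_true, false_and, iff_false]
    omega
  · have h1 := pipeCount_col (D := D) he hj (a := a) (s := i) (by omega) (by omega)
    have h2 := pipeCount_col (D := D) he hj (a := a) (s := i + 1) (by omega) (by omega)
    have h3 := pipeCount_le_succ (D := D) (e := e) a i j
    have h4 := pipeCount_succ_le (D := D) (e := e) a i (j + 1)
    -- Adding j to [0, a) ∪ [s, j) raises the rank exactly when the pipe on column j has a label
    -- less than s; now take s = i + 1 and s = i.
    simp only [hj, not_false_iff, true_and, Fin.ext_iff]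
    split_ifs at h1 h2 <;> omega

/-- The exchange condition on the ranks for the columns `i < j` and the set `[0, i) ∪ [a, j)`. -/
theorem exchange_middle_iff (he : IsReadingOrder e) {i j : Fin n} {a : ℕ} (hi : (i : ℕ) < a)
    (hj : a ≤ (j : ℕ)) :
    (intervalRank D e (i + 1) a j = intervalRank D e i a j + 1 ∧
      intervalRank D e i a (j + 1) = intervalRank D e i a j + 1 ∧
      intervalRank D e (i + 1) a (j + 1) = intervalRank D e i a j + 1) ↔
    ∃ b : Blank D, b.1.1 = i ∧ b.1.2 = j ∧ (b.pipeNorth : ℕ) < a ∧ a ≤ (b.pipeWest : ℕ) := by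
  simp only [intervalRank, card_filter_lt_succ]
  by_cases hiI : i ∈ I
  swap
  · have h1 := pipeCount_of_notMem (D := D) he hiI (s := a) (t := j)
    refine iff_of_false (by simp only [hiI, if_false]; omega) ?_
    rintro ⟨b, rfl, -⟩
    exact hiI b.row_mem
  by_cases hjI : j ∈ I
  · have h1 := pipeCount_of_mem (D := D) he hjI (a := i + 1) (s := a) (by omega) (by omega)
    refine iff_of_false (by simp only [hiI, if_true]; omega) ?_
    rintro ⟨b, -, rfl, -⟩
    exact b.col_notMem hjI
  have hij : i < j := Fin.lt_def.2 (by omega)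
  have h1 := pipeCount_row (D := D) he hiI (s := a) (show (i : ℕ) < j by omega)
  have h2 := pipeCount_col (D := D) he hjI (a := i + 1) (s := a) (by omega) (by omega)
  have h3 := pipeCount_row (D := D) he hiI (s := a) (show (i : ℕ) < j + 1 by omega)
  obtain ⟨l, hl, p1, p2, p3⟩ := exists_prefix (D := D) he ⟨(i, j), hiI, hjI, hij⟩
  dsimp only at p1 p2 p3
  rw [p1] at h1
  rw [p2] at h2
  rw [p3] at h3
  simp only [hiI, if_true]
  by_cases hb : D ⟨(i, j), hiI, hjI, hij⟩ = Stone.blank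
  · obtain ⟨q1, q2⟩ := blankPerm_pipes (D := D) (b := toBlank _ hb) hl
    change blankPerm D l i = _ at q1
    change blankPerm D l j = _ at q2
    rw [blankPerm_concat_blank l hb, Equiv.Perm.mul_apply, Equiv.swap_apply_left, q2] at h3
    rw [q1] at h1
    rw [q2] at h2
    have hiff : (∃ b : Blank D, b.1.1 = i ∧ b.1.2 = j ∧ (b.pipeNorth : ℕ) < a ∧
        a ≤ (b.pipeWest : ℕ)) ↔ ((toBlank _ hb : Blank D).pipeNorth : ℕ) < a ∧
        a ≤ ((toBlank _ hb : Blank D).pipeWest : ℕ) := by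
      constructor
      · rintro ⟨b, e1, e2, h⟩
        rwa [show b = toBlank _ hb from Blank.ext' e1 e2] at h
      · exact fun h => ⟨toBlank _ hb, rfl, rfl, h⟩
    rw [hiff]
    split_ifs at h1 h2 h3 <;> omega
  -- At a stone the row keeps its pipe. Given the first condition, the other two then make opposite
  -- demands on the pipe of the column.
  · rw [blankPerm_concat_stone l hb] at h3
    refine iff_of_false ?_ ?_
    · split_ifs at h1 h2 h3 <;> omega
    · rintro ⟨⟨b, hb'⟩, rfl, rfl, -⟩
      exact hb hb'.2

end Counting


/-! ### Bases of minimal weight -/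

section Bases

variable {k n : ℕ} (A : Matrix (Fin k) (Fin n) ℝ)

/-- The columns `J` of `A` form a basis. -/
def IsColBasis (J : Finset (Fin n)) : Prop := ∃ h : J.card = k, plucker A J h ≠ 0

/-- The rank of a set of columns. -/
noncomputable def colRank (S : Set (Fin n)) : ℕ :=
  Module.finrank ℝ (Submodule.span ℝ (A.col '' S))

variable {A}

theorem isColBasis_iff {J : Finset (Fin n)} :
    IsColBasis A J ↔ J.card = k ∧ LinearIndepOn ℝ A.col (J : Set (Fin n)) := by
  refine ⟨fun ⟨h, hd⟩ => ⟨h, ?_⟩, fun ⟨h, hd⟩ => ⟨h, ?_⟩⟩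
  · have h1 := Matrix.linearIndependent_cols_iff_isUnit.2
      ((Matrix.isUnit_iff_isUnit_det _).2 (isUnit_iff_ne_zero.2 hd))
    rw [← Finset.range_orderEmbOfFin J h, linearIndepOn_range_iff (J.orderEmbOfFin h).injective]
    exact h1
  · rw [← Finset.range_orderEmbOfFin J h,
      linearIndepOn_range_iff (J.orderEmbOfFin h).injective] at hd
    exact isUnit_iff_ne_zero.1 ((Matrix.isUnit_iff_isUnit_det _).1
      (Matrix.linearIndependent_cols_iff_isUnit.1 hd))

/-- Row rank equals column rank, applied to the matrix with the columns outside S replaced by zero.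
-/
theorem colRank_eq (S : Set (Fin n)) : colRank A S =
    Module.finrank ℝ (Submodule.map (coordProj S) (Submodule.span ℝ (Set.range A.row))) := by
  classical
  set B := A * Matrix.diagonal (fun x : Fin n => if x ∈ S then (1 : ℝ) else 0) with hB
  have hBij : ∀ i j, B i j = if j ∈ S then A i j else 0 := fun i j => by
    simp [hB, Matrix.mul_diagonal]
  have hcol : Submodule.span ℝ (A.col '' S) = Submodule.span ℝ (Set.range B.col) := by
    refine le_antisymm (Submodule.span_le.2 ?_) (Submodule.span_le.2 ?_)
    · rintro _ ⟨j, hj, rfl⟩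
      exact Submodule.subset_span ⟨j, by ext i; simp [Matrix.col, hBij, hj]⟩
    · rintro _ ⟨j, rfl⟩
      by_cases hj : j ∈ S
      · exact Submodule.subset_span ⟨j, hj, by ext i; simp [Matrix.col, hBij, hj]⟩
      · have : B.col j = 0 := by ext i; simp [Matrix.col, hBij, hj]
        rw [this]; exact zero_mem _
  have hrow : Submodule.map (coordProj S) (Submodule.span ℝ (Set.range A.row)) =
      Submodule.span ℝ (Set.range B.row) := by
    rw [Submodule.map_span, ← Set.range_comp]
    congr 2
    ext i j
    by_cases hj : j ∈ S
    · simp [Function.comp, coordProj_apply_mem hj, Matrix.row, hBij, hj]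
    · simp [Function.comp, coordProj_apply_notMem hj, Matrix.row, hBij, hj]
  rw [colRank, hcol, hrow, ← Matrix.rank_eq_finrank_span_cols, ← Matrix.rank_eq_finrank_span_row]

theorem colRank_mono {S T : Set (Fin n)} (h : S ⊆ T) : colRank A S ≤ colRank A T :=
  Submodule.finrank_mono (Submodule.span_mono (Set.image_mono h))

theorem finrank_span_col {J : Finset (Fin n)} (hJ : LinearIndepOn ℝ A.col (J : Set (Fin n))) :
    Module.finrank ℝ (Submodule.span ℝ (A.col '' (J : Set (Fin n)))) = J.card := by
  have := finrank_span_eq_card (R := ℝ) hJ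
  rw [Set.image_eq_range]
  simpa using this

theorem card_le_colRank {J X : Finset (Fin n)} {S : Set (Fin n)} (hJ : IsColBasis A J)
    (hX : X ⊆ J) (hXS : (X : Set (Fin n)) ⊆ S) : X.card ≤ colRank A S := by
  rw [← finrank_span_col ((isColBasis_iff.1 hJ).2.mono (Finset.coe_subset.2 hX))]
  exact colRank_mono hXS

/-- A column outside the span of some members of a basis may replace one of the other members;
which one can be prescribed if the column lies in the span of those members and that one. -/
theorem IsColBasis.exists_exchange {J X : Finset (Fin n)} (hJ : IsColBasis A J) (hX : X ⊆ J)
    {y : Fin n} (hy : A.col y ∉ Submodule.span ℝ (A.col '' (X : Set (Fin n)))) :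
    ∃ x ∈ J, x ∉ X ∧ IsColBasis A (insert y (J.erase x)) ∧
      ∀ z, A.col y ∈ Submodule.span ℝ (A.col '' (insert z (X : Set (Fin n)))) → z ∈ J → z = x := by
  classical
  obtain ⟨hcard, hind⟩ := isColBasis_iff.1 hJ
  have hc : Fintype.card (J : Set (Fin n)) = Module.finrank ℝ (Fin k → ℝ) := by simp [hcard]
  let b : Module.Basis (J : Set (Fin n)) ℝ (Fin k → ℝ) :=
    basisOfLinearIndependentOfCardEqFinrank' _ hind hc
  have hb : ∀ s : Set (Fin n), s ⊆ J → b '' {x | (x : Fin n) ∈ s} = A.col '' s := by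
    intro s hs
    ext v
    constructor
    · rintro ⟨x, hx, rfl⟩
      exact ⟨x, hx, by simp [b]⟩
    · rintro ⟨x, hx, rfl⟩
      exact ⟨⟨x, hs hx⟩, hx, by simp [b]⟩
  -- Some member x of `J` outside `X` occurs in the expansion of column y, and it can be replaced.
  -- If y lies in the span of `X` and one further member z, no other x can occur.
  rw [← hb X (Finset.coe_subset.2 hX), Module.Basis.mem_span_image, Set.not_subset] at hy
  obtain ⟨x, hx, hxX⟩ := hy
  have hyx : A.col y ∉ Submodule.span ℝ (A.col '' ((J.erase x : Finset (Fin n)) : Set (Fin n))) := by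
    rw [← hb _ (Finset.coe_subset.2 (Finset.erase_subset _ _)), Module.Basis.mem_span_image]
    intro h
    have := h hx
    simp at this
  refine ⟨x, x.2, hxX, isColBasis_iff.2 ⟨?_, ?_⟩, ?_⟩
  · rw [Finset.card_insert_of_notMem, Finset.card_erase_of_mem x.2, hcard]
    · have := Finset.card_pos.2 ⟨_, x.2⟩
      omega
    · exact fun h => hyx (Submodule.subset_span ⟨y, h, rfl⟩)
  · rw [Finset.coe_insert]
    exact (hind.mono (Finset.coe_subset.2 (Finset.erase_subset _ _))).insert hyx
  · intro z hz hzJ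
    rw [← hb _ (Set.insert_subset hzJ (Finset.coe_subset.2 hX)), Module.Basis.mem_span_image] at hz
    rcases hz hx with h | h
    · exact h.symm
    · exact absurd h hxX

/-- `J` is a basis of minimal weight. -/
def IsMinBasis (A : Matrix (Fin k) (Fin n) ℝ) (w : Fin n → ℝ) (J : Finset (Fin n)) : Prop :=
  IsColBasis A J ∧ ∀ J', IsColBasis A J' → ∑ x ∈ J, w x ≤ ∑ x ∈ J', w x

variable {w : Fin n → ℝ}

/-- `S` consists of the elements whose weights are below some level. -/
def IsLower (w : Fin n → ℝ) (S : Set (Fin n)) : Prop := ∀ x ∈ S, ∀ y ∉ S, w x < w y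

-- The greedy principle. If the members of J in S did not span S, some y in S outside their span
-- could replace a member of J outside S, which is heavier.
open Classical in
theorem IsMinBasis.card_filter {J : Finset (Fin n)} (hJ : IsMinBasis A w J) {S : Set (Fin n)}
    (hS : IsLower w S) : (J.filter (· ∈ S)).card = colRank A S := by
  set X := J.filter (· ∈ S) with hX
  have hXJ : X ⊆ J := Finset.filter_subset _ _
  refine le_antisymm (card_le_colRank hJ.1 hXJ fun x hx => (Finset.mem_filter.1 hx).2) ?_
  by_contra hlt
  obtain ⟨y, hyS, hy⟩ : ∃ y ∈ S, A.col y ∉ Submodule.span ℝ (A.col '' (X : Set (Fin n))) := by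
    by_contra hno
    push Not at hno
    refine hlt ?_
    rw [← finrank_span_col ((isColBasis_iff.1 hJ.1).2.mono (Finset.coe_subset.2 hXJ))]
    refine Submodule.finrank_mono (Submodule.span_le.2 ?_)
    rintro _ ⟨y, hy, rfl⟩
    exact hno y hy
  obtain ⟨x, hxJ, hxX, hbasis, -⟩ := hJ.1.exists_exchange hXJ hy
  have hxS : x ∉ S := fun h => hxX (Finset.mem_filter.2 ⟨hxJ, h⟩)
  have hyJ : y ∉ J.erase x := fun h => hy (Submodule.subset_span
    ⟨y, Finset.mem_coe.2 (Finset.mem_filter.2 ⟨Finset.mem_of_mem_erase h, hyS⟩), rfl⟩)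
  have h1 := hJ.2 _ hbasis
  rw [Finset.sum_insert hyJ, ← Finset.add_sum_erase J w hxJ] at h1
  have := hS y hyS x hxS
  linarith

/-- Exactly one of `i` and `j` is needed to extend a basis of `S` to `S ∪ {i, j}`, and both can be
used. -/
def IsExchange (A : Matrix (Fin k) (Fin n) ℝ) (S : Set (Fin n)) (i j : Fin n) : Prop :=
  colRank A (insert i S) = colRank A S + 1 ∧ colRank A (insert j S) = colRank A S + 1 ∧
    colRank A (insert i (insert j S)) = colRank A S + 1

theorem IsExchange.symm {S : Set (Fin n)} {i j : Fin n} (h : IsExchange A S i j) :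
    IsExchange A S j i := ⟨h.2.1, h.1, by rw [Set.insert_comm]; exact h.2.2⟩

/-- The members of J in S span S and, with i, they span S ∪ {i, j}. So column j depends on these
members and i, but not on these members alone; it can replace i and nothing else, without change of
weight. -/
theorem IsMinBasis.exists_ne_of_mem {J : Finset (Fin n)} (hJ : IsMinBasis A w J)
    {S : Set (Fin n)} {i j : Fin n} (hS : IsLower w S) (hij : w i = w j) (hi : i ∉ S)
    (hex : IsExchange A S i j) (hiJ : i ∈ J) (hjJ : j ∉ J) :
    ∃ J' ≠ J, IsMinBasis A w J' := by
  classical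
  set X := J.filter (· ∈ S) with hX
  have hXJ : X ⊆ J := Finset.filter_subset _ _
  have hXc : X.card = colRank A S := hJ.card_filter hS
  have hind := (isColBasis_iff.1 hJ.1).2
  have hXspan : Submodule.span ℝ (A.col '' (X : Set (Fin n))) = Submodule.span ℝ (A.col '' S) := by
    refine Submodule.eq_of_le_of_finrank_eq (Submodule.span_mono (Set.image_mono fun x hx =>
      (Finset.mem_filter.1 hx).2)) ?_
    rw [finrank_span_col (hind.mono (Finset.coe_subset.2 hXJ)), hXc, colRank]
  have hiX : i ∉ X := fun h => hi (Finset.mem_filter.1 h).2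
  have hiXspan : Submodule.span ℝ (A.col '' (insert i (X : Set (Fin n)))) =
      Submodule.span ℝ (A.col '' (insert i (insert j S))) := by
    refine Submodule.eq_of_le_of_finrank_eq (Submodule.span_mono (Set.image_mono ?_)) ?_
    · exact Set.insert_subset_insert fun x hx => Or.inr (Finset.mem_filter.1 hx).2
    · rw [← Finset.coe_insert, finrank_span_col (hind.mono (Finset.coe_subset.2
        (Finset.insert_subset hiJ hXJ))), Finset.card_insert_of_notMem hiX, hXc]
      exact hex.2.2.symm
  have hj : A.col j ∉ Submodule.span ℝ (A.col '' (X : Set (Fin n))) := by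
    intro h
    rw [hXspan] at h
    have h1 : colRank A (insert j S) = colRank A S := by
      rw [colRank, Set.image_insert_eq, Submodule.span_insert_eq_span h, colRank]
    have := hex.2.1
    omega
  obtain ⟨x, hxJ, hxX, hbasis, hx⟩ := hJ.1.exists_exchange hXJ hj
  obtain rfl : i = x := hx i (hiXspan ▸ Submodule.subset_span
    ⟨j, Or.inr (Or.inl rfl), rfl⟩) hiJ
  have hsum : ∑ x ∈ insert j (J.erase i), w x = ∑ x ∈ J, w x := by
    rw [Finset.sum_insert (fun h => hjJ (Finset.mem_of_mem_erase h)),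
      ← Finset.add_sum_erase J w hxJ, hij]
  exact ⟨_, fun h => hjJ (h ▸ Finset.mem_insert_self _ _), hbasis, fun J' hJ' => hsum ▸ hJ.2 J' hJ'⟩

/-- If two elements of equal weight can be exchanged, then the basis of minimal weight is not
unique. -/
theorem IsMinBasis.exists_ne {J : Finset (Fin n)} (hJ : IsMinBasis A w J) {S : Set (Fin n)}
    {i j : Fin n} (hne : i ≠ j) (hS : IsLower w S) (hS' : IsLower w (insert i (insert j S)))
    (hij : w i = w j) (hi : i ∉ S) (hj : j ∉ S) (hex : IsExchange A S i j) :
    ∃ J' ≠ J, IsMinBasis A w J' := by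
  classical
  have h1 := hJ.card_filter hS
  obtain ⟨T, hT⟩ : ∃ T, T = insert i (insert j S) := ⟨_, rfl⟩
  have h2 := hJ.card_filter (hT ▸ hS')
  have h3 : colRank A T = colRank A S + 1 := by rw [hT]; exact hex.2.2
  rw [h3, ← h1] at h2
  -- `J` has exactly one more member in `T` than in `S`, so it contains exactly one of i and j.
  by_cases hiJ : i ∈ J <;> by_cases hjJ : j ∈ J
  · have : J.filter (· ∈ T) = insert i (insert j (J.filter (· ∈ S))) := by
      ext x; simp only [hT, Finset.mem_filter, Set.mem_insert_iff, Finset.mem_insert]; grind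
    rw [this, Finset.card_insert_of_notMem (by simp [hne, hi]),
      Finset.card_insert_of_notMem (by simp [hj])] at h2
    omega
  · exact hJ.exists_ne_of_mem hS hij hi hex hiJ hjJ
  · exact hJ.exists_ne_of_mem hS hij.symm hj hex.symm hjJ hiJ
  · have : J.filter (· ∈ T) = J.filter (· ∈ S) := by
      ext x; simp only [hT, Finset.mem_filter, Set.mem_insert_iff]; grind
    rw [this] at h2
    omega

/-- If the basis of minimal weight is not unique and no three weights agree, then some two elements
of equal weight can be exchanged. -/
theorem exists_isExchange {J J' : Finset (Fin n)} (hJ : IsMinBasis A w J)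
    (hJ' : IsMinBasis A w J') (hne : J ≠ J')
    (hw : ∀ x y z, x ≠ y → x ≠ z → y ≠ z → w x = w y → w x ≠ w z) :
    ∃ i j, i < j ∧ w i = w j ∧ IsExchange A {x | w x < w i} i j := by
  classical
  obtain ⟨x, hxJ, hxJ'⟩ : ∃ x ∈ J, x ∉ J' := by
    by_contra hno
    push Not at hno
    exact hne (Finset.eq_of_subset_of_card_le hno (by rw [hJ.1.1, hJ'.1.1]))
  set S := {y | w y < w x} with hSdef
  set T := {y | w y ≤ w x} with hTdef
  have hS : IsLower w S := fun y hy z hz => lt_of_lt_of_le hy (not_lt.1 hz)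
  have hT : IsLower w T := fun y hy z hz => lt_of_le_of_lt hy (not_le.1 hz)
  have key : ∀ J : Finset (Fin n), (J.filter (· ∈ T)).card =
      (J.filter (· ∈ S)).card + (J.filter (fun y => w y = w x)).card := by
    intro J
    rw [← Finset.card_union_of_disjoint]
    · congr 1
      ext y
      simp only [Finset.mem_filter, Finset.mem_union, hSdef, hTdef, Set.mem_ofPred_eq,
        le_iff_lt_or_eq, and_or_left]
    · rw [Finset.disjoint_left]
      intro y h h'
      exact absurd (Finset.mem_filter.1 h').2 (ne_of_lt (Finset.mem_filter.1 h).2)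
  have h1 := key J
  have h2 := key J'
  rw [hJ.card_filter hS, hJ.card_filter hT] at h1
  rw [hJ'.card_filter hS, hJ'.card_filter hT] at h2
  -- Both bases have the same number of members of weight `w x`, namely the difference of the ranks
  -- of `T` and `S`. As x is missing from `J'`, another element of this weight takes its place.
  obtain ⟨y, hyJ', hyx, hyJ⟩ : ∃ y ∈ J', w y = w x ∧ y ∉ J := by
    by_contra hno
    push Not at hno
    have hsub : J'.filter (fun y => w y = w x) ⊆ J.filter (fun y => w y = w x) := fun y hy => by
      simp only [Finset.mem_filter] at hy ⊢
      exact ⟨hno y hy.1 hy.2, hy.2⟩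
    have := Finset.eq_of_subset_of_card_le hsub (by omega)
    have hx : x ∈ J.filter (fun y => w y = w x) := Finset.mem_filter.2 ⟨hxJ, rfl⟩
    rw [← this] at hx
    exact hxJ' (Finset.mem_filter.1 hx).1
  have hxy : x ≠ y := fun h => hxJ' (h ▸ hyJ')
  have hTeq : T = insert x (insert y S) := by
    ext z
    simp only [hTdef, hSdef, Set.mem_ofPred_eq, Set.mem_insert_iff]
    constructor
    · intro hz
      by_contra hcon
      push Not at hcon
      exact hw x y z hxy hcon.1.symm hcon.2.1.symm hyx.symm (le_antisymm hcon.2.2 hz)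
    · rintro (rfl | rfl | h)
      exacts [le_rfl, hyx.le, h.le]
  have hone : J.filter (fun z => w z = w x) = {x} := by
    ext z
    simp only [Finset.mem_filter, Finset.mem_singleton]
    constructor
    · rintro ⟨hz, hzx⟩
      by_contra hne'
      exact hw x y z hxy (Ne.symm hne') (fun h => hyJ (h ▸ hz)) hyx.symm hzx.symm
    · rintro rfl
      exact ⟨hxJ, rfl⟩
  rw [hone, Finset.card_singleton] at h1
  have hlow : ∀ (J : Finset (Fin n)) (z : Fin n), IsMinBasis A w J → z ∈ J → z ∉ S →
      colRank A S + 1 ≤ colRank A (insert z S) := by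
    intro J z hJ hz hzS
    rw [← hJ.card_filter hS, ← Finset.card_insert_of_notMem (a := z) (by simp [hzS])]
    refine card_le_colRank hJ.1 (Finset.insert_subset hz (Finset.filter_subset _ _)) ?_
    rw [Finset.coe_insert]
    exact Set.insert_subset_insert fun y hy => (Finset.mem_filter.1 hy).2
  have hx := hlow J x hJ hxJ (lt_irrefl (w x))
  have hy := hlow J' y hJ' hyJ' (by rw [hSdef, Set.mem_ofPred_eq, hyx]; exact lt_irrefl _)
  have hx' : colRank A (insert x S) ≤ colRank A T := by
    rw [hTeq]; exact colRank_mono (Set.insert_subset_insert (Set.subset_insert _ _))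
  have hy' : colRank A (insert y S) ≤ colRank A T := by
    rw [hTeq]; exact colRank_mono (Set.subset_insert _ _)
  have hex : IsExchange A S x y := ⟨by omega, by omega, by rw [← hTeq]; omega⟩
  rcases lt_or_gt_of_ne hxy with h | h
  · exact ⟨x, y, h, hyx.symm, hex⟩
  · exact ⟨y, x, h, hyx, by rw [hyx]; exact hex.symm⟩

end Bases


/-! ### The locus where a minimum of affine functions is not linear -/

section Locus

theorem isClosed_nonlinearLocus (f : ℝ × ℝ → ℝ) : IsClosed (nonlinearLocus f) := by
  rw [← isOpen_compl_iff, isOpen_iff_eventually]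
  intro P hP
  obtain ⟨a, b, c, h⟩ := not_not.1 hP
  filter_upwards [eventually_eventually_nhds.2 h] with Q hQ
  exact not_not.2 ⟨a, b, c, hQ⟩

variable {ι : Type*} (a b d : ι → ℝ)

/-- An affine function on the plane. -/
def affineFun (i : ι) (q : ℝ × ℝ) : ℝ := a i * q.1 + b i * q.2 + d i

/-- `i` minimizes the affine functions at `q`. -/
def IsMinAt (q : ℝ × ℝ) (i : ι) : Prop := ∀ l, affineFun a b d i q ≤ affineFun a b d l q

variable {a b d}

theorem continuous_affineFun (i : ι) : Continuous (affineFun a b d i) := by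
  unfold affineFun; fun_prop

theorem exists_isMinAt [Finite ι] [Nonempty ι] (q : ℝ × ℝ) : ∃ i, IsMinAt a b d q i :=
  Finite.exists_min fun i => affineFun a b d i q

theorem IsMinAt.iInf_eq [Finite ι] [Nonempty ι] {q : ℝ × ℝ} {i : ι} (h : IsMinAt a b d q i) :
    ⨅ i, affineFun a b d i q = affineFun a b d i q :=
  le_antisymm (ciInf_le (Set.finite_range _).bddBelow i) (le_ciInf h)

theorem IsMinAt.eventually_unique [Finite ι] {q : ℝ × ℝ} {i : ι} (h : IsMinAt a b d q i)
    (hu : ∀ j, IsMinAt a b d q j → j = i) :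
    ∀ᶠ q' in 𝓝 q, IsMinAt a b d q' i ∧ ∀ j, IsMinAt a b d q' j → j = i := by
  have hlt : ∀ j, j ≠ i → affineFun a b d i q < affineFun a b d j q := fun j hj =>
    lt_of_not_ge fun hle => hj (hu j fun l => hle.trans (h l))
  have : ∀ᶠ q' in 𝓝 q, ∀ j, j ≠ i → affineFun a b d i q' < affineFun a b d j q' := by
    rw [eventually_all]
    intro j
    by_cases hj : j = i
    · exact Eventually.of_forall fun _ h => absurd hj h
    · filter_upwards [(continuous_affineFun i).continuousAt.eventually_lt
        (continuous_affineFun j).continuousAt (hlt j hj)] with q' hq' _ using hq'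
  filter_upwards [this] with q' hq'
  refine ⟨fun l => ?_, fun j hj => ?_⟩
  · by_cases hl : l = i
    · rw [hl]
    · exact (hq' l hl).le
  · by_contra hne
    exact absurd (hj i) (not_le.2 (hq' j hne))

/-- A unique minimizer stays unique nearby and the minimum coincides with it. Conversely, if the
minimum is linear near q with first coefficient α, a minimizer i at q satisfies α s ≤ a_i s for all
small s of either sign, so a_i = α; as the a_i are distinct, there is only one. -/
theorem mem_nonlinearLocus_iff [Finite ι] [Nonempty ι] (ha : Function.Injective a) (q : ℝ × ℝ) :
    q ∈ nonlinearLocus (fun q => ⨅ i, affineFun a b d i q) ↔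
      ∃ i j, i ≠ j ∧ IsMinAt a b d q i ∧ IsMinAt a b d q j := by
  constructor
  · intro hq
    obtain ⟨i, hi⟩ := exists_isMinAt (a := a) (b := b) (d := d) q
    by_contra hno
    push Not at hno
    refine hq ⟨a i, b i, d i, ?_⟩
    filter_upwards [hi.eventually_unique fun j hj => by_contra fun hne =>
      hno i j (Ne.symm hne) hi hj] with q' hq'
    rw [hq'.1.iInf_eq, affineFun]
  · rintro ⟨i, j, hij, hi, hj⟩ ⟨α, β, γ, h⟩
    have key : ∀ i, IsMinAt a b d q i → a i = α := by
      intro i hi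
      have h0 : ⨅ i, affineFun a b d i q = α * q.1 + β * q.2 + γ := h.self_of_nhds
      rw [hi.iInf_eq] at h0
      have hcont : Tendsto (fun s : ℝ => ((q.1 + s, q.2) : ℝ × ℝ)) (𝓝 0) (𝓝 q) := by
        have : Continuous fun s : ℝ => ((q.1 + s, q.2) : ℝ × ℝ) := by fun_prop
        simpa using this.tendsto 0
      have h1 := hcont.eventually h
      have h2 : ∀ᶠ s : ℝ in 𝓝 0, α * s ≤ a i * s := by
        filter_upwards [h1] with s hs
        have h3 : ⨅ i, affineFun a b d i (q.1 + s, q.2) ≤ affineFun a b d i (q.1 + s, q.2) :=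
          ciInf_le (Set.finite_range _).bddBelow i
        rw [show ⨅ i, affineFun a b d i (q.1 + s, q.2) = α * (q.1 + s) + β * q.2 + γ from hs] at h3
        simp only [affineFun] at h0 h3
        linarith
      obtain ⟨ε, hε, hball⟩ := Metric.eventually_nhds_iff.1 h2
      have h4 := hball (y := ε / 2) (by simp [abs_of_pos hε]; linarith)
      have h5 := hball (y := -(ε / 2)) (by simp [abs_of_pos hε]; linarith)
      nlinarith
    exact hij (ha ((key i hi).trans (key j hj).symm))

theorem continuous_iInf_affineFun [Finite ι] [Nonempty ι] : Continuous fun q => ⨅ i, affineFun a b d i q := by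
  have := Fintype.ofFinite ι
  have h : Continuous fun q => Finset.univ.inf' Finset.univ_nonempty fun i => affineFun a b d i q :=
    Continuous.finset_inf'_apply _ fun i _ => continuous_affineFun i
  simpa only [Finset.inf'_univ_eq_ciInf] using h

/-- The locus has no isolated points. -/
theorem mem_closure_nonlinearLocus_diff [Finite ι] [Nonempty ι] (ha : Function.Injective a) {F : Set (ℝ × ℝ)}
    (hF : F.Finite) {P : ℝ × ℝ} (hP : P ∈ nonlinearLocus (fun q => ⨅ i, affineFun a b d i q)) :
    P ∈ closure (nonlinearLocus (fun q => ⨅ i, affineFun a b d i q) \ F) := by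
  set f : ℝ × ℝ → ℝ := fun q => ⨅ i, affineFun a b d i q with hf
  by_contra hcl
  have h1 : ∀ᶠ q in 𝓝 P, q ∉ nonlinearLocus f \ F := by
    rw [mem_closure_iff_frequently, not_frequently] at hcl
    exact hcl
  have h2 : ∀ᶠ q in 𝓝 P, q ∉ F \ {P} :=
    (hF.subset Set.sdiff_subset).isClosed.isOpen_compl.mem_nhds (by simp)
  obtain ⟨ε, hε, hball⟩ := Metric.eventually_nhds_iff.1 (h1.and h2)
  have huniq : ∀ q, dist q P < ε → q ≠ P → ∀ i j, IsMinAt a b d q i → IsMinAt a b d q j →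
      i = j := by
    intro q hq hne i j hi hj
    by_contra hij
    obtain ⟨h3, h4⟩ := hball hq
    have h5 : q ∈ nonlinearLocus f := (mem_nonlinearLocus_iff ha q).2 ⟨i, j, hij, hi, hj⟩
    exact h3 ⟨h5, fun hqF => h4 ⟨hqF, hne⟩⟩
  choose m hm using fun q => exists_isMinAt (a := a) (b := b) (d := d) q
  have hfm : ∀ q, f q = affineFun a b d (m q) q := fun q => (hm q).iInf_eq
  -- With P isolated, the minimizer is unique and locally constant on a punctured neighbourhood,
  -- hence constant on horizontal segments just above P. The resulting midpoint identity passes to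
  -- the segment through P, where two minimizers with different first coefficients contradict it.
  have hmid : ∀ δ : ℝ, 0 < δ → δ < ε →
      f (P.1 - ε / 2, P.2 + δ) + f (P.1 + ε / 2, P.2 + δ) = 2 * f (P.1, P.2 + δ) := by
    intro δ hδ hδε
    let g : ℝ → ℝ × ℝ := fun s => (P.1 + s, P.2 + δ)
    have hg : Continuous g := by fun_prop
    have hpre : IsPreconnected (g '' Set.Icc (-(ε / 2)) (ε / 2)) :=
      isPreconnected_Icc.image g hg.continuousOn
    have hmem : ∀ q ∈ g '' Set.Icc (-(ε / 2)) (ε / 2), dist q P < ε ∧ q ≠ P := by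
      rintro _ ⟨s, hs, rfl⟩
      refine ⟨?_, fun h => ?_⟩
      · rw [Prod.dist_eq, max_lt_iff, Real.dist_eq, Real.dist_eq]
        simp only [g, add_sub_cancel_left]
        rw [abs_lt, abs_lt]
        exact ⟨⟨by linarith [hs.1], by linarith [hs.2]⟩, ⟨by linarith, hδε⟩⟩
      · have := congrArg Prod.snd h
        simp only [g] at this
        linarith
    -- For the discrete topology, local constancy is continuity, and a continuous map on a connected
    -- set is constant.
    let _ : TopologicalSpace ι := ⊥
    have : DiscreteTopology ι := ⟨rfl⟩
    have hcont : ContinuousOn m (g '' Set.Icc (-(ε / 2)) (ε / 2)) := by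
      intro q hq
      obtain ⟨h3, h4⟩ := hmem q hq
      refine ContinuousAt.continuousWithinAt ?_
      have : ∀ᶠ q' in 𝓝 q, m q = m q' := by
        filter_upwards [(hm q).eventually_unique fun j hj => huniq q h3 h4 _ _ hj (hm q)] with q' hq'
        exact (hq'.2 _ (hm q')).symm
      exact continuousAt_const.congr this
    have hconst : ∀ s ∈ Set.Icc (-(ε / 2)) (ε / 2), m (g s) = m (g 0) := fun s hs =>
      hpre.constant hcont ⟨s, hs, rfl⟩ ⟨0, ⟨by linarith, by linarith⟩, rfl⟩
    have e1 := hfm (g (-(ε / 2)))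
    have e2 := hfm (g (ε / 2))
    have e3 := hfm (g 0)
    rw [hconst _ ⟨le_rfl, by linarith⟩] at e1
    rw [hconst _ ⟨by linarith, le_rfl⟩] at e2
    simp only [g, add_zero, ← sub_eq_add_neg] at e1 e2 e3
    rw [e1, e2, e3]
    simp only [affineFun]
    ring
  have hlim : f (P.1 - ε / 2, P.2) + f (P.1 + ε / 2, P.2) = 2 * f (P.1, P.2) := by
    have hfc : Continuous f := continuous_iInf_affineFun
    have c1 : Continuous fun δ : ℝ => f (P.1 - ε / 2, P.2 + δ) + f (P.1 + ε / 2, P.2 + δ) := by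
      fun_prop
    have c2 : Continuous fun δ : ℝ => 2 * f (P.1, P.2 + δ) := by fun_prop
    have t1 := (c1.tendsto 0).mono_left (nhdsWithin_le_nhds (s := Set.Ioi 0))
    have t2 := (c2.tendsto 0).mono_left (nhdsWithin_le_nhds (s := Set.Ioi 0))
    have heq : (fun δ : ℝ => f (P.1 - ε / 2, P.2 + δ) + f (P.1 + ε / 2, P.2 + δ)) =ᶠ[𝓝[>] 0]
        fun δ : ℝ => 2 * f (P.1, P.2 + δ) := by
      filter_upwards [Ioo_mem_nhdsGT hε] with δ hδ using hmid δ hδ.1 hδ.2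
    have := tendsto_nhds_unique (t1.congr' heq) t2
    simpa using this
  obtain ⟨i, j, hij, hi, hj⟩ := (mem_nonlinearLocus_iff ha P).1 hP
  have hle : ∀ (l : ι) (q : ℝ × ℝ), f q ≤ affineFun a b d l q := fun l q =>
    ciInf_le (Set.finite_range _).bddBelow l
  have e1 : f P = affineFun a b d i P := hi.iInf_eq
  have e2 : f P = affineFun a b d j P := hj.iInf_eq
  have i1 := hle i (P.1 - ε / 2, P.2)
  have i2 := hle i (P.1 + ε / 2, P.2)
  have j1 := hle j (P.1 - ε / 2, P.2)
  have j2 := hle j (P.1 + ε / 2, P.2)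
  have hne := fun h => hij (ha h)
  simp only [affineFun, Prod.mk.eta] at e1 e2 i1 i2 j1 j2 hlim
  rcases lt_or_gt_of_ne hne with h | h <;> nlinarith

end Locus


/-! ### The lines `φ_i = φ_j` -/

section Lines

variable {n : ℕ} {κ : Fin n → ℝ}

/-- The line `φ_i = φ_j`, parametrized so that `φ_x - φ_i` is the product of `κ_x - κ_i`, `κ_x - κ_j`
and `κ_x - r`. -/
def linePoint (κ : Fin n → ℝ) (i j : Fin n) (r : ℝ) : ℝ × ℝ :=
  (κ i * κ j + (κ i + κ j) * r, -(κ i + κ j + r))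

/-- At a fixed point of the plane φ_x is a monic cubic in κ_x without constant term. By Vieta, the
coordinates of the point are the elementary symmetric functions of the three solutions κ_i, κ_j, r
of φ = κ_i κ_j r, up to sign. -/
theorem phi_linePoint (x i j : Fin n) (r : ℝ) : phi κ x (linePoint κ i j r) =
    (κ x - κ i) * (κ x - κ j) * (κ x - r) + κ i * κ j * r := by
  simp only [phi, linePoint]; ring

theorem linePoint_apply (i j m : Fin n) : linePoint κ i j (κ m) = vPoint κ i j m := by
  simp only [linePoint, vPoint]; ext <;> simp; ring

theorem exists_linePoint {i j : Fin n} (h : κ i ≠ κ j) {P : ℝ × ℝ} (hP : phi κ i P = phi κ j P) :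
    P = linePoint κ i j (-P.2 - κ i - κ j) := by
  have h1 : (κ i - κ j) * (P.1 + (κ i + κ j) * P.2 + (κ i ^ 2 + κ i * κ j + κ j ^ 2)) = 0 := by
    simp only [phi] at hP; linear_combination hP
  have h2 := (mul_eq_zero.1 h1).resolve_left (sub_ne_zero.2 h)
  ext
  · simp only [linePoint]; linear_combination h2
  · simp only [linePoint]; ring

/-- The part of the line `φ_i = φ_j` with parameters in `R`. -/
def linePart (κ : Fin n → ℝ) (i j : Fin n) (R : Set ℝ) : Set (ℝ × ℝ) :=
  {P | phi κ i P = phi κ j P ∧ -P.2 - κ i - κ j ∈ R}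

theorem linePart_eq_image {i j : Fin n} (h : κ i ≠ κ j) (R : Set ℝ) :
    linePart κ i j R = linePoint κ i j '' R := by
  ext P
  constructor
  · rintro ⟨h1, h2⟩
    exact ⟨_, h2, (exists_linePoint h h1).symm⟩
  · rintro ⟨r, hr, rfl⟩
    refine ⟨by simp [phi_linePoint], ?_⟩
    convert hr using 1
    simp only [linePoint]; ring

theorem isClosed_linePart (i j : Fin n) {R : Set ℝ} (hR : IsClosed R) :
    IsClosed (linePart κ i j R) := by
  have h1 : Continuous (phi κ i) := by unfold phi; fun_prop
  have h2 : Continuous (phi κ j) := by unfold phi; fun_prop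
  have h3 : Continuous fun P : ℝ × ℝ => -P.2 - κ i - κ j := by fun_prop
  exact (isClosed_eq h1 h2).inter (hR.preimage h3)

theorem exists_cut (hκ : StrictMono κ) (r : ℝ) : ∃ a : ℕ, ∀ x : Fin n, (x : ℕ) < a ↔ κ x < r := by
  classical
  by_cases h : ∃ m, ∃ hm : m < n, r ≤ κ ⟨m, hm⟩
  · refine ⟨Nat.find h, fun x => ⟨fun hx => ?_, fun hx => ?_⟩⟩
    · by_contra hr
      exact Nat.find_min h hx ⟨x.2, not_lt.1 hr⟩
    · obtain ⟨hm, hr⟩ := Nat.find_spec h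
      exact hκ.lt_iff_lt.1 (hx.trans_le hr)
  · push Not at h
    exact ⟨n, fun x => iff_of_true x.2 (h x x.2)⟩

end Lines

/-! ### The pieces of the contour plot in the blank boxes -/

section Pieces

variable {n : ℕ} {I : Finset (Fin n)} {D : Box I → Stone} (κ : Fin n → ℝ)

namespace Blank

/-- The parameters of the piece to the west of a blank box. -/
def westRange (b : Blank D) : Set ℝ := {r | κ b.1.2 ≤ r ∧ ∀ h, r ≤ κ (b.nextWest h).1.2}

/-- The parameters of the piece inside a blank box. -/
def midRange (b : Blank D) : Set ℝ := Set.Icc (κ b.pipeNorth) (κ b.pipeWest)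

/-- The parameters of the piece to the north of a blank box. -/
def northRange (b : Blank D) : Set ℝ := {r | r ≤ κ b.1.1 ∧ ∀ h, κ (b.nextNorth h).1.1 ≤ r}

/-- The piece of the contour plot to the west of a blank box. -/
def westPart (b : Blank D) : Set (ℝ × ℝ) := linePart κ b.1.1 b.pipeWest (b.westRange κ)

/-- The piece of the contour plot inside a blank box. -/
def midPart (b : Blank D) : Set (ℝ × ℝ) := linePart κ b.1.1 b.1.2 (b.midRange κ)

/-- The piece of the contour plot to the north of a blank box. -/
def northPart (b : Blank D) : Set (ℝ × ℝ) := linePart κ b.pipeNorth b.1.2 (b.northRange κ)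

variable {κ}

theorem westRange_of_not {b : Blank D} (h : ¬ b.westOf.Nonempty) :
    b.westRange κ = Set.Ici (κ b.1.2) := by
  ext r; simp [westRange, h]

theorem westRange_of {b : Blank D} (h : b.westOf.Nonempty) :
    b.westRange κ = Set.Icc (κ b.1.2) (κ (b.nextWest h).1.2) := by
  ext r; simp [westRange, h]

theorem northRange_of_not {b : Blank D} (h : ¬ b.northOf.Nonempty) :
    b.northRange κ = Set.Iic (κ b.1.1) := by
  ext r; simp [northRange, h]

theorem northRange_of {b : Blank D} (h : b.northOf.Nonempty) :
    b.northRange κ = Set.Icc (κ (b.nextNorth h).1.1) (κ b.1.1) := by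
  ext r; simp [northRange, h, and_comm]

theorem isClosed_westRange (b : Blank D) : IsClosed (b.westRange κ) := by
  by_cases h : b.westOf.Nonempty
  · rw [westRange_of h]; exact isClosed_Icc
  · rw [westRange_of_not h]; exact isClosed_Ici

theorem isClosed_northRange (b : Blank D) : IsClosed (b.northRange κ) := by
  by_cases h : b.northOf.Nonempty
  · rw [northRange_of h]; exact isClosed_Icc
  · rw [northRange_of_not h]; exact isClosed_Iic

theorem closure_interior_westRange (hκ : StrictMono κ) (b : Blank D) :
    closure (interior (b.westRange κ)) = b.westRange κ := by
  by_cases h : b.westOf.Nonempty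
  · rw [westRange_of h, closure_interior_Icc (hκ (b.nextWest_lt h)).ne]
  · rw [westRange_of_not h, interior_Ici, closure_Ioi]

theorem closure_interior_northRange (hκ : StrictMono κ) (b : Blank D) :
    closure (interior (b.northRange κ)) = b.northRange κ := by
  by_cases h : b.northOf.Nonempty
  · rw [northRange_of h, closure_interior_Icc (hκ (b.nextNorth_lt h)).ne]
  · rw [northRange_of_not h, interior_Iic, closure_Iio]

end Blank

variable {κ}

/-- The exchange condition at a point of the line `φ_i = φ_j` that lies on no other of these
lines. -/
theorem isExchange_iff {k : ℕ} {e : List (Box I)} (hI : I.card = k) (he : IsReadingOrder e)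
    (hD : IsGoDiagram e D) (hκ : StrictMono κ) {A : Matrix (Fin k) (Fin n) ℝ}
    (hA : A ∈ deodharComponent k e D) {i j : Fin n} (hij : i < j) {r : ℝ} (hr : r ∉ Set.range κ) :
    IsExchange A {x | phi κ x (linePoint κ i j r) < phi κ i (linePoint κ i j r)} i j ↔
      ∃ b : Blank D, (b.1.1 = i ∧ b.pipeWest = j ∧ r ∈ b.westRange κ) ∨
        (b.1.1 = i ∧ b.1.2 = j ∧ r ∈ b.midRange κ) ∨
        (b.1.2 = j ∧ b.pipeNorth = i ∧ r ∈ b.northRange κ) := by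
  obtain ⟨p, q, hp, hspan⟩ := exists_lineVec_of_mem_deodharComponent hI he hA
  obtain ⟨a, ha⟩ := exists_cut hκ r
  have hrank : ∀ (S : Set (Fin n)) (a' s t : ℕ), a' ≤ s →
      (∀ y, y ∈ S ↔ (y : ℕ) < a' ∨ s ≤ (y : ℕ) ∧ (y : ℕ) < t) →
      colRank A S = intervalRank D e a' s t := fun S a' s t h hS => by
    rw [colRank_eq, hspan, finrank_map_coordProj hp he hD h hS, intervalRank]
  have hlt : ∀ x, κ x < r ↔ (x : ℕ) < a := fun x => (ha x).symm
  have hge : ∀ x, r ≤ κ x ↔ a ≤ (x : ℕ) := fun x => by rw [← not_lt, hlt, not_lt]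
  have hle : ∀ x, κ x ≤ r ↔ (x : ℕ) < a := fun x => by
    rw [← hlt]; exact ⟨fun h => lt_of_le_of_ne h fun h' => hr ⟨x, h'⟩, le_of_lt⟩
  -- The sign of the product of three factors: x is lighter than i when it lies below all of i, j
  -- and the cut `a`, or above exactly two of them.
  have hmem : ∀ x, x ∈ {x | phi κ x (linePoint κ i j r) < phi κ i (linePoint κ i j r)} ↔
      (x < i ∧ (x < j ∧ (x : ℕ) < a ∨ j < x ∧ a ≤ (x : ℕ))) ∨
        (i < x ∧ (x < j ∧ a ≤ (x : ℕ) ∨ j < x ∧ (x : ℕ) < a)) := by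
    intro x
    have hrx : κ x ≠ r := fun h => hr ⟨x, h⟩
    rw [Set.mem_ofPred_eq, phi_linePoint, phi_linePoint, sub_self, zero_mul, zero_mul, zero_add,
      add_lt_iff_neg_right, mul_assoc, mul_neg_iff, mul_neg_iff, mul_pos_iff]
    simp only [sub_pos, sub_neg, hκ.lt_iff_lt, hlt, ← hge]
    have : r < κ x ↔ r ≤ κ x := ⟨le_of_lt, fun h => lt_of_le_of_ne h (Ne.symm hrx)⟩
    rw [this]
    tauto
  simp only [Blank.westRange, Blank.midRange, Blank.northRange, Set.mem_ofPred_eq, Set.mem_Icc, hge,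
    hle]
  obtain ⟨S, hS⟩ : ∃ S, S = {x | phi κ x (linePoint κ i j r) < phi κ i (linePoint κ i j r)} :=
    ⟨_, rfl⟩
  rw [← hS] at hmem ⊢
  have hij' : (i : ℕ) < j := hij
  simp only [Fin.lt_def] at hmem
  have hins : ∀ (c y : Fin n) (T : Set (Fin n)), y ∈ insert c T ↔ (y : ℕ) = c ∨ y ∈ T := fun c y T => by
    rw [Set.mem_insert_iff, Fin.ext_iff]
  unfold IsExchange
  -- For r above κ_j, below κ_i or in between, only a west, north or middle piece respectively can
  -- occur; the bounds on the pipe labels exclude the other two.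
  by_cases h1 : (j : ℕ) < a
  · rw [hrank S i (j + 1) a (by omega) fun y => by rw [hmem]; omega,
      hrank (insert i S) (i + 1) (j + 1) a (by omega) fun y => by rw [hins, hmem]; omega,
      hrank (insert j S) i j a (by omega) fun y => by rw [hins, hmem]; omega,
      hrank (insert i (insert j S)) (i + 1) j a (by omega) fun y => by rw [hins, hins, hmem]; omega,
      exchange_high_iff he hij h1]
    constructor
    · rintro ⟨b, h⟩
      exact ⟨b, Or.inl h⟩
    · rintro ⟨b, h | ⟨-, rfl, -, h⟩ | ⟨rfl, rfl, h, -⟩⟩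
      · exact ⟨b, h⟩
      · have : (b.pipeWest : ℕ) ≤ b.1.2 := b.pipeWest_le_col
        omega
      · have : (b.1.1 : ℕ) < b.1.2 := b.row_lt_col
        omega
  by_cases h2 : a ≤ (i : ℕ)
  · rw [hrank S a (i + 1) j (by omega) fun y => by rw [hmem]; omega,
      hrank (insert i S) a i j (by omega) fun y => by rw [hins, hmem]; omega,
      hrank (insert j S) a (i + 1) (j + 1) (by omega) fun y => by rw [hins, hmem]; omega,
      hrank (insert i (insert j S)) a i (j + 1) (by omega) fun y => by rw [hins, hins, hmem]; omega,
      exchange_low_iff he hij h2]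
    constructor
    · rintro ⟨b, h⟩
      exact ⟨b, Or.inr (Or.inr h)⟩
    · rintro ⟨b, ⟨rfl, rfl, h, -⟩ | ⟨rfl, -, h, -⟩ | h⟩
      · have : (b.1.1 : ℕ) < b.1.2 := b.row_lt_col
        omega
      · have : (b.1.1 : ℕ) ≤ b.pipeNorth := b.row_le_pipeNorth
        omega
      · exact ⟨b, h⟩
  · rw [hrank S i a j (by omega) fun y => by rw [hmem]; omega,
      hrank (insert i S) (i + 1) a j (by omega) fun y => by rw [hins, hmem]; omega,
      hrank (insert j S) i a (j + 1) (by omega) fun y => by rw [hins, hmem]; omega,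
      hrank (insert i (insert j S)) (i + 1) a (j + 1) (by omega) fun y => by rw [hins, hins, hmem]; omega,
      exchange_middle_iff he (by omega) (by omega)]
    constructor
    · rintro ⟨b, h⟩
      exact ⟨b, Or.inr (Or.inl h)⟩
    · rintro ⟨b, ⟨rfl, rfl, h, -⟩ | h | ⟨rfl, rfl, h, -⟩⟩
      · have : (b.pipeWest : ℕ) ≤ b.1.2 := b.pipeWest_le_col
        omega
      · exact ⟨b, h⟩
      · have : (b.1.1 : ℕ) ≤ b.pipeNorth := b.row_le_pipeNorth
        omega

end Pieces

/-! ### The contour plot is the union of the pieces -/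

section Plot

variable {n k : ℕ} {I : Finset (Fin n)} {D : Box I → Stone} {κ : Fin n → ℝ}

/-- Genericity covers 1 < p < n. For p = 0 and p = n there is only one subset, and for p = 1
monotonicity suffices. -/
theorem GenericParameters.sum_injOn (hκ : GenericParameters κ) {J J' : Finset (Fin n)}
    (hc : J.card = J'.card) (h : ∑ x ∈ J, κ x = ∑ x ∈ J', κ x) : J = J' := by
  rcases lt_or_ge 1 J.card with h1 | h1
  · by_cases h2 : J.card < n
    · exact hκ.2 _ h1 h2 J J' rfl hc.symm h
    · have hu : ∀ K : Finset (Fin n), K.card = J.card → K = Finset.univ := fun K hK =>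
        (Finset.card_eq_iff_eq_univ K).1
          (le_antisymm K.card_le_univ (by rw [hK, Fintype.card_fin]; omega))
      rw [hu J rfl, hu J' hc.symm]
  · interval_cases hJ : J.card
    · rw [Finset.card_eq_zero.1 hJ, Finset.card_eq_zero.1 hc.symm]
    · obtain ⟨x, rfl⟩ := Finset.card_eq_one.1 hJ
      obtain ⟨y, rfl⟩ := Finset.card_eq_one.1 hc.symm
      simp only [Finset.sum_singleton] at h
      rw [hκ.1.injective h]

/-- The sum of the `φ_j` over `j ∈ J` is an affine function. -/
theorem sum_phi_eq {ι : Type*} (s : ι → Finset (Fin n)) (J : ι) (P : ℝ × ℝ) :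
    ∑ x ∈ s J, phi κ x P = affineFun (fun J => ∑ x ∈ s J, κ x) (fun J => ∑ x ∈ s J, κ x ^ 2)
      (fun J => ∑ x ∈ s J, κ x ^ 3) J P := by
  simp only [affineFun, phi, Finset.sum_add_distrib, Finset.sum_mul]

theorem nonempty_isBase (M : Matroid (Fin n)) :
    Nonempty {J : Finset (Fin n) // M.IsBase (J : Set (Fin n))} := by
  classical
  obtain ⟨B, hB⟩ := M.exists_isBase
  exact ⟨⟨B.toFinset, by simpa using hB⟩⟩

/-- These sums are the first coefficients of the affine functions, and their injectivity is what
`mem_nonlinearLocus_iff` requires. -/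
theorem injective_sum_of_mem_stratum (hκ : GenericParameters κ) {M : Matroid (Fin n)}
    {A : Matrix (Fin k) (Fin n) ℝ} (hA : A ∈ matroidStratum k M) : Function.Injective
      fun J : {J : Finset (Fin n) // M.IsBase (J : Set (Fin n))} => ∑ x ∈ J.1, κ x := by
  intro J J' h
  obtain ⟨h1, -⟩ := (hA J.1).1 J.2
  obtain ⟨h2, -⟩ := (hA J'.1).1 J'.2
  exact Subtype.ext (hκ.sum_injOn (h1.trans h2.symm) h)

theorem mem_contourPlotNegInfinity_iff (hκ : GenericParameters κ) {M : Matroid (Fin n)}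
    {A : Matrix (Fin k) (Fin n) ℝ} (hA : A ∈ matroidStratum k M) (P : ℝ × ℝ) :
    P ∈ contourPlotNegInfinity κ M ↔
      ∃ J J', J ≠ J' ∧ IsMinBasis A (fun x => phi κ x P) J ∧
        IsMinBasis A (fun x => phi κ x P) J' := by
  have := nonempty_isBase M
  unfold contourPlotNegInfinity
  simp only [sum_phi_eq (fun J : {J : Finset (Fin n) // M.IsBase (J : Set (Fin n))} => J.1)]
  rw [mem_nonlinearLocus_iff (injective_sum_of_mem_stratum hκ hA)]
  simp only [IsMinAt, ← sum_phi_eq (fun J : {J : Finset (Fin n) // M.IsBase (J : Set (Fin n))} => J.1)]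
  constructor
  · rintro ⟨J, J', hne, h1, h2⟩
    exact ⟨J.1, J'.1, fun h => hne (Subtype.ext h),
      ⟨(hA _).1 J.2, fun K hK => h1 ⟨K, (hA K).2 hK⟩⟩,
      ⟨(hA _).1 J'.2, fun K hK => h2 ⟨K, (hA K).2 hK⟩⟩⟩
  · rintro ⟨J, J', hne, h1, h2⟩
    exact ⟨⟨J, (hA J).2 h1.1⟩, ⟨J', (hA J').2 h2.1⟩, fun h => hne (congrArg Subtype.val h),
      fun K => h1.2 K.1 ((hA _).1 K.2), fun K => h2.2 K.1 ((hA _).1 K.2)⟩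

theorem mem_closure_contourPlotNegInfinity_diff (hκ : GenericParameters κ) {M : Matroid (Fin n)}
    {A : Matrix (Fin k) (Fin n) ℝ} (hA : A ∈ matroidStratum k M) {F : Set (ℝ × ℝ)}
    (hF : F.Finite) {P : ℝ × ℝ} (hP : P ∈ contourPlotNegInfinity κ M) :
    P ∈ closure (contourPlotNegInfinity κ M \ F) := by
  have := nonempty_isBase M
  unfold contourPlotNegInfinity at hP ⊢
  simp only [sum_phi_eq (fun J : {J : Finset (Fin n) // M.IsBase (J : Set (Fin n))} => J.1)] at hP ⊢
  exact mem_closure_nonlinearLocus_diff (injective_sum_of_mem_stratum hκ hA) hF hP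

theorem exists_isMinBasis {M : Matroid (Fin n)} {A : Matrix (Fin k) (Fin n) ℝ}
    (hA : A ∈ matroidStratum k M) (w : Fin n → ℝ) : ∃ J, IsMinBasis A w J := by
  have := nonempty_isBase M
  obtain ⟨J, hJ⟩ := Finite.exists_min
    fun J : {J : Finset (Fin n) // M.IsBase (J : Set (Fin n))} => ∑ x ∈ J.1, w x
  exact ⟨J.1, (hA _).1 J.2, fun K hK => hJ ⟨K, (hA K).2 hK⟩⟩

/-- A point of a line `φ_i = φ_j` at which the exchange condition holds lies on the contour plot. -/
theorem mem_contourPlotNegInfinity_of_isExchange (hκ : GenericParameters κ) {M : Matroid (Fin n)}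
    {A : Matrix (Fin k) (Fin n) ℝ} (hA : A ∈ matroidStratum k M) {i j : Fin n} (hij : i ≠ j) {r : ℝ}
    (hr : r ∉ Set.range κ)
    (h : IsExchange A {x | phi κ x (linePoint κ i j r) < phi κ i (linePoint κ i j r)} i j) :
    linePoint κ i j r ∈ contourPlotNegInfinity κ M := by
  have hw : phi κ i (linePoint κ i j r) = phi κ j (linePoint κ i j r) := by simp [phi_linePoint]
  rw [mem_contourPlotNegInfinity_iff hκ hA]
  obtain ⟨S, hS⟩ : ∃ S, S = {x | phi κ x (linePoint κ i j r) < phi κ i (linePoint κ i j r)} :=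
    ⟨_, rfl⟩
  rw [← hS] at h
  have hlow : IsLower (fun x => phi κ x (linePoint κ i j r)) S := by
    intro x hx y hy
    rw [hS] at hx hy
    exact lt_of_lt_of_le hx (not_lt.1 hy)
  -- As r is none of the κ, no third weight equals that of i and j.
  have hlow' : IsLower (fun x => phi κ x (linePoint κ i j r)) (insert i (insert j S)) := by
    intro x hx y hy
    simp only [hS, Set.mem_insert_iff, Set.mem_ofPred_eq, not_or, not_lt] at hx hy
    have h1 : phi κ x (linePoint κ i j r) ≤ phi κ i (linePoint κ i j r) := by
      rcases hx with rfl | rfl | hx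
      · exact le_rfl
      · exact hw.ge
      · exact hx.le
    refine h1.trans_lt (lt_of_le_of_ne hy.2.2 fun h2 => ?_)
    simp only [phi_linePoint, sub_self, zero_mul, zero_add, right_eq_add, mul_eq_zero,
      sub_eq_zero, hκ.1.injective.eq_iff] at h2
    rcases h2 with (h2 | h2) | h2
    · exact hy.1 h2
    · exact hy.2.1 h2
    · exact hr ⟨y, h2⟩
  obtain ⟨J, hJ⟩ := exists_isMinBasis hA fun x => phi κ x (linePoint κ i j r)
  obtain ⟨J', hne, hJ'⟩ := hJ.exists_ne hij hlow hlow' hw (by simp [hS]) (by simp [hS, hw]) h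
  exact ⟨J, J', hne.symm, hJ, hJ'⟩

/-- A part of a line with the exchange condition at its generic points lies on the contour plot. -/
theorem linePart_subset_contourPlotNegInfinity (hκ : GenericParameters κ) {M : Matroid (Fin n)}
    {A : Matrix (Fin k) (Fin n) ℝ} (hA : A ∈ matroidStratum k M) {i j : Fin n} (hij : i ≠ j)
    {R : Set ℝ} (hR : R ⊆ closure (interior R))
    (h : ∀ r ∈ R, r ∉ Set.range κ →
      IsExchange A {x | phi κ x (linePoint κ i j r) < phi κ i (linePoint κ i j r)} i j) :
    linePart κ i j R ⊆ contourPlotNegInfinity κ M := by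
  rw [linePart_eq_image (hκ.1.injective.ne hij)]
  -- The excluded parameters are finite in number, hence negligible in the interior of `R`; the plot
  -- is closed.
  have hd : Dense (Set.range κ)ᶜ := (Set.finite_range κ).countable.dense_compl ℝ
  have h1 : R ⊆ closure (interior R ∩ (Set.range κ)ᶜ) :=
    hR.trans (closure_minimal (hd.open_subset_closure_inter isOpen_interior) isClosed_closure)
  have h2 : Continuous (linePoint κ i j) := by unfold linePoint; fun_prop
  refine (Set.image_mono h1).trans ((image_closure_subset_closure_image h2).trans
    (closure_minimal ?_ (isClosed_nonlinearLocus _)))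
  rintro _ ⟨r, ⟨hr, hr'⟩, rfl⟩
  exact mem_contourPlotNegInfinity_of_isExchange hκ hA hij hr' (h r (interior_subset hr) hr')

/-- The contour plot is the union of the pieces in the blank boxes. -/
theorem contourPlotNegInfinity_eq {e : List (Box I)} (hI : I.card = k) (he : IsReadingOrder e)
    (hD : IsGoDiagram e D) (hκ : GenericParameters κ) {M : Matroid (Fin n)}
    (hM : (matroidStratum k M ∩ deodharComponent k e D).Nonempty) :
    contourPlotNegInfinity κ M =
      ⋃ b : Blank D, b.westPart κ ∪ b.midPart κ ∪ b.northPart κ := by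
  obtain ⟨A, hAM, hAD⟩ := hM
  have hiff := fun {i j : Fin n} (hij : i < j) {r : ℝ} (hr : r ∉ Set.range κ) =>
    isExchange_iff hI he hD hκ.1 hAD hij hr
  apply Set.Subset.antisymm
  -- `F` is finite and contains all points where three φ agree. The plot lies in the closure of its
  -- part off `F`, and the union of the pieces is closed, so those points may be ignored.
  · set F : Set (ℝ × ℝ) := Set.range fun t : Fin n × Fin n × Fin n => vPoint κ t.1 t.2.1 t.2.2 with hF
    have hcl : IsClosed (⋃ b : Blank D, b.westPart κ ∪ b.midPart κ ∪ b.northPart κ) :=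
      isClosed_iUnion_of_finite fun b =>
        ((isClosed_linePart _ _ b.isClosed_westRange).union
          (isClosed_linePart _ _ isClosed_Icc)).union (isClosed_linePart _ _ b.isClosed_northRange)
    intro P hP
    refine closure_minimal ?_ hcl
      (mem_closure_contourPlotNegInfinity_diff hκ hAM (Set.finite_range _ : F.Finite) hP)
    rintro P ⟨hP, hPF⟩
    obtain ⟨J, J', hne, hJ, hJ'⟩ := (mem_contourPlotNegInfinity_iff hκ hAM P).1 hP
    obtain ⟨i, j, hij, hw, hex⟩ := exists_isExchange hJ hJ' hne (by
      intro x y z hxy hxz hyz h1 h2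
      have hx := exists_linePoint (hκ.1.injective.ne hxy) h1
      rw [hx] at h2
      simp only [phi_linePoint, sub_self, zero_mul, zero_add, right_eq_add, mul_eq_zero,
        sub_eq_zero, hκ.1.injective.eq_iff] at h2
      rcases h2 with (h2 | h2) | h2
      · exact hxz h2.symm
      · exact hyz h2.symm
      · exact hPF ⟨(x, y, z), by rw [hx, ← h2, linePoint_apply]⟩)
    obtain ⟨r, rfl⟩ : ∃ r, P = linePoint κ i j r :=
      ⟨_, exists_linePoint (hκ.1.injective.ne hij.ne) hw⟩
    have hr : r ∉ Set.range κ := by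
      rintro ⟨m, rfl⟩
      exact hPF ⟨(i, j, m), (linePoint_apply i j m).symm⟩
    obtain ⟨b, h⟩ := (hiff hij hr).1 hex
    refine Set.mem_iUnion.2 ⟨b, ?_⟩
    rcases h with ⟨rfl, rfl, h⟩ | ⟨rfl, rfl, h⟩ | ⟨rfl, rfl, h⟩
    · exact Or.inl (Or.inl (by
        rw [Blank.westPart, linePart_eq_image (hκ.1.injective.ne hij.ne)]; exact ⟨r, h, rfl⟩))
    · exact Or.inl (Or.inr (by
        rw [Blank.midPart, linePart_eq_image (hκ.1.injective.ne hij.ne)]; exact ⟨r, h, rfl⟩))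
    · exact Or.inr (by
        rw [Blank.northPart, linePart_eq_image (hκ.1.injective.ne hij.ne)]; exact ⟨r, h, rfl⟩)
  · refine Set.iUnion_subset fun b => Set.union_subset (Set.union_subset ?_ ?_) ?_
    · have hlt := b.row_lt_pipeWest
      exact linePart_subset_contourPlotNegInfinity hκ hAM hlt.ne
        (b.closure_interior_westRange hκ.1).ge
        fun r hr hr' => (hiff hlt hr').2 ⟨b, Or.inl ⟨rfl, rfl, hr⟩⟩
    -- By the Go condition the middle interval is nondegenerate, hence the closure of its interior.
    · exact linePart_subset_contourPlotNegInfinity hκ hAM b.row_lt_col.ne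
        (closure_interior_Icc (hκ.1 (b.pipeNorth_lt_pipeWest he hD)).ne).ge
        fun r hr hr' => (hiff b.row_lt_col hr').2 ⟨b, Or.inr (Or.inl ⟨rfl, rfl, hr⟩)⟩
    · have hlt := b.pipeNorth_lt_col
      exact linePart_subset_contourPlotNegInfinity hκ hAM hlt.ne
        (b.closure_interior_northRange hκ.1).ge
        fun r hr hr' => (hiff hlt hr').2 ⟨b, Or.inr (Or.inr ⟨rfl, rfl, hr⟩)⟩

end Plot


/-! ### Vertices and edges of the graph in the plane -/

section Realization

variable {n : ℕ} {I : Finset (Fin n)} {D : Box I → Stone} {κ : Fin n → ℝ}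

theorem vPoint_swap_right (i l m : Fin n) : vPoint κ i l m = vPoint κ i m l := by
  simp only [vPoint]; ext <;> simp <;> ring

theorem vPoint_swap_left (i l m : Fin n) : vPoint κ i l m = vPoint κ l i m := by
  simp only [vPoint]; ext <;> simp <;> ring

/-- The second coordinate, minus a sum of three distinct parameters, already determines the triple.
-/
theorem vPoint_injective (hκ : GenericParameters κ) {i l m i' l' m' : Fin n} (h₁ : i < l)
    (h₂ : l < m) (h₁' : i' < l') (h₂' : l' < m') (h : vPoint κ i l m = vPoint κ i' l' m') :
    i = i' ∧ l = l' ∧ m = m' := by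
  have hsum : ∀ {i l m : Fin n}, i < l → l < m →
      ({i, l, m} : Finset (Fin n)).card = 3 ∧
        ∑ x ∈ ({i, l, m} : Finset (Fin n)), κ x = κ i + κ l + κ m := by
    intro i l m h₁ h₂
    have h3 : i ∉ ({l, m} : Finset (Fin n)) := by simp [h₁.ne, (h₁.trans h₂).ne]
    have h4 : l ∉ ({m} : Finset (Fin n)) := by simp [h₂.ne]
    rw [Finset.card_insert_of_notMem h3, Finset.card_insert_of_notMem h4, Finset.sum_insert h3,
      Finset.sum_insert h4, Finset.sum_singleton, Finset.card_singleton]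
    exact ⟨rfl, (add_assoc _ _ _).symm⟩
  have h5 := congrArg Prod.snd h
  simp only [vPoint, neg_inj] at h5
  have h6 : ({i, l, m} : Finset (Fin n)) = {i', l', m'} :=
    hκ.sum_injOn ((hsum h₁ h₂).1.trans (hsum h₁' h₂').1.symm)
      ((hsum h₁ h₂).2.trans (h5.trans (hsum h₁' h₂').2.symm))
  have h7 : ∀ x, (x = i ∨ x = l ∨ x = m) ↔ (x = i' ∨ x = l' ∨ x = m') := fun x => by
    simpa using Finset.ext_iff.1 h6 x
  have a1 := (h7 i).1 (by simp)
  have a2 := (h7 l).1 (by simp)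
  have a3 := (h7 m).1 (by simp)
  simp only [Fin.lt_def, Fin.ext_iff] at *
  omega

theorem pair_eq_of_lt {α : Type*} [LinearOrder α] {i j i' j' : α} (h : i < j) (h' : i' < j')
    (he : ({i, j} : Set α) = {i', j'}) : i = i' ∧ j = j' := by
  rcases Set.pair_eq_pair_iff.1 he with h1 | ⟨rfl, rfl⟩
  · exact h1
  · exact absurd h (not_lt.2 h'.le)

/-- The places of the vertices of the graph in the plane. -/
noncomputable def vertexPos (κ : Fin n → ℝ) : WhiteVert D ⊕ BlackVert D → ℝ × ℝ :=
  Sum.elim (fun b => vPoint κ b.1.1.1 b.1.pipeNorth b.1.1.2)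
    (fun b => vPoint κ b.1.1.1 b.1.pipeWest b.1.1.2)

theorem Blank.row_lt_pipeNorth {b : Blank D} (h : b.eastOf.Nonempty) : b.1.1 < b.pipeNorth :=
  lt_of_le_of_ne b.row_le_pipeNorth fun h' => b.pipeNorth_eq_row_iff.1 h'.symm h

theorem Blank.pipeWest_lt_col {b : Blank D} (h : b.southOf.Nonempty) : b.pipeWest < b.1.2 :=
  lt_of_le_of_ne b.pipeWest_le_col fun h' => b.pipeWest_eq_col_iff.1 h' h

theorem hasVertexType_of_tripLabel (hbij : Function.Bijective (pipeAtEnd D))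
    {v : WhiteVert D ⊕ BlackVert D} {a b c : Fin 3} (hab : a ≠ b) (hac : a ≠ c) (hbc : b ≠ c)
    {i l m : Fin n}
    (ha : ({tripLabel (Sum.inl (v, a)), tripLabel (goRev (Sum.inl (v, a)))} : Set (Fin n)) = {i, l})
    (hb : ({tripLabel (Sum.inl (v, b)), tripLabel (goRev (Sum.inl (v, b)))} : Set (Fin n)) = {i, m})
    (hc : ({tripLabel (Sum.inl (v, c)), tripLabel (goRev (Sum.inl (v, c)))} : Set (Fin n)) =
      {l, m}) : (goMinus D).HasVertexType v i l m := by
  have hne : ∀ {x y : Fin 3}, x ≠ y → (Sum.inl (v, x) : GoDart D) ≠ Sum.inl (v, y) :=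
    fun hxy h => hxy (Prod.mk.inj (Sum.inl.inj h)).2
  have key : ∀ d : GoDart D, Sum.map Prod.fst Subtype.val d = (Sum.inl v : _ ⊕ Fin n) ↔
      d = Sum.inl (v, a) ∨ d = Sum.inl (v, b) ∨ d = Sum.inl (v, c) := by
    rintro (⟨v', x⟩ | x)
    · simp only [Sum.map_inl, Sum.inl.injEq, Prod.mk.injEq, ← and_or_left]
      exact (and_iff_left (by omega)).symm
    · simp
  exact ⟨_, _, _, hne hab, hne hac, hne hbc, Set.ext key, (edgeLabels_eq hbij _).trans ha,
    (edgeLabels_eq hbij _).trans hb, (edgeLabels_eq hbij _).trans hc⟩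

theorem exists_hasVertexType (hbij : Function.Bijective (pipeAtEnd D)) (v : (goMinus D).Vert) :
    ∃ i l m, i < l ∧ l < m ∧ (goMinus D).HasVertexType v i l m ∧
      vertexPos κ v = vPoint κ i l m := by
  obtain ⟨b, h⟩ | ⟨b, h⟩ := v
  · refine ⟨b.1.1, b.pipeNorth, b.1.2, Blank.row_lt_pipeNorth h, b.pipeNorth_lt_col,
      hasVertexType_of_tripLabel hbij (a := 2) (b := 1) (c := 0) (by decide) (by decide) (by decide)
        ?_ ?_ ?_, rfl⟩
    · rw [tripLabel_goRev_white, tripLabel_white, Set.pair_comm]; rfl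
    · rw [tripLabel_goRev_white, tripLabel_white]; rfl
    · rw [tripLabel_goRev_white, tripLabel_white, Set.pair_comm]; rfl
  · refine ⟨b.1.1, b.pipeWest, b.1.2, b.row_lt_pipeWest, Blank.pipeWest_lt_col h,
      hasVertexType_of_tripLabel hbij (a := 0) (b := 2) (c := 1) (by decide) (by decide) (by decide)
        ?_ ?_ ?_, rfl⟩
    · rw [tripLabel_goRev_black, tripLabel_black]; rfl
    · rw [tripLabel_goRev_black, tripLabel_black, Set.pair_comm]; rfl
    · rw [tripLabel_goRev_black, tripLabel_black]; rfl

/-- The outer labels of a vertex are the row and the column of its box, so equal points force equal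
boxes; the middle labels of the two vertices of a box differ by the Go condition. -/
theorem vertexPos_injective {e : List (Box I)} (he : IsReadingOrder e) (hD : IsGoDiagram e D)
    (hκ : GenericParameters κ) :
    Function.Injective (vertexPos κ : WhiteVert D ⊕ BlackVert D → ℝ × ℝ) := by
  rintro (⟨b, h⟩ | ⟨b, h⟩) (⟨b', h'⟩ | ⟨b', h'⟩) heq
  · obtain ⟨h1, -, h3⟩ := vPoint_injective hκ (Blank.row_lt_pipeNorth h) b.pipeNorth_lt_col
      (Blank.row_lt_pipeNorth h') b'.pipeNorth_lt_col heq
    obtain rfl := Blank.ext' h1 h3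
    rfl
  · obtain ⟨h1, h2, h3⟩ := vPoint_injective hκ (Blank.row_lt_pipeNorth h) b.pipeNorth_lt_col
      b'.row_lt_pipeWest (Blank.pipeWest_lt_col h') heq
    obtain rfl := Blank.ext' h1 h3
    exact absurd h2 (b.pipeNorth_lt_pipeWest he hD).ne
  · obtain ⟨h1, h2, h3⟩ := vPoint_injective hκ b.row_lt_pipeWest (Blank.pipeWest_lt_col h)
      (Blank.row_lt_pipeNorth h') b'.pipeNorth_lt_col heq
    obtain rfl := Blank.ext' h1 h3
    exact absurd h2.symm (b.pipeNorth_lt_pipeWest he hD).ne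
  · obtain ⟨h1, -, h3⟩ := vPoint_injective hκ b.row_lt_pipeWest (Blank.pipeWest_lt_col h)
      b'.row_lt_pipeWest (Blank.pipeWest_lt_col h') heq
    obtain rfl := Blank.ext' h1 h3
    rfl

-- Edges as parts of the lines φ_i = φ_j.

/-- The half-edge `d` is the end with the smaller parameters of an edge on the line `φ_i = φ_j`;
`L` consists of the parameters beyond this end. -/
def IsLowEnd (κ : Fin n → ℝ) (d : GoDart D) (i j : Fin n) (L : Set ℝ) : Prop :=
  (∃ v r, (goMinus D).tail d = Sum.inl v ∧ vertexPos κ v = linePoint κ i j r ∧ L = Set.Ici r) ∨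
    ∃ x ∉ I, (goMinus D).tail d = Sum.inr x ∧ L = Set.univ

/-- The half-edge `d` is the end with the larger parameters of an edge on the line `φ_i = φ_j`;
`U` consists of the parameters before this end. -/
def IsHighEnd (κ : Fin n → ℝ) (d : GoDart D) (i j : Fin n) (U : Set ℝ) : Prop :=
  (∃ v r, (goMinus D).tail d = Sum.inl v ∧ vertexPos κ v = linePoint κ i j r ∧ U = Set.Iic r) ∨
    ∃ x ∈ I, (goMinus D).tail d = Sum.inr x ∧ U = Set.univ

/-- The edge of the half-edge `d` is the part with parameters in `R` of the line `φ_i = φ_j`. -/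
def IsEdgeOn (κ : Fin n → ℝ) (d : GoDart D) (i j : Fin n) (R : Set ℝ) : Prop :=
  R.Nontrivial ∧ ∃ L U, IsLowEnd κ d i j L ∧ IsHighEnd κ (goRev d) i j U ∧ R = L ∩ U

theorem edgePiece_goRev (d : GoDart D) (i j : Fin n) (down : Fin n → Prop) :
    (goMinus D).edgePiece κ (vertexPos κ) down (goRev d) i j =
      (goMinus D).edgePiece κ (vertexPos κ) down d i j := by
  have h : (goMinus D).rev (goRev d) = d := goRev_goRev d
  have h' : (goMinus D).rev d = goRev d := rfl
  simp only [PlabicGraph.edgePiece, h, h']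
  rcases (goMinus D).tail d with v | x <;> rcases (goMinus D).tail (goRev d) with v' | x'
  · exact segment_symm _ _ _
  · rfl
  · rfl
  · rfl

theorem linePoint_sub (i j : Fin n) (r s : ℝ) : linePoint κ i j s - linePoint κ i j r =
    ((κ i + κ j) * (s - r), -(s - r)) := by
  simp only [linePoint]; ext <;> simp <;> ring

theorem segment_linePoint (i j : Fin n) {r s : ℝ} (h : r ≤ s) :
    segment ℝ (linePoint κ i j r) (linePoint κ i j s) = linePoint κ i j '' Set.Icc r s := by
  rw [← segment_eq_Icc h]
  let f : ℝ →ᵃ[ℝ] ℝ × ℝ :=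
    (AffineMap.mk' (linePoint κ i j) (LinearMap.toSpanSingleton ℝ (ℝ × ℝ) (κ i + κ j, -1)) 0
      fun r => by
        refine Prod.ext ?_ ?_
        · simp [linePoint]; ring
        · simp [linePoint])
  exact (image_segment ℝ f r s).symm

theorem ray_linePoint_up (i j : Fin n) (r : ℝ) {p : Prop} (hp : p) :
    PlabicGraph.ray (linePoint κ i j r) (κ i + κ j) p = linePoint κ i j '' Set.Ici r := by
  ext q
  constructor
  · rintro ⟨w, rfl, h1, h2, -⟩
    refine ⟨r - w.2, by have := h2 hp; simp only [Set.mem_Ici]; linarith, ?_⟩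
    ext
    · simp only [linePoint, Prod.fst_add, h1]; ring
    · simp only [linePoint, Prod.snd_add]; ring
  · rintro ⟨s, hs, rfl⟩
    have hs' : r ≤ s := hs
    refine ⟨linePoint κ i j s - linePoint κ i j r, by abel, ?_, fun _ => ?_, fun h => absurd hp h⟩
    · rw [linePoint_sub]; ring
    · rw [linePoint_sub]; simp only; linarith

theorem ray_linePoint_down (i j : Fin n) (r : ℝ) {p : Prop} (hp : ¬ p) :
    PlabicGraph.ray (linePoint κ i j r) (κ i + κ j) p = linePoint κ i j '' Set.Iic r := by
  ext q
  constructor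
  · rintro ⟨w, rfl, h1, -, h2⟩
    refine ⟨r - w.2, by have := h2 hp; simp only [Set.mem_Iic]; linarith, ?_⟩
    ext
    · simp only [linePoint, Prod.fst_add, h1]; ring
    · simp only [linePoint, Prod.snd_add]; ring
  · rintro ⟨s, hs, rfl⟩
    have hs' : s ≤ r := hs
    refine ⟨linePoint κ i j s - linePoint κ i j r, by abel, ?_, fun h => absurd h hp, fun _ => ?_⟩
    · rw [linePoint_sub]; ring
    · rw [linePoint_sub]; simp only; linarith

/-- The parameter increases as ȳ decreases: an end at the west side leaves the parameter unbounded
above and gives a ray with ȳ → -∞, an end at the north side gives one with ȳ → +∞. -/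
theorem IsEdgeOn.edgePiece_eq {d : GoDart D} {i j : Fin n} {R : Set ℝ} (h : IsEdgeOn κ d i j R)
    (hij : κ i ≠ κ j) :
    (goMinus D).edgePiece κ (vertexPos κ) (fun x => x ∈ I) d i j = linePart κ i j R := by
  obtain ⟨hR, L, U, hL, hU, rfl⟩ := h
  have h' : (goMinus D).rev d = goRev d := rfl
  rw [linePart_eq_image hij]
  obtain ⟨v, r, h1, h2, rfl⟩ | ⟨x, hx, h1, rfl⟩ := hL <;>
  obtain ⟨v', r', h1', h2', rfl⟩ | ⟨x', hx', h1', rfl⟩ := hU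
  · obtain ⟨s, hs, hs'⟩ := hR.nonempty
    simp only [PlabicGraph.edgePiece, h', h1, h1', h2, h2']
    rw [Set.Ici_inter_Iic, segment_linePoint i j (le_trans (Set.mem_Ici.1 hs) hs')]
  · simp only [PlabicGraph.edgePiece, h', h1, h1', h2, Set.inter_univ]
    exact ray_linePoint_up i j r hx'
  · simp only [PlabicGraph.edgePiece, h', h1, h1', h2', Set.univ_inter]
    exact ray_linePoint_down i j r' hx
  · simp only [PlabicGraph.edgePiece, h', h1, h1', Set.inter_univ]
    rw [← linePart_eq_image hij]
    ext P
    simp [linePart]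

theorem nontrivial_Icc_iff {r s : ℝ} : (Set.Icc r s).Nontrivial ↔ r < s := by
  rw [← not_iff_not, Set.not_nontrivial_iff, Set.subsingleton_Icc_iff, not_lt]

theorem IsEdgeOn.hasSlope {d : GoDart D} {i j : Fin n} {R : Set ℝ} (h : IsEdgeOn κ d i j R)
    {v v' : (goMinus D).Vert} (hv : (goMinus D).tail d = Sum.inl v)
    (hv' : (goMinus D).tail (goRev d) = Sum.inl v') :
    HasSlope (vertexPos κ v' - vertexPos κ v) (κ i + κ j) := by
  obtain ⟨hR, L, U, hL, hU, rfl⟩ := h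
  obtain ⟨w, r, h1, h2, rfl⟩ | ⟨x, -, h1, -⟩ := hL
  swap
  · rw [hv] at h1; cases h1
  obtain ⟨w', r', h1', h2', rfl⟩ | ⟨x, -, h1', -⟩ := hU
  swap
  · rw [hv'] at h1'; cases h1'
  obtain rfl : v = w := Sum.inl.inj (hv.symm.trans h1)
  obtain rfl : v' = w' := Sum.inl.inj (hv'.symm.trans h1')
  rw [Set.Ici_inter_Iic, nontrivial_Icc_iff] at hR
  rw [h2, h2', linePoint_sub]
  exact ⟨neg_ne_zero.2 (sub_ne_zero.2 hR.ne'), by ring⟩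

theorem HasSlope.neg_sub {P Q : ℝ × ℝ} {s : ℝ} (h : HasSlope (P - Q) s) : HasSlope (Q - P) s := by
  obtain ⟨h1, h2⟩ := h
  rw [← _root_.neg_sub P Q]
  exact ⟨neg_ne_zero.2 h1, by rw [Prod.fst_neg, Prod.snd_neg, h2]; ring⟩

theorem isHighEnd_leaveWest (b : Blank D) : IsHighEnd κ (leaveWest b) b.1.1 b.pipeWest
    {r | ∀ h, r ≤ κ (b.nextWest h).1.2} := by
  unfold leaveWest
  by_cases h : b.westOf.Nonempty
  · rw [dif_pos h]
    refine Or.inl ⟨_, κ (b.nextWest h).1.2, rfl, ?_, ?_⟩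
    · rw [linePoint_apply, ← b.pipeNorth_nextWest h]; rfl
    · ext r; simp [h]
  · rw [dif_neg h]
    refine Or.inr ⟨_, b.row_mem, rfl, ?_⟩
    ext r; simp [h]

theorem isLowEnd_leaveNorth (b : Blank D) : IsLowEnd κ (leaveNorth b) b.pipeNorth b.1.2
    {r | ∀ h, κ (b.nextNorth h).1.1 ≤ r} := by
  unfold leaveNorth
  by_cases h : b.northOf.Nonempty
  · rw [dif_pos h]
    refine Or.inl ⟨_, κ (b.nextNorth h).1.1, rfl, ?_, ?_⟩
    · rw [linePoint_apply, ← b.pipeWest_nextNorth h, vPoint_swap_right, vPoint_swap_left]; rfl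
    · ext r; simp [h]
  · rw [dif_neg h]
    refine Or.inr ⟨_, b.col_notMem, rfl, ?_⟩
    ext r; simp [h]

/-- The edge from the west ends at the first kept vertex. If the black vertex is forgotten, the pipe
leaving west is the column's own, so the west and middle pieces are on one line and the edge goes on
to the white vertex. If that is forgotten too, the pipe leaving north is the row's own, and the
north piece joins the same line. -/
theorem isLowEnd_enterWest (b : Blank D) : ∃ L, IsLowEnd κ (enterWest b) b.1.1 b.pipeWest L ∧
    (b.southOf.Nonempty → L = Set.Ici (κ b.1.2)) ∧
    (¬ b.southOf.Nonempty → b.eastOf.Nonempty → L = Set.Ici (κ b.pipeNorth)) ∧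
    (¬ b.southOf.Nonempty → ¬ b.eastOf.Nonempty → L = {r | ∀ h, κ (b.nextNorth h).1.1 ≤ r}) := by
  unfold enterWest
  by_cases h : b.southOf.Nonempty
  · refine ⟨Set.Ici (κ b.1.2), ?_, by simp [h]⟩
    rw [dif_pos h]
    exact Or.inl ⟨_, κ b.1.2, rfl, (linePoint_apply _ _ _).symm, rfl⟩
  by_cases h' : b.eastOf.Nonempty
  · refine ⟨Set.Ici (κ b.pipeNorth), ?_, by simp [h, h']⟩
    rw [dif_neg h, dif_pos h', b.pipeWest_eq_col_iff.2 h]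
    exact Or.inl ⟨_, _, rfl, by rw [linePoint_apply, vPoint_swap_right]; rfl, rfl⟩
  · refine ⟨_, ?_, by simp [h], by simp [h'], fun _ _ => rfl⟩
    rw [dif_neg h, dif_neg h', b.pipeWest_eq_col_iff.2 h]
    have := isLowEnd_leaveNorth (κ := κ) b
    rwa [b.pipeNorth_eq_row_iff.2 h'] at this

theorem isHighEnd_enterNorth (b : Blank D) : ∃ U, IsHighEnd κ (enterNorth b) b.pipeNorth b.1.2 U ∧
    (b.eastOf.Nonempty → U = Set.Iic (κ b.1.1)) ∧
    (¬ b.eastOf.Nonempty → b.southOf.Nonempty → U = Set.Iic (κ b.pipeWest)) ∧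
    (¬ b.eastOf.Nonempty → ¬ b.southOf.Nonempty → U = {r | ∀ h, r ≤ κ (b.nextWest h).1.2}) := by
  unfold enterNorth
  by_cases h : b.eastOf.Nonempty
  · refine ⟨Set.Iic (κ b.1.1), ?_, by simp [h]⟩
    rw [dif_pos h]
    refine Or.inl ⟨_, κ b.1.1, rfl, ?_, rfl⟩
    rw [linePoint_apply, vPoint_swap_right, vPoint_swap_left]; rfl
  by_cases h' : b.southOf.Nonempty
  · refine ⟨Set.Iic (κ b.pipeWest), ?_, by simp [h, h']⟩
    rw [dif_neg h, dif_pos h', b.pipeNorth_eq_row_iff.2 h]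
    exact Or.inl ⟨_, _, rfl, by rw [linePoint_apply, vPoint_swap_right]; rfl, rfl⟩
  · refine ⟨_, ?_, by simp [h], by simp [h'], fun _ _ => rfl⟩
    rw [dif_neg h, dif_neg h', b.pipeNorth_eq_row_iff.2 h]
    have := isHighEnd_leaveWest (κ := κ) b
    rwa [b.pipeWest_eq_col_iff.2 h'] at this

theorem Blank.nontrivial_westRange (hκ : StrictMono κ) (b : Blank D) :
    (b.westRange κ).Nontrivial := by
  by_cases h : b.westOf.Nonempty
  · rw [westRange_of h, nontrivial_Icc_iff]; exact hκ (b.nextWest_lt h)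
  · rw [westRange_of_not h]
    exact ⟨κ b.1.2, Set.self_mem_Ici, κ b.1.2 + 1, by simp, by simp⟩

theorem Blank.nontrivial_northRange (hκ : StrictMono κ) (b : Blank D) :
    (b.northRange κ).Nontrivial := by
  by_cases h : b.northOf.Nonempty
  · rw [northRange_of h, nontrivial_Icc_iff]; exact hκ (b.nextNorth_lt h)
  · rw [northRange_of_not h]
    exact ⟨κ b.1.1, Set.self_mem_Iic, κ b.1.1 - 1, by simp, (sub_one_lt _).ne'⟩

/-- The part of the contour plot that belongs to a blank box. -/
def Blank.part (κ : Fin n → ℝ) (b : Blank D) : Set (ℝ × ℝ) :=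
  b.westPart κ ∪ b.midPart κ ∪ b.northPart κ

/-- The edge is the west piece, prolonged by the middle piece if the black vertex is forgotten and
by the north piece if both are; the parameter ranges abut at κ of the column and at κ of
`pipeNorth`. -/
theorem exists_isEdgeOn_enterWest (hκ : StrictMono κ) (b : Blank D) :
    ∃ R, IsEdgeOn κ (enterWest b) b.1.1 b.pipeWest R ∧ b.westRange κ ⊆ R ∧
      (¬ b.southOf.Nonempty → b.midRange κ ⊆ R) ∧ linePart κ b.1.1 b.pipeWest R ⊆ b.part κ := by
  obtain ⟨L, hL, h1, h2, h3⟩ := isLowEnd_enterWest (κ := κ) b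
  have hN := hκ.monotone b.row_le_pipeNorth
  have hC := hκ b.pipeNorth_lt_col
  have hW := hκ.monotone b.pipeWest_le_col
  have hnW := fun h => hκ (b.nextWest_lt h)
  have hnN := fun h => hκ (b.nextNorth_lt h)
  have hsub : b.westRange κ ⊆ L ∩ {r | ∀ h, r ≤ κ (b.nextWest h).1.2} := by
    rintro r ⟨hr, hr'⟩
    refine ⟨?_, hr'⟩
    by_cases hs : b.southOf.Nonempty
    · rw [h1 hs]; exact hr
    by_cases he : b.eastOf.Nonempty
    · rw [h2 hs he]; exact hC.le.trans hr
    · rw [h3 hs he]; exact fun h => by linarith [hnN h]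
  refine ⟨_, ⟨(b.nontrivial_westRange hκ).mono hsub, L, _, hL, ?_, rfl⟩, hsub, ?_, ?_⟩
  · rw [goRev_enterWest]; exact isHighEnd_leaveWest b
  · rintro hs r ⟨hr, hr'⟩
    refine ⟨?_, fun h => by linarith [hnW h]⟩
    by_cases he : b.eastOf.Nonempty
    · rw [h2 hs he]; exact hr
    · rw [h3 hs he]; exact fun h => by linarith [hnN h]
  · rintro P ⟨hP, hr, hr'⟩
    by_cases hr1 : κ b.1.2 ≤ -P.2 - κ b.1.1 - κ b.pipeWest
    · exact Or.inl (Or.inl ⟨hP, hr1, hr'⟩)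
    by_cases hs : b.southOf.Nonempty
    · rw [h1 hs] at hr; exact absurd hr hr1
    have hwc := b.pipeWest_eq_col_iff.2 hs
    rw [hwc] at hr hP hr1
    by_cases hr2 : κ b.pipeNorth ≤ -P.2 - κ b.1.1 - κ b.1.2
    · refine Or.inl (Or.inr ⟨hP, hr2, ?_⟩)
      rw [hwc]; exact (not_le.1 hr1).le
    by_cases he : b.eastOf.Nonempty
    · rw [h2 hs he] at hr; exact absurd hr hr2
    rw [h3 hs he] at hr
    have hpn := b.pipeNorth_eq_row_iff.2 he
    rw [hpn] at hr2
    refine Or.inr ?_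
    rw [Blank.northPart, hpn]
    exact ⟨hP, (not_le.1 hr2).le, hr⟩

theorem exists_isEdgeOn_leaveNorth (hκ : StrictMono κ) (b : Blank D) :
    ∃ R, IsEdgeOn κ (leaveNorth b) b.pipeNorth b.1.2 R ∧ b.northRange κ ⊆ R ∧
      (¬ b.eastOf.Nonempty → b.midRange κ ⊆ R) ∧ linePart κ b.pipeNorth b.1.2 R ⊆ b.part κ := by
  obtain ⟨U, hU, h1, h2, h3⟩ := isHighEnd_enterNorth (κ := κ) b
  have hN := hκ.monotone b.row_le_pipeNorth
  have hC := hκ b.row_lt_pipeWest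
  have hW := hκ.monotone b.pipeWest_le_col
  have hnW := fun h => hκ (b.nextWest_lt h)
  have hnN := fun h => hκ (b.nextNorth_lt h)
  have hsub : b.northRange κ ⊆ {r | ∀ h, κ (b.nextNorth h).1.1 ≤ r} ∩ U := by
    rintro r ⟨hr, hr'⟩
    refine ⟨hr', ?_⟩
    by_cases he : b.eastOf.Nonempty
    · rw [h1 he]; exact hr
    by_cases hs : b.southOf.Nonempty
    · rw [h2 he hs]; exact hr.trans hC.le
    · rw [h3 he hs]; exact fun h => by linarith [hnW h]
  refine ⟨_, ⟨(b.nontrivial_northRange hκ).mono hsub, _, U, isLowEnd_leaveNorth b, ?_, rfl⟩,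
    hsub, ?_, ?_⟩
  · rw [goRev_leaveNorth]; exact hU
  · rintro he r ⟨hr, hr'⟩
    refine ⟨fun h => by linarith [hnN h], ?_⟩
    by_cases hs : b.southOf.Nonempty
    · rw [h2 he hs]; exact hr'
    · rw [h3 he hs]; exact fun h => by linarith [hnW h]
  · rintro P ⟨hP, hr', hr⟩
    by_cases hr1 : -P.2 - κ b.pipeNorth - κ b.1.2 ≤ κ b.1.1
    · exact Or.inr ⟨hP, hr1, hr'⟩
    by_cases he : b.eastOf.Nonempty
    · rw [h1 he] at hr; exact absurd hr hr1
    have hpn := b.pipeNorth_eq_row_iff.2 he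
    rw [hpn] at hr hP hr1
    by_cases hr2 : -P.2 - κ b.1.1 - κ b.1.2 ≤ κ b.pipeWest
    · refine Or.inl (Or.inr ⟨hP, ?_, hr2⟩)
      rw [hpn]; exact (not_le.1 hr1).le
    by_cases hs : b.southOf.Nonempty
    · rw [h2 he hs] at hr; exact absurd hr hr2
    rw [h3 he hs] at hr
    have hwc := b.pipeWest_eq_col_iff.2 hs
    rw [hwc] at hr2
    refine Or.inl (Or.inl ?_)
    rw [Blank.westPart, hwc]
    exact ⟨hP, (not_le.1 hr2).le, hr⟩

theorem isEdgeOn_white_one (hκ : StrictMono κ) (b : Blank D) (h) (h' : b.southOf.Nonempty)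
    (hlt : b.pipeNorth < b.pipeWest) :
    IsEdgeOn κ (whiteDart b h 1) b.1.1 b.1.2 (b.midRange κ) := by
  refine ⟨nontrivial_Icc_iff.2 (hκ hlt), Set.Ici (κ b.pipeNorth), Set.Iic (κ b.pipeWest),
    Or.inl ⟨_, _, rfl, ?_, rfl⟩, ?_, Set.Ici_inter_Iic.symm⟩
  · rw [linePoint_apply, vPoint_swap_right]; rfl
  · rw [goRev_white_one, dif_pos h']
    refine Or.inl ⟨_, _, rfl, ?_, rfl⟩
    rw [linePoint_apply, vPoint_swap_right]; rfl

/-- Up to reversal, every half-edge enters a box from the west, leaves a box to the north, or joins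
the two kept vertices of a box. -/
theorem dart_induction {Q : GoDart D → Prop} (hrev : ∀ d, Q (goRev d) → Q d)
    (hW : ∀ b, Q (enterWest b)) (hN : ∀ b, Q (leaveNorth b))
    (hM : ∀ (b : Blank D) (h), b.southOf.Nonempty → Q (whiteDart b h 1)) (d : GoDart D) : Q d := by
  rcases d with ⟨⟨b, h⟩ | ⟨b, h⟩, m⟩ | ⟨x, hx⟩
  · obtain rfl | rfl | rfl : m = 0 ∨ m = 1 ∨ m = 2 := by omega
    · exact hrev _ (goRev_white_zero b h ▸ hN b)
    · by_cases hs : b.southOf.Nonempty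
      · exact hM b h hs
      · have : enterWest b = whiteDart b h 1 := by rw [enterWest, dif_neg hs, dif_pos h]
        have hQ := hW b
        rwa [this] at hQ
    · exact hrev _ (goRev_white_two b h ▸ hW _)
  · obtain rfl | rfl | rfl : m = 0 ∨ m = 1 ∨ m = 2 := by omega
    · have : enterWest b = blackDart b h 0 := by rw [enterWest, dif_pos h]
      have hQ := hW b
      rwa [this] at hQ
    · refine hrev _ (hrev _ ?_)
      change Q (goRev (goRev (blackDart b h 1)))
      rw [goRev_black_one, goRev_enterNorth]
      exact hN _
    · refine hrev _ ?_
      change Q (goRev (blackDart b h 2))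
      rw [goRev_black_two]
      split_ifs with he
      · exact hM b he h
      · exact hN b
  · rcases exists_isWestmost_or_isNorthmost hx with ⟨b, h⟩ | ⟨b, h⟩
    · exact hrev _ (h.goRev hx ▸ hW b)
    · refine hrev _ (hrev _ ?_)
      rw [h.goRev hx, goRev_enterNorth]
      exact hN b

theorem exists_isEdgeOn {e : List (Box I)} (he : IsReadingOrder e) (hD : IsGoDiagram e D)
    (hκ : StrictMono κ) (d : GoDart D) : ∃ (b : Blank D) (i j : Fin n) (R : Set ℝ), i < j ∧
      (goMinus D).edgeLabels d = {i, j} ∧ (IsEdgeOn κ d i j R ∨ IsEdgeOn κ (goRev d) i j R) ∧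
      linePart κ i j R ⊆ b.part κ := by
  have hbij := pipeAtEnd_bijective (D := D) he
  revert d
  refine dart_induction ?_ ?_ ?_ ?_
  · rintro d ⟨b, i, j, R, h1, h2, h3, h4⟩
    refine ⟨b, i, j, R, h1, ?_, ?_, h4⟩
    · rw [edgeLabels_eq hbij, goRev_goRev, Set.pair_comm] at h2
      rw [edgeLabels_eq hbij, h2]
    · rw [goRev_goRev] at h3
      exact h3.symm
  · intro b
    obtain ⟨R, h1, -, -, h2⟩ := exists_isEdgeOn_enterWest hκ b
    exact ⟨b, _, _, R, b.row_lt_pipeWest, by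
      rw [edgeLabels_eq hbij, goRev_enterWest, tripLabel_enterWest, tripLabel_leaveWest],
      Or.inl h1, h2⟩
  · intro b
    obtain ⟨R, h1, -, -, h2⟩ := exists_isEdgeOn_leaveNorth hκ b
    exact ⟨b, _, _, R, b.pipeNorth_lt_col, by
      rw [edgeLabels_eq hbij, goRev_leaveNorth, tripLabel_enterNorth, tripLabel_leaveNorth],
      Or.inl h1, h2⟩
  · intro b h hs
    exact ⟨b, _, _, _, b.row_lt_col, by
      rw [edgeLabels_eq hbij, tripLabel_goRev_white, tripLabel_white]; rfl,
      Or.inl (isEdgeOn_white_one hκ b h hs (b.pipeNorth_lt_pipeWest he hD)),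
      fun P hP => Or.inl (Or.inr hP)⟩

theorem hasSlope_of_edgeLabels {e : List (Box I)} (he : IsReadingOrder e) (hD : IsGoDiagram e D)
    (hκ : StrictMono κ) {d : GoDart D} {v v' : (goMinus D).Vert} {i j : Fin n}
    (hv : (goMinus D).tail d = Sum.inl v) (hv' : (goMinus D).tail (goRev d) = Sum.inl v')
    (hij : i < j) (hl : (goMinus D).edgeLabels d = {i, j}) :
    HasSlope (vertexPos κ v' - vertexPos κ v) (κ i + κ j) := by
  obtain ⟨-, i', j', R, hij', hl', h, -⟩ := exists_isEdgeOn he hD hκ d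
  obtain ⟨rfl, rfl⟩ := pair_eq_of_lt hij hij' (hl.symm.trans hl')
  rcases h with h | h
  · exact h.hasSlope hv hv'
  · exact (h.hasSlope hv' (by rwa [goRev_goRev])).neg_sub

theorem realization_eq {e : List (Box I)} (he : IsReadingOrder e) (hD : IsGoDiagram e D)
    (hκ : StrictMono κ) :
    (goMinus D).realization κ (vertexPos κ) (fun x => x ∈ I) = ⋃ b : Blank D, b.part κ := by
  have hbij := pipeAtEnd_bijective (D := D) he
  apply Set.Subset.antisymm
  · rintro P ⟨d, i, j, hij, hl, hP⟩
    obtain ⟨b, i', j', R, hij', hl', h, hsub⟩ := exists_isEdgeOn he hD hκ d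
    obtain ⟨rfl, rfl⟩ := pair_eq_of_lt hij hij' (hl.symm.trans hl')
    refine Set.mem_iUnion.2 ⟨b, hsub ?_⟩
    rcases h with h | h
    · rwa [h.edgePiece_eq (hκ hij).ne] at hP
    · exact (h.edgePiece_eq (hκ hij).ne).le ((edgePiece_goRev d i j _).ge hP)
  · have key : ∀ {d : GoDart D} {i j : Fin n} {R : Set ℝ}, i < j → tripLabel d = i →
        tripLabel (goRev d) = j → IsEdgeOn κ d i j R →
        linePart κ i j R ⊆ (goMinus D).realization κ (vertexPos κ) (fun x => x ∈ I) := by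
      rintro d i j R hij rfl rfl h P hP
      exact ⟨d, _, _, hij, edgeLabels_eq hbij d, by rwa [h.edgePiece_eq (hκ hij).ne]⟩
    refine Set.iUnion_subset fun b => ?_
    obtain ⟨R, h1, h2, h3, -⟩ := exists_isEdgeOn_enterWest hκ b
    obtain ⟨R', h1', h2', h3', -⟩ := exists_isEdgeOn_leaveNorth hκ b
    have k1 := key b.row_lt_pipeWest (tripLabel_enterWest b)
      (by rw [goRev_enterWest, tripLabel_leaveWest]) h1
    have k2 := key b.pipeNorth_lt_col (tripLabel_leaveNorth b)
      (by rw [goRev_leaveNorth, tripLabel_enterNorth]) h1'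
    refine Set.union_subset (Set.union_subset ?_ ?_) ?_
    · exact fun P hP => k1 ⟨hP.1, h2 hP.2⟩
    -- The middle piece is an edge by itself if both vertices are kept; otherwise it is absorbed by
    -- the edge to the north (white vertex forgotten) or to the west (black vertex forgotten).
    · by_cases hs : b.southOf.Nonempty
      · by_cases hE : b.eastOf.Nonempty
        · exact key b.row_lt_col rfl (tripLabel_goRev_white b hE 1)
            (isEdgeOn_white_one hκ b hE hs (b.pipeNorth_lt_pipeWest he hD))
        · rw [b.pipeNorth_eq_row_iff.2 hE] at k2
          exact fun P hP => k2 ⟨hP.1, h3' hE hP.2⟩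
      · rw [b.pipeWest_eq_col_iff.2 hs] at k1
        exact fun P hP => k1 ⟨hP.1, h3 hs hP.2⟩
    · exact fun P hP => k2 ⟨hP.1, h2' hP.2⟩

end Realization


/-! ### Rescaled contour plots -/

section Rescaling

variable {n k : ℕ} {κ : Fin n → ℝ}

/-- Nonlinearity is preserved by rescaling. -/
theorem mem_nonlinearLocus_of_smul {f g : ℝ × ℝ → ℝ} {c s : ℝ}
    (h : ∀ q, f q = c * g (s • q)) {q : ℝ × ℝ} (hq : q ∈ nonlinearLocus f) :
    s • q ∈ nonlinearLocus g := by
  rintro ⟨a, b, d, hg⟩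
  refine hq ⟨c * (a * s), c * (b * s), c * d, ?_⟩
  have hcont : Continuous fun q : ℝ × ℝ => s • q := by fun_prop
  filter_upwards [hcont.continuousAt.eventually hg] with q' hq'
  rw [h, hq', Prod.smul_fst, Prod.smul_snd, smul_eq_mul, smul_eq_mul]
  ring

theorem mem_nonlinearLocus_smul_iff {f g : ℝ × ℝ → ℝ} {c s : ℝ} (hs : s ≠ 0) (hc : c ≠ 0)
    (h : ∀ q, f q = c * g (s • q)) (q : ℝ × ℝ) :
    q ∈ nonlinearLocus f ↔ s • q ∈ nonlinearLocus g := by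
  refine ⟨mem_nonlinearLocus_of_smul h, fun hq => ?_⟩
  have h' : ∀ q, g q = c⁻¹ * f (s⁻¹ • q) := fun q => by
    rw [h, smul_smul, mul_inv_cancel₀ hs, one_smul, inv_mul_cancel_left₀ hc]
  have := mem_nonlinearLocus_of_smul h' hq
  rwa [smul_smul, inv_mul_cancel₀ hs, one_smul] at this

/-- Each exponent is t times the value of φ at (x/t, y/t), and the negative factor t exchanges
maximum and minimum. -/
theorem dominantExponent_eq {M : Matroid (Fin n)} {A : Matrix (Fin k) (Fin n) ℝ}
    (hA : A ∈ matroidStratum k M) {t : ℝ} (ht : t < 0) (q : ℝ × ℝ) :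
    dominantExponent κ A q.1 q.2 t =
      t * ⨅ J : {J : Finset (Fin n) // M.IsBase (J : Set (Fin n))}, ∑ j ∈ J.1, phi κ j (t⁻¹ • q) := by
  rw [Real.mul_iInf_of_nonpos ht.le]
  refine (Equiv.subtypeEquivRight fun J => (hA J).symm).iSup_congr fun J => ?_
  rw [Finset.mul_sum]
  refine Finset.sum_congr rfl fun j _ => ?_
  simp only [phi, Prod.smul_fst, Prod.smul_snd, smul_eq_mul]
  have h1 : t * t⁻¹ = 1 := mul_inv_cancel₀ ht.ne
  linear_combination (κ j * q.1 + κ j ^ 2 * q.2) * h1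

theorem image_contourPlot_eq {M : Matroid (Fin n)} {A : Matrix (Fin k) (Fin n) ℝ}
    (hA : A ∈ matroidStratum k M) {t : ℝ} (ht : t < 0) :
    (fun q : ℝ × ℝ => |t|⁻¹ • q) '' contourPlot κ A t =
      (fun q : ℝ × ℝ => -q) '' contourPlotNegInfinity κ M := by
  have h : ∀ q, q ∈ contourPlot κ A t ↔ t⁻¹ • q ∈ contourPlotNegInfinity κ M :=
    mem_nonlinearLocus_smul_iff (inv_ne_zero ht.ne) ht.ne (dominantExponent_eq hA ht)
  rw [abs_of_neg ht]
  ext q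
  constructor
  · rintro ⟨q, hq, rfl⟩
    exact ⟨_, (h q).1 hq, by simp [inv_neg]⟩
  · rintro ⟨q, hq, rfl⟩
    refine ⟨t • q, (h _).2 ?_, ?_⟩
    · rwa [smul_smul, inv_mul_cancel₀ ht.ne, one_smul]
    · simp only [smul_smul, inv_neg, neg_mul, inv_mul_cancel₀ ht.ne, neg_smul, one_smul]

end Rescaling

end KPSoliton

-- Assembly of the theorem.

theorem mainTheorem3 {n k : ℕ} (κ : Fin n → ℝ) (hκ : GenericParameters κ)
    (I : Finset (Fin n)) (hI : I.card = k)
    (e : List (Box I)) (he : IsReadingOrder e)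
    (D : Box I → Stone) (hD : IsGoDiagram e D) :
    (goMinus D).IsGeneralizedPlabic ∧
    (goMinus D).HasTripPermutation (goPerm e D) ∧
    (∀ d, ∃ i j, i < j ∧ (goMinus D).edgeLabels d = {i, j}) ∧
    (∃ pos : (goMinus D).Vert → ℝ × ℝ,
      Function.Injective pos ∧
      (∀ v, ∃ i l m, i < l ∧ l < m ∧ (goMinus D).HasVertexType v i l m ∧
        pos v = vPoint κ i l m) ∧
      (∀ d v v' i j, (goMinus D).tail d = Sum.inl v →
        (goMinus D).tail ((goMinus D).rev d) = Sum.inl v' →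
        i < j → (goMinus D).edgeLabels d = {i, j} → HasSlope (pos v' - pos v) (κ i + κ j)) ∧
      ∀ M : Matroid (Fin n), (matroidStratum k M ∩ deodharComponent k e D).Nonempty →
        contourPlotNegInfinity κ M = (goMinus D).realization κ pos (fun x => x ∈ I)) ∧
    (∀ M M' : Matroid (Fin n), (matroidStratum k M ∩ deodharComponent k e D).Nonempty →
      (matroidStratum k M' ∩ deodharComponent k e D).Nonempty →
      contourPlotNegInfinity κ M = contourPlotNegInfinity κ M') ∧
    (∀ M : Matroid (Fin n), (matroidStratum k M ∩ deodharComponent k e D).Nonempty →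
      ∀ A ∈ matroidStratum k M,
        (∀ t : ℝ, t < 0 → (fun q : ℝ × ℝ => |t|⁻¹ • q) '' contourPlot κ A t =
          (fun q : ℝ × ℝ => -q) '' contourPlotNegInfinity κ M) ∧
        Tendsto (fun t : ℝ => Metric.hausdorffEDist
            ((fun q : ℝ × ℝ => |t|⁻¹ • q) '' contourPlot κ A t)
            ((fun q : ℝ × ℝ => -q) '' contourPlotNegInfinity κ M)) atBot (𝓝 0)) := by
  have hbij := pipeAtEnd_bijective (D := D) he
  have hplot : ∀ M : Matroid (Fin n), (matroidStratum k M ∩ deodharComponent k e D).Nonempty →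
      contourPlotNegInfinity κ M = (goMinus D).realization κ (vertexPos κ) (fun x => x ∈ I) :=
    fun M hM => (contourPlotNegInfinity_eq hI he hD hκ hM).trans (realization_eq he hD hκ.1).symm
  refine ⟨goMinus_isGeneralizedPlabic he, goMinus_hasTripPermutation he,
    exists_edgeLabels_eq hbij, ⟨vertexPos κ, vertexPos_injective he hD hκ,
      exists_hasVertexType hbij, fun d v v' i j hv hv' hij hl =>
        hasSlope_of_edgeLabels he hD hκ.1 hv hv' hij hl, hplot⟩,
    fun M M' hM hM' => (hplot M hM).trans (hplot M' hM').symm,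
    fun M _ A hA => ⟨fun t ht => image_contourPlot_eq hA ht, ?_⟩⟩
  -- For t < 0 the two sets coincide, so the distance is constantly zero near -∞.
  refine tendsto_const_nhds.congr' ?_
  filter_upwards [eventually_lt_atBot (0 : ℝ)] with t ht
  rw [image_contourPlot_eq hA ht, Metric.hausdorffEDist_self]
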